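/- **Setting.** Let $p\ge 1$, $m\ge 1$, and let $d_1,\dots,d_p\ge 0$ be integers with $d_p>0$ and $\mathfrak l=\sum_{j\ge1} d_j\le m$; put $d_0=m-\mathfrak l$. Let $l_1,\dots,l_g$ be the positive numbers among $d_1,\dots,d_p$. Matrices with $n_{\min}=\sum_j j d_j$ rows are cut into row blocks indexed by $(r,l)$, $1\le r\le p$, $0\le l\le r-1$, the block $(r,l)$ having $d_r$ rows. Let $F$ be the nilpotent Jordan matrix whose block $F_{r,l;s,k}$ is the identity if $r=s$, $l=k+1$, and zero otherwise. For a real $n_{\min}\times m$ matrix $G$ let $G_{:,0}$ be the matrix formed by the blocks $G_{r,0}$. Let $\mathcal{GO}$ be the set of those $G$ with $G_{:,0}G_{:,0}'=I_{\mathfrak l}$ and $G_{\rho,l}G_{\rho_1,0}'=0$ for $l>\max(0,\rho-\rho_1-1)$. Let $\mathcal Q$ be the group of invertible matrices $Q$ that commute with $F$, are block diagonal, and satisfy $Q_{r,0;r,0}=\dots=Q_{r,r-1;r,r-1}$ and $Q_{r,0;r,0}Q_{r,0;r,0}'=I_{d_r}$; it acts on $\mathcal{GO}$ by left multiplication. Cut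 the rows of $O\in O(m)$ into blocks $O_p,\dots,O_1,O_0$ of sizes $d_p,\dots,d_1,d_0$. Let $$V=\bigoplus_{r=1}^p \mathrm{Mat}\Big(d_r,\ \sum_{l=1}^{r-1}\sum_{j=0}^{r-l-1}d_j\Big),$$ with elements $C=(C_{r,l})_{r>l>0}$, $C_{r,l}=(C_{r,l,j})_{0\le j\le r-l-1}$, $C_{r,l,j}\in\mathrm{Mat}(d_r,d_j)$. The pair $(C,O)$ represents the matrix $G$ with $G_{r,0}=O_r$ and $G_{r,l}=\sum_{j=0}^{r-l-1}C_{r,l,j}O_j$ for $l>0$. Let $\mathcal F=O(m)/(O(l_1)\times\dots\times O(l_g)\times O(m-\mathfrak l))$ be the real flag manifold, i.e. the set of orbits of the group of block diagonal orthogonal matrices (blocks of sizes $d_p,\dots,d_1,d_0$) acting on $O(m)$ from the left; $O(m)/O(m-\mathfrak l)$ is the set of orbits $O(m-\mathfrak l)O$ of its subgroup acting only on the last $m-\mathfrak l$ rows. Finally let $\kappa(G)$ be the block matrix with rows indexed by $(r,l)$, columns indexed by $i=1,\dots,p$, and blocks $\kappa(G)_{(r,l),i}=G_{r,r-l-i}$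 if $i\le r-l$ and $0$ otherwise, and, for $mp\times mp$ matrices $A,B$, let $\mathcal R(G)=\det(\kappa(G)A\kappa(G)')/\det(\kappa(G)B\kappa(G)')$. **Theorem.** 1. $Q\mapsto (Q_{r,0;r,0})_{d_r>0}$ is an isomorphism of topological groups $\mathcal Q\cong O(l_1)\times\dots\times O(l_g)$. 2. The elements of $\mathcal{GO}$ are exactly the matrices represented by pairs $(C,O)\in V\times O(m)$, and the map $\mathcal{GO}\to O(m)/O(m-\mathfrak l)$ that sends a matrix represented by $(C,O)$ to the class $O(m-\mathfrak l)O$ is well defined. 3. This map induces a map $\pi:\mathcal{GO}/\mathcal Q\to\mathcal F$. With the quotient topologies and the quotient smooth structures (a function is smooth exactly if its pullback to $\mathcal{GO}$, resp. $O(m)$, locally extends to a smooth function on the space of matrices), $\mathcal K=\mathcal{GO}/\mathcal Q$ and $\mathcal F$ are smooth manifolds, $\dim\mathcal F=\sum_{i>j\ge0}d_id_j$, and $\pi$ is a smooth real vector bundle with fibre $V$: for each $O\in O(m)$ the map sending $C$ to the class of the matrix represented by $(C,O)$ is a linear isomorphism of $V$ onto the fibre over the class of $O$. If $p=1$, or if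 $\mathfrak l=m$ and $d_id_j=0$ whenever $j\ge1$ and $i\ge j+2$ (in particular if $\mathfrak l=m$ and $p\le2$), then $\pi$ is a diffeomorphism, so that $\mathcal K$ is identified with $\mathcal F$. 4. $\dim\mathcal K = m\sum_{j>0}jd_j-\sum_{i\ge1}\big(\sum_{j\ge i}d_j\big)^2=\sum_{i>j\ge0}d_id_j+\sum_{r=1}^pd_r\sum_{l=1}^{r-1}\sum_{j=0}^{r-l-1}d_j$. 5. If $A$ is symmetric and $B$ is symmetric positive definite, then the denominator of $\mathcal R$ does not vanish on $\mathcal{GO}$, and $\mathcal R$ descends to a bounded smooth function on $\mathcal K$. -/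

import Mathlib

open scoped Manifold ContDiff Matrix Matrix.Norms.Elementwise

noncomputable section

/-- Structure parameters `d_1, …, d_p` of a nilpotent Jordan matrix together with the number `m` of
input variables: `p ≥ 1`, `d_p > 0`, and `𝔩 = d_1 + ⋯ + d_p ≤ m`.  The last condition is expressed
by recording `d_0 = m - 𝔩` as well.  The values `d j` with `j > p` play no role. -/
structure StructParam (p m : ℕ) where
  d : ℕ → ℕ
  one_le : 1 ≤ p
  top_pos : 0 < d p
  sum_eq : ∑ j ∈ Finset.range (p + 1), d j = m

namespace StructParam

variable {p m : ℕ} (P : StructParam p m)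

/-! ### Indices -/

/-- Row index of the state matrices.  The triple `⟨r, (l, a)⟩` is the `a`-th row of the block with
exponent `r + 1` and sub-index `l`, `0 ≤ l < r + 1`; that block has `d (r + 1)` rows.
There are `n_min = ∑ j d_j` such indices. -/
abbrev State : Type := Σ r : Fin p, Fin (r + 1) × Fin (P.d (r + 1))

/-- Row index of the submatrix made of the blocks with sub-index `0`; there are `𝔩` of them. -/
abbrev Top : Type := Σ r : Fin p, Fin (P.d (r + 1))

/-- Row index of an `m × m` matrix cut into `p + 1` row blocks of sizes `d_p, …, d_1, d_0`. -/
abbrev Row : Type := Σ j : Fin (p + 1), Fin (P.d j)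

/-- The rows of an `m × m` matrix are grouped from the top down into the block with label `p`
(of `d_p` rows), then the one with label `p - 1`, and so on down to the label `0`. -/
def row : P.Row ≃ Fin m :=
  ((Equiv.sigmaCongrLeft (β := fun j : Fin (p + 1) => Fin (P.d j)) Fin.revPerm).symm.trans
    finSigmaFinEquiv).trans (finCongr (by
      rw [Equiv.sum_comp Fin.revPerm (fun j : Fin (p + 1) => P.d j)]
      exact (Finset.sum_range _).symm.trans P.sum_eq))

/-! ### The Jordan matrix, the configuration space and the group acting on it -/

/-- The nilpotent Jordan matrix `K(p, d_p) ⊕ ⋯ ⊕ K(1, d_1)`: within the blocks of one exponent it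
maps the block with sub-index `l - 1` identically to the block with sub-index `l`. -/
def jordan : Matrix P.State P.State ℝ := fun x y =>
  if x.1 = y.1 ∧ (x.2.1 : ℕ) = y.2.1 + 1 ∧ (x.2.2 : ℕ) = y.2.2 then 1 else 0

/-- The block `G_{r+1, l}` of a state matrix. -/
def blk (G : Matrix P.State (Fin m) ℝ) (r : Fin p) (l : Fin (r + 1)) :
    Matrix (Fin (P.d (r + 1))) (Fin m) ℝ := fun a x => G ⟨r, (l, a)⟩ x

/-- The matrix `G_{:,0}` that collects the blocks with sub-index `0`. -/
def top (G : Matrix P.State (Fin m) ℝ) : Matrix P.Top (Fin m) ℝ :=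
  fun i x => G ⟨i.1, (0, i.2)⟩ x

/-- The configuration space `𝒢𝒪`: the rows of `G_{:,0}` are orthonormal (in particular `G_{:,0}` has
full row rank) and `G_{ρ,l} G_{ρ₁,0}' = 0` whenever `l > max(0, ρ - ρ₁ - 1)`. -/
def GO : Set (Matrix P.State (Fin m) ℝ) :=
  {G | P.top G * (P.top G)ᵀ = 1 ∧
    ∀ (r s : Fin p) (l : Fin (r + 1)),
      max 0 (((r : ℤ) + 1) - ((s : ℤ) + 1) - 1) < (l : ℤ) → P.blk G r l * (P.blk G s 0)ᵀ = 0}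

/-- The diagonal block `Q_{r+1,0; r+1,0}`. -/
def diagBlk (Q : Matrix P.State P.State ℝ) (r : Fin p) :
    Matrix (Fin (P.d (r + 1))) (Fin (P.d (r + 1))) ℝ :=
  fun a b => Q ⟨r, (0, a)⟩ ⟨r, (0, b)⟩

/-- `Q` commutes with the Jordan matrix, is block diagonal, all its diagonal blocks of the same
exponent agree, and they are orthogonal. -/
structure IsOrthBlockDiag (Q : Matrix P.State P.State ℝ) : Prop where
  comm : Q * P.jordan = P.jordan * Q
  off : ∀ (r s : Fin p) (j : Fin (r + 1)) (k : Fin (s + 1)) (a : Fin (P.d (r + 1)))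
    (b : Fin (P.d (s + 1))), ¬ (r = s ∧ (j : ℕ) = k) → Q ⟨r, (j, a)⟩ ⟨s, (k, b)⟩ = 0
  same : ∀ (r : Fin p) (j : Fin (r + 1)) (a b : Fin (P.d (r + 1))),
    Q ⟨r, (j, a)⟩ ⟨r, (j, b)⟩ = P.diagBlk Q r a b
  orth : ∀ r : Fin p, P.diagBlk Q r * (P.diagBlk Q r)ᵀ = 1

variable {P}

theorem IsOrthBlockDiag.mul_apply {Q : Matrix P.State P.State ℝ} (hQ : P.IsOrthBlockDiag Q)
    {ι : Type*} (N : Matrix P.State ι ℝ) (r : Fin p) (j : Fin (r + 1)) (a : Fin (P.d (r + 1)))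
    (y : ι) :
    (Q * N) ⟨r, (j, a)⟩ y = ∑ c, P.diagBlk Q r a c * N ⟨r, (j, c)⟩ y := by
  rw [Matrix.mul_apply, Fintype.sum_sigma, Finset.sum_eq_single r]
  · rw [Fintype.sum_prod_type, Finset.sum_eq_single j]
    · exact Finset.sum_congr rfl fun c _ => by rw [hQ.same]
    · intro k _ hk
      refine Finset.sum_eq_zero fun c _ => ?_
      rw [hQ.off _ _ _ _ _ _ (fun h => hk (Fin.ext h.2.symm)), zero_mul]
    · simp
  · intro s _ hs
    refine Finset.sum_eq_zero fun c _ => ?_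
    rw [hQ.off _ _ _ _ _ _ (fun h => hs h.1.symm), zero_mul]
  · simp

theorem IsOrthBlockDiag.one : P.IsOrthBlockDiag (1 : Matrix P.State P.State ℝ) where
  comm := by rw [Matrix.one_mul, Matrix.mul_one]
  off r s j k a b h := by
    rw [Matrix.one_apply_ne]
    intro e
    obtain ⟨rfl, e⟩ := Sigma.mk.inj_iff.1 e
    exact h ⟨rfl, congrArg (fun z => (z.1 : ℕ)) (eq_of_heq e)⟩
  same r j a b := by simp [diagBlk, Matrix.one_apply]
  orth r := by
    have : P.diagBlk 1 r = 1 := by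
      ext a b; simp [diagBlk, Matrix.one_apply]
    rw [this]; simp

theorem IsOrthBlockDiag.mul {Q R : Matrix P.State P.State ℝ} (hQ : P.IsOrthBlockDiag Q)
    (hR : P.IsOrthBlockDiag R) : P.IsOrthBlockDiag (Q * R) := by
  have key : ∀ r, P.diagBlk (Q * R) r = P.diagBlk Q r * P.diagBlk R r := by
    intro r; ext a b
    exact hQ.mul_apply R r 0 a _
  refine ⟨?_, ?_, ?_, ?_⟩
  · rw [mul_assoc, hR.comm, ← mul_assoc, hQ.comm, mul_assoc]
  · intro r s j k a b h
    rw [hQ.mul_apply]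
    refine Finset.sum_eq_zero fun c _ => ?_
    rw [hR.off _ _ _ _ _ _ h, mul_zero]
  · intro r j a b
    rw [hQ.mul_apply, key, Matrix.mul_apply]
    exact Finset.sum_congr rfl fun c _ => by rw [hR.same]
  · intro r
    rw [key, Matrix.transpose_mul, mul_assoc, ← mul_assoc (P.diagBlk R r), hR.orth, one_mul,
      hQ.orth]

theorem IsOrthBlockDiag.mul_transpose {Q : Matrix P.State P.State ℝ} (hQ : P.IsOrthBlockDiag Q) :
    Q * Qᵀ = 1 := by
  ext ⟨r, j, a⟩ ⟨s, k, b⟩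
  rw [hQ.mul_apply]
  by_cases h : r = s ∧ (j : ℕ) = k
  · obtain ⟨rfl, h⟩ := h
    obtain rfl := Fin.ext h
    have := congrFun (congrFun (hQ.orth r) a) b
    rw [Matrix.mul_apply] at this
    simp only [Matrix.transpose_apply, hQ.same] at this ⊢
    rw [this]
    simp [Matrix.one_apply]
  · rw [(IsOrthBlockDiag.one (P := P)).off _ _ _ _ _ _ h]
    refine Finset.sum_eq_zero fun c _ => ?_
    rw [Matrix.transpose_apply, hQ.off _ _ _ _ _ _ (fun h' => h ⟨h'.1.symm, h'.2.symm⟩), mul_zero]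

theorem IsOrthBlockDiag.transpose {Q : Matrix P.State P.State ℝ} (hQ : P.IsOrthBlockDiag Q) :
    P.IsOrthBlockDiag Qᵀ where
  comm := by
    have h1 := hQ.mul_transpose
    have h2 : Qᵀ * Q = 1 := mul_eq_one_comm.1 h1
    calc Qᵀ * P.jordan = Qᵀ * (P.jordan * Q) * Qᵀ := by simp only [mul_assoc, h1, mul_one]
      _ = P.jordan * Qᵀ := by rw [← hQ.comm, ← mul_assoc, h2, one_mul]
  off r s j k a b h := hQ.off _ _ _ _ _ _ (fun h' => h ⟨h'.1.symm, h'.2.symm⟩)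
  same r j a b := hQ.same r j b a
  orth r := mul_eq_one_comm.1 (hQ.orth r)

variable (P)

/-- The group `𝒬` of orthogonal block diagonal matrices commuting with the Jordan matrix. -/
def Q : Subgroup (Matrix P.State P.State ℝ)ˣ where
  carrier := {U | P.IsOrthBlockDiag (U : Matrix P.State P.State ℝ)}
  mul_mem' hU hV := hU.mul hV
  one_mem' := IsOrthBlockDiag.one
  inv_mem' := by
    intro U hU
    have h := hU.mul_transpose
    have h' : ((U⁻¹ : (Matrix P.State P.State ℝ)ˣ) : Matrix P.State P.State ℝ)
        = (U : Matrix P.State P.State ℝ)ᵀ := Units.inv_eq_of_mul_eq_one_right h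
    change P.IsOrthBlockDiag _
    rw [h']
    exact hU.transpose

/-- Two configurations are equivalent when they differ by left multiplication with an element
of `𝒬`. -/
def orbitSetoid : Setoid P.GO where
  r G G' := ∃ U ∈ P.Q, (U : Matrix P.State P.State ℝ) * G.1 = G'.1
  iseqv :=
    { refl := fun G => ⟨1, P.Q.one_mem, by simp⟩
      symm := by
        rintro G G' ⟨U, hU, h⟩
        exact ⟨U⁻¹, P.Q.inv_mem hU, by
          rw [← h, ← Matrix.mul_assoc, Units.inv_mul, Matrix.one_mul]⟩
      trans := by
        rintro G G' G'' ⟨U, hU, h⟩ ⟨V, hV, h'⟩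
        exact ⟨V * U, P.Q.mul_mem hV hU, by
          rw [← h', ← h, Units.val_mul, Matrix.mul_assoc]⟩ }

/-- The orbit space `𝒦 = 𝒢𝒪 / 𝒬`. -/
def K : Type := Quotient P.orbitSetoid

/-- `𝒦` carries the quotient topology. -/
instance : TopologicalSpace P.K := inferInstanceAs (TopologicalSpace (Quotient P.orbitSetoid))

/-- The class of a configuration. -/
def toK (G : P.GO) : P.K := Quotient.mk P.orbitSetoid G

/-! ### The flag manifold -/

/-- The subgroup `O(d_p) × ⋯ × O(d_1) × O(d_0)` of block diagonal matrices in `O(m)`; the factors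
with `d_r = 0` are trivial, so for `r ≥ 1` only the positive `d_r` contribute. -/
def blockDiag : Subgroup (Matrix.orthogonalGroup (Fin m) ℝ) where
  carrier := {U | ∀ x y : P.Row, x.1 ≠ y.1 → U.1 (P.row x) (P.row y) = 0}
  mul_mem' := by
    intro U V hU hV x y h
    change (U.1 * V.1) (P.row x) (P.row y) = 0
    rw [Matrix.mul_apply, ← Equiv.sum_comp P.row]
    refine Finset.sum_eq_zero fun z _ => ?_
    by_cases hz : x.1 = z.1
    · rw [hV z y (fun e => h (hz.trans e)), mul_zero]
    · rw [hU x z hz, zero_mul]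
  one_mem' := by
    intro x y h
    change (1 : Matrix (Fin m) (Fin m) ℝ) (P.row x) (P.row y) = 0
    rw [Matrix.one_apply_ne]
    intro e
    exact h (congrArg Sigma.fst (P.row.injective e))
  inv_mem' := by
    intro U hU x y h
    change (star U.1) (P.row x) (P.row y) = 0
    rw [Matrix.star_apply, hU y x (Ne.symm h), star_zero]

/-- The subgroup `O(m - 𝔩)` of `O(m)` that acts on the last block of `d_0 = m - 𝔩` rows only. -/
def lastBlock : Subgroup (Matrix.orthogonalGroup (Fin m) ℝ) where
  carrier := {U | ∀ x y : P.Row, (x.1 ≠ 0 ∨ y.1 ≠ 0) →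
    U.1 (P.row x) (P.row y) = (1 : Matrix P.Row P.Row ℝ) x y}
  mul_mem' := by
    intro U V hU hV x y h
    change (U.1 * V.1) (P.row x) (P.row y) = _
    rw [Matrix.mul_apply, ← Equiv.sum_comp P.row]
    rcases h with h | h
    · rw [Finset.sum_eq_single x]
      · rw [hU x x (Or.inl h), hV x y (Or.inl h), Matrix.one_apply_eq, one_mul]
      · intro z _ hz
        rw [hU x z (Or.inl h), Matrix.one_apply_ne (Ne.symm hz), zero_mul]
      · simp
    · rw [Finset.sum_eq_single y]
      · rw [hV y y (Or.inr h), hU x y (Or.inr h), Matrix.one_apply_eq, mul_one]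
      · intro z _ hz
        rw [hV z y (Or.inr h), Matrix.one_apply_ne hz, mul_zero]
      · simp
  one_mem' := by
    intro x y _
    change (1 : Matrix (Fin m) (Fin m) ℝ) (P.row x) (P.row y) = _
    simp [Matrix.one_apply]
  inv_mem' := by
    intro U hU x y h
    change (star U.1) (P.row x) (P.row y) = _
    rw [Matrix.star_apply, hU y x h.symm]
    simp [Matrix.one_apply, eq_comm]

theorem lastBlock_le : P.lastBlock ≤ P.blockDiag := by
  intro U hU x y h
  have h0 : x.1 ≠ 0 ∨ y.1 ≠ 0 := by
    by_contra hc
    push Not at hc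
    exact h (hc.1.trans hc.2.symm)
  rw [hU x y h0, Matrix.one_apply_ne]
  exact fun e => h (congrArg Sigma.fst e)

/-- The quotient `O(m) / O(m - 𝔩)`, whose points are the classes `O(m - 𝔩) O`. -/
def Stiefel : Type := Quotient (QuotientGroup.rightRel P.lastBlock)

/-- The real flag manifold `O(m) / (O(d_p) × ⋯ × O(d_1) × O(m - 𝔩))`, whose points are the classes of
`O` under left multiplication with the block diagonal subgroup. -/
def Flag : Type := Quotient (QuotientGroup.rightRel P.blockDiag)

/-- The flag manifold carries the quotient topology. -/
instance : TopologicalSpace P.Flag :=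
  inferInstanceAs (TopologicalSpace (Quotient (QuotientGroup.rightRel P.blockDiag)))

/-- The class `O(m - 𝔩) O`. -/
def toStiefel (O : Matrix.orthogonalGroup (Fin m) ℝ) : P.Stiefel :=
  Quotient.mk (QuotientGroup.rightRel P.lastBlock) O

/-- The class of `O` in the flag manifold. -/
def toFlag (O : Matrix.orthogonalGroup (Fin m) ℝ) : P.Flag :=
  Quotient.mk (QuotientGroup.rightRel P.blockDiag) O

/-- The natural projection `O(m) / O(m - 𝔩) → O(m) / (O(d_p) × ⋯ × O(d_1) × O(m - 𝔩))`. -/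
def stiefelToFlag : P.Stiefel → P.Flag :=
  Quotient.map' id (by
    intro O O' h
    rw [QuotientGroup.rightRel_apply] at h ⊢
    exact P.lastBlock_le h)

/-! ### The parametrization of configurations -/

/-- The vector space `⊕_{r=1}^p Mat(d_r, ∑_{l=1}^{r-1} ∑_{j=0}^{r-l-1} d_j)`.  Here `r : Fin p` stands
for the exponent `r + 1` and `l : Fin r` for the sub-index `l + 1`, so that `j` runs from `0` to
`(r + 1) - (l + 1) - 1`. -/
def Coef : Type :=
  (r : Fin p) → Matrix (Fin (P.d (r + 1))) (Σ l : Fin r, Σ j : Fin (r - l), Fin (P.d j)) ℝ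

/-- The norm on this finite-dimensional space is the largest absolute value of an entry. -/
instance : NormedAddCommGroup P.Coef :=
  inferInstanceAs (NormedAddCommGroup ((r : Fin p) →
    Matrix (Fin (P.d (r + 1))) (Σ l : Fin r, Σ j : Fin (r - l), Fin (P.d j)) ℝ))

instance : NormedSpace ℝ P.Coef :=
  inferInstanceAs (NormedSpace ℝ ((r : Fin p) →
    Matrix (Fin (P.d (r + 1))) (Σ l : Fin r, Σ j : Fin (r - l), Fin (P.d j)) ℝ))

/-- The matrix built from a pair `(C, O)`: `G_{r,0}` is the row block `O_r` of `O`, and for `l > 0`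
`G_{r,l} = ∑_{j=0}^{r-l-1} C_{r,l,j} O_j`, where `C_{r,l} = (C_{r,l,j})_j`. -/
def build (C : P.Coef) (O : Matrix (Fin m) (Fin m) ℝ) : Matrix P.State (Fin m) ℝ :=
  fun i x => Fin.cases
    (O (P.row ⟨i.1.succ, i.2.2⟩) x)
    (fun l : Fin i.1 => ∑ c : (Σ j : Fin (i.1 - l), Fin (P.d j)),
      C i.1 i.2.2 ⟨l, c⟩ * O (P.row ⟨⟨c.1, by omega⟩, c.2⟩) x)
    i.2.1

/-! ### The generalized Rayleigh quotient -/

/-- The matrix `κ(G)`.  Its block in the row `(r, l)` and in the column of lag `i`, `1 ≤ i ≤ p`, is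
`G_{r, r-l-i}` if `i ≤ r - l` and zero otherwise (`i : Fin p` stands for the lag `i + 1`). -/
def kappa (G : Matrix P.State (Fin m) ℝ) : Matrix P.State (Fin p × Fin m) ℝ :=
  fun x c => if (c.1 : ℕ) + x.2.1 ≤ x.1 then
      G ⟨x.1, (⟨x.1 - x.2.1 - c.1, by omega⟩, x.2.2)⟩ c.2 else 0

/-- `det(κ(G) A κ(G)') / det(κ(G) B κ(G)')`. -/
def rayleigh (A B : Matrix (Fin p × Fin m) (Fin p × Fin m) ℝ) (G : Matrix P.State (Fin m) ℝ) : ℝ :=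
  (P.kappa G * A * (P.kappa G)ᵀ).det / (P.kappa G * B * (P.kappa G)ᵀ).det

/-! ### The dimensions -/

/-- `∑_{i>j≥0} d_i d_j`. -/
def flagDim : ℕ := ∑ i ∈ Finset.range (p + 1), ∑ j ∈ Finset.range i, P.d i * P.d j

/-- `∑_{r=1}^p d_r ∑_{l=1}^{r-1} ∑_{j=0}^{r-l-1} d_j`. -/
def fibreDim : ℕ :=
  ∑ r ∈ Finset.Icc 1 p, P.d r * ∑ l ∈ Finset.Icc 1 (r - 1), ∑ j ∈ Finset.range (r - l), P.d j

/-- The fibre over `b` of a map `π : 𝒦 → ℱ`. -/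
def Fibre {P : StructParam p m} (π : P.K → P.Flag) (b : P.Flag) : Type := {x : P.K // π x = b}

variable {P}

/-- A fibre carries the subspace topology. -/
instance (π : P.K → P.Flag) (b : P.Flag) : TopologicalSpace (Fibre π b) :=
  inferInstanceAs (TopologicalSpace {x : P.K // π x = b})

/-- The union of the fibres of `π`, which is `𝒦` itself, with the topology of `𝒦`. -/
instance (π : P.K → P.Flag) : TopologicalSpace (Bundle.TotalSpace P.Coef (Fibre π)) :=
  TopologicalSpace.induced (fun z => z.2.1) inferInstance

end StructParam

/-! ### Smooth structures on quotients -/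

/-- Let `X` be a subset of a normed space, given by its inclusion `ι`.  A real function on `X` is
smooth on the relatively open set `W` if near each point of `W` it is the restriction of a smooth
function defined on an open set of the ambient space. -/
def SmoothOnSubset {X E : Type*} [NormedAddCommGroup E] [NormedSpace ℝ E] (ι : X → E) (W : Set X)
    (f : X → ℝ) : Prop :=
  ∀ x ∈ W, ∃ U : Set E, IsOpen U ∧ ι x ∈ U ∧
    ∃ g : E → ℝ, ContDiffOn ℝ ∞ g U ∧ ∀ y ∈ W, ι y ∈ U → f y = g (ι y)

/-- `M`, with the given atlas, is a smooth (Hausdorff, second countable) manifold of dimension `n`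
whose smooth structure is the quotient structure for the map `q : X → M` from a subset `X` of a
normed space: the topology is the quotient topology, and a function on an open subset of `M` is smooth
exactly if its composition with `q` is.  The last property determines the smooth structure. -/
structure IsSmoothQuotient (n : ℕ) {X E M : Type*} [TopologicalSpace X] [NormedAddCommGroup E]
    [NormedSpace ℝ E] [TopologicalSpace M] [ChartedSpace (EuclideanSpace ℝ (Fin n)) M]
    (ι : X → E) (q : X → M) : Prop where
  isManifold : IsManifold (𝓡 n) ∞ M
  hausdorff : T2Space M
  secondCountable : SecondCountableTopology M
  quotient : Topology.IsQuotientMap q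
  smooth_iff : ∀ (V : Set M), IsOpen V → ∀ f : M → ℝ,
    ContMDiffOn (𝓡 n) 𝓘(ℝ, ℝ) ∞ f V ↔ SmoothOnSubset ι (q ⁻¹' V) (f ∘ q)

end

/-! The orbits of `𝒬` are classified by the matrices `G_{r,0}ᵀ G_{r,l}`. Block orthogonal matrices
leave them unchanged. If they agree for `G` and `G'`, then the blocks `G'_{r,0} G_{r,0}ᵀ` are
orthogonal and carry `G` to `G'` (`toK_eq_toK_iff`). In particular `𝒦` injects continuously into a
space of matrices, so it is Hausdorff.

Complete the orthonormal rows of `G_{:,0}` to an orthogonal matrix `O`. The orthogonality relations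
of `𝒢𝒪` then say that `G_{r,l}`, `l > 0`, is a combination of the blocks `O_j` with `j ≤ r - l - 1`,
so `G` is represented by a pair `(C, O)`, and `O` is unique up to its last `d_0` rows. Once a
representative `S` of the flag is fixed, each orbit over that flag contains exactly one
configuration represented by a pair `(C, S)`, with `C_{r,l,j} = S_r G_{r,0}ᵀ G_{r,l} S_jᵀ`
(`coef_build`, `buildK_coefK`). Replacing `S` by `D S` with `D` block diagonal changes `C_{r,l,j}`
to `D_r C_{r,l,j} D_jᵀ`. This is linear in `C`, so `𝒦` is in effect the vector bundle with fibre `V`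
associated with `O(m) → ℱ`.

Charts of `ℱ` and local sections of `O(m) → ℱ` come from block LU factorization. Where the leading
block minors do not vanish, a matrix is a block triangular matrix times a block unipotent one, and
the unipotent factor gives the coordinates. Conversely, Gram–Schmidt turns a block unipotent matrix
into an orthogonal one with the same coordinates. An orthogonal block triangular matrix is block
diagonal, so on `O(m)` equal coordinates mean equal flags (`flagSect_flagCoord`). Translation by `R
∈ O(m)` moves the chart to any point. Both quotients receive their manifold structure from one
device, `QuotientSlice`.

`𝒦` is not compact unless the fibre is zero, so boundedness of the Rayleigh quotient is proved
algebraically: `κ(G)` has full row rank by a block echelon argument, and after normalization its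
rows are orthonormal, which bounds the determinant. The two dimension formulas agree by induction on
`p`. -/

noncomputable section

/-! ### Smooth structures on quotients defined by slices -/

/-- A slice for the quotient map `q` from a subset `X` of a normed space `E`, given by its inclusion
`ι`: a smooth function `coord` on an open set `dom` that is constant on the fibres of `q`, and a smooth
map `sect` into `X` that meets each fibre of `q` in `dom` exactly once and is inverse to `coord`. -/
structure QuotientSlice {X E M : Type*} [NormedAddCommGroup E] [NormedSpace ℝ E] (ι : X → E)
    (q : X → M) (F : Type*) [NormedAddCommGroup F] [NormedSpace ℝ F] where
  dom : Set E
  coord : E → F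
  sect : F → X
  isOpen_dom : IsOpen dom
  contDiffOn_coord : ContDiffOn ℝ ∞ coord dom
  contDiff_sect : ContDiff ℝ ∞ (ι ∘ sect)
  sect_mem : ∀ t, ι (sect t) ∈ dom
  coord_sect : ∀ t, coord (ι (sect t)) = t
  saturated : ∀ x y, q x = q y → ι x ∈ dom → ι y ∈ dom ∧ coord (ι x) = coord (ι y)
  q_sect_coord : ∀ x, ι x ∈ dom → q (sect (coord (ι x))) = q x

namespace QuotientSlice

variable {X E M F : Type*} [NormedAddCommGroup E] [NormedSpace ℝ E] [NormedAddCommGroup F]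
  [NormedSpace ℝ F] {ι : X → E} {q : X → M}

/-- The set of classes that meet the domain of a slice. -/
def baseSet (S : QuotientSlice ι q F) : Set M := q '' (ι ⁻¹' S.dom)

theorem mem_baseSet (S : QuotientSlice ι q F) {x : X} : q x ∈ S.baseSet ↔ ι x ∈ S.dom :=
  ⟨fun ⟨y, hy, h⟩ => (S.saturated y x h hy).1, fun h => ⟨x, h, rfl⟩⟩

theorem preimage_baseSet (S : QuotientSlice ι q F) : q ⁻¹' S.baseSet = ι ⁻¹' S.dom :=
  Set.ext fun _ => S.mem_baseSet

open Classical in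
/-- The coordinate function of a slice, as a function on the quotient. -/
def toFun (S : QuotientSlice ι q F) (y : M) : F :=
  -- On `baseSet` the choice of representative is immaterial by `saturated`; elsewhere the value has
  -- no meaning.
  if h : ∃ x, q x = y then S.coord (ι h.choose) else 0

theorem toFun_apply (S : QuotientSlice ι q F) {x : X} (hx : ι x ∈ S.dom) :
    S.toFun (q x) = S.coord (ι x) := by
  have h : ∃ x', q x' = q x := ⟨x, rfl⟩
  rw [toFun, dif_pos h]
  exact (S.saturated x _ h.choose_spec.symm hx).2.symm

/-- Change of the model space of a slice by a linear isomorphism. -/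
def congr {F' : Type*} [NormedAddCommGroup F'] [NormedSpace ℝ F'] (S : QuotientSlice ι q F)
    (L : F ≃L[ℝ] F') : QuotientSlice ι q F' where
  dom := S.dom
  coord := L ∘ S.coord
  sect := S.sect ∘ L.symm
  isOpen_dom := S.isOpen_dom
  contDiffOn_coord := L.contDiff.comp_contDiffOn S.contDiffOn_coord
  contDiff_sect := S.contDiff_sect.comp L.symm.contDiff
  sect_mem t := S.sect_mem _
  coord_sect t := by simp [S.coord_sect]
  saturated x y h hx := ⟨(S.saturated x y h hx).1, congrArg L (S.saturated x y h hx).2⟩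
  q_sect_coord x hx := by simpa using S.q_sect_coord x hx

variable [TopologicalSpace X]

theorem continuous_sect (S : QuotientSlice ι q F) (hι : Topology.IsInducing ι) :
    Continuous S.sect :=
  hι.continuous_iff.2 S.contDiff_sect.continuous

variable [TopologicalSpace M]

theorem isOpen_baseSet (S : QuotientSlice ι q F) (hι : Topology.IsInducing ι)
    (hq : Topology.IsQuotientMap q) : IsOpen S.baseSet := by
  rw [← hq.isOpen_preimage, S.preimage_baseSet]
  exact S.isOpen_dom.preimage hι.continuous

/-- The chart defined by a slice. -/
def chart (S : QuotientSlice ι q F) (hι : Topology.IsInducing ι)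
    (hq : Topology.IsQuotientMap q) : OpenPartialHomeomorph M F where
  toFun := S.toFun
  invFun := q ∘ S.sect
  source := S.baseSet
  target := Set.univ
  map_source' _ _ := Set.mem_univ _
  map_target' t _ := S.mem_baseSet.2 (S.sect_mem t)
  left_inv' := by
    rintro _ ⟨x, hx, rfl⟩
    rw [S.toFun_apply hx]
    exact S.q_sect_coord x hx
  right_inv' t _ := (S.toFun_apply (S.sect_mem t)).trans (S.coord_sect t)
  open_source := S.isOpen_baseSet hι hq
  open_target := isOpen_univ
  continuousOn_toFun := by
    rw [hq.continuousOn_isOpen_iff (S.isOpen_baseSet hι hq), S.preimage_baseSet]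
    refine (S.contDiffOn_coord.continuousOn.comp hι.continuous.continuousOn
      (Set.mapsTo_preimage _ _)).congr fun x hx => ?_
    exact S.toFun_apply hx
  continuousOn_invFun := (hq.continuous.comp (S.continuous_sect hι)).continuousOn

@[simp]
theorem chart_source (S : QuotientSlice ι q F) (hι : Topology.IsInducing ι)
    (hq : Topology.IsQuotientMap q) : (S.chart hι hq).source = S.baseSet := rfl

@[simp]
theorem chart_target (S : QuotientSlice ι q F) (hι : Topology.IsInducing ι)
    (hq : Topology.IsQuotientMap q) : (S.chart hι hq).target = Set.univ := rfl

theorem chart_apply (S : QuotientSlice ι q F) (hι : Topology.IsInducing ι)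
    (hq : Topology.IsQuotientMap q) {x : X} (hx : ι x ∈ S.dom) :
    S.chart hι hq (q x) = S.coord (ι x) := S.toFun_apply hx

@[simp]
theorem chart_symm_apply (S : QuotientSlice ι q F) (hι : Topology.IsInducing ι)
    (hq : Topology.IsQuotientMap q) (t : F) : (S.chart hι hq).symm t = q (S.sect t) := rfl

variable {A : Type*}

/-- The charted space defined by a family of slices that covers the quotient. -/
@[reducible]
def chartedSpace (S : A → QuotientSlice ι q F)
    (hι : Topology.IsInducing ι) (hq : Topology.IsQuotientMap q)
    (hS : ∀ x, ∃ a, ι x ∈ (S a).dom) : ChartedSpace F M where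
  atlas := Set.range fun a => (S a).chart hι hq
  chartAt y := (S (hS (hq.surjective y).choose).choose).chart hι hq
  mem_chart_source y := by
    have h := ((S _).mem_baseSet (ι := ι) (q := q)).2 (hS (hq.surjective y).choose).choose_spec
    rwa [(hq.surjective y).choose_spec] at h
  chart_mem_atlas y := ⟨_, rfl⟩

variable [ChartedSpace F M] {S : A → QuotientSlice ι q F} {hι : Topology.IsInducing ι}
  {hq : Topology.IsQuotientMap q}

/-- A transition map is `coord` of one slice after `sect` of another, a composition of smooth maps
between normed spaces. -/
theorem isManifold (hA : atlas F M = Set.range fun a => (S a).chart hι hq) :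
    IsManifold 𝓘(ℝ, F) ∞ M := by
  refine isManifold_of_contDiffOn 𝓘(ℝ, F) ∞ M fun e e' he he' => ?_
  rw [hA] at he he'
  obtain ⟨a, rfl⟩ := he
  obtain ⟨b, rfl⟩ := he'
  have hmem : ∀ t, q ((S a).sect t) ∈ (S b).baseSet → ι ((S a).sect t) ∈ (S b).dom :=
    fun t ht => (S b).mem_baseSet.1 ht
  refine ((S b).contDiffOn_coord.comp (S a).contDiff_sect.contDiffOn
    (t := (S b).dom) (s := {t | q ((S a).sect t) ∈ (S b).baseSet}) hmem).congr_mono ?_ ?_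
  · intro t ht
    have ht' : q ((S a).sect t) ∈ (S b).baseSet := by simpa using ht
    exact (S b).toFun_apply (hmem t ht')
  · intro t ht
    simpa using ht

theorem contMDiffOn_chart (hA : atlas F M = Set.range fun a => (S a).chart hι hq) (a : A) :
    ContMDiffOn 𝓘(ℝ, F) 𝓘(ℝ, F) ∞ ((S a).chart hι hq) (S a).baseSet := by
  have := isManifold hA
  exact contMDiffOn_of_mem_maximalAtlas
    (IsManifold.subset_maximalAtlas (hA ▸ Set.mem_range_self a : _ ∈ atlas F M))

theorem contMDiff_chart_symm (hA : atlas F M = Set.range fun a => (S a).chart hι hq) (a : A) :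
    ContMDiff 𝓘(ℝ, F) 𝓘(ℝ, F) ∞ ((S a).chart hι hq).symm := by
  have := isManifold hA
  rw [← contMDiffOn_univ]
  exact contMDiffOn_symm_of_mem_maximalAtlas
    (IsManifold.subset_maximalAtlas (hA ▸ Set.mem_range_self a : _ ∈ atlas F M))

/-- Countably many preimages of chart domains cover the second countable space `X`, so countably
many chart domains cover `M`. -/
theorem secondCountableTopology (hq : Topology.IsQuotientMap q) [SecondCountableTopology X]
    [FiniteDimensional ℝ F] :
    SecondCountableTopology M := by
  have : ProperSpace F := FiniteDimensional.proper ℝ F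
  obtain ⟨s, hs, hsu⟩ := TopologicalSpace.countable_cover_nhds (α := X)
    (f := fun x => q ⁻¹' (chartAt F (q x)).source) fun x =>
      ((chartAt F (q x)).open_source.preimage hq.continuous).mem_nhds (mem_chart_source F (q x))
  refine ChartedSpace.secondCountable_of_countable_cover F (s := q '' s) ?_ (hs.image q)
  refine Set.eq_univ_of_forall fun y => ?_
  obtain ⟨x, rfl⟩ := hq.surjective y
  obtain ⟨z, hz, hx⟩ := Set.mem_iUnion₂.1 (hsu ▸ Set.mem_univ x)
  exact Set.mem_iUnion₂.2 ⟨q z, ⟨z, hz, rfl⟩, hx⟩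

/-- In one direction `f ∘ q ∘ sect ∘ coord` is a local smooth extension of `f ∘ q`; in the other, a
local extension `g` gives `f = g ∘ ι ∘ sect ∘ chart`. -/
theorem contMDiffOn_iff_smoothOnSubset (hA : atlas F M = Set.range fun a => (S a).chart hι hq)
    (hS : ∀ x, ∃ a, ι x ∈ (S a).dom) {V : Set M} (hV : IsOpen V) (f : M → ℝ) :
    ContMDiffOn 𝓘(ℝ, F) 𝓘(ℝ, ℝ) ∞ f V ↔ SmoothOnSubset ι (q ⁻¹' V) (f ∘ q) := by
  constructor
  · intro hf x hx
    obtain ⟨a, ha⟩ := hS x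
    have hc : ContDiffOn ℝ ∞ (f ∘ (q ∘ (S a).sect)) ((q ∘ (S a).sect) ⁻¹' V) := by
      rw [← contMDiffOn_iff_contDiffOn]
      exact hf.comp (contMDiff_chart_symm hA a).contMDiffOn (Set.mapsTo_preimage _ _)
    have hO : IsOpen ((q ∘ (S a).sect) ⁻¹' V) :=
      hV.preimage (hq.continuous.comp ((S a).continuous_sect hι))
    refine ⟨(S a).dom ∩ (S a).coord ⁻¹' ((q ∘ (S a).sect) ⁻¹' V),
      (S a).contDiffOn_coord.continuousOn.isOpen_inter_preimage (S a).isOpen_dom hO, ⟨ha, ?_⟩,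
      (f ∘ (q ∘ (S a).sect)) ∘ (S a).coord,
      hc.comp ((S a).contDiffOn_coord.mono Set.inter_subset_left) Set.inter_subset_right, ?_⟩
    · change q _ ∈ V
      rwa [(S a).q_sect_coord x ha]
    · intro y _ hy
      exact congrArg f ((S a).q_sect_coord y hy.1).symm
  · intro hf y hy
    obtain ⟨x, rfl⟩ := hq.surjective y
    obtain ⟨a, ha⟩ := hS x
    -- The section passes through `x'`, in general not through `x`, so the local extension is taken
    -- near `x'`.
    set x' := (S a).sect ((S a).coord (ι x)) with hx'
    have hqx : q x' = q x := (S a).q_sect_coord x ha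
    obtain ⟨U, hU, hxU, g, hg, hfg⟩ := hf x' (by rwa [Set.mem_preimage, hqx])
    have hO : IsOpen ((ι ∘ (S a).sect) ⁻¹' U) := hU.preimage (S a).contDiff_sect.continuous
    have hgs : ContDiffOn ℝ ∞ (g ∘ (ι ∘ (S a).sect)) ((ι ∘ (S a).sect) ⁻¹' U) :=
      hg.comp (S a).contDiff_sect.contDiffOn (Set.mapsTo_preimage _ _)
    have hcx : (S a).chart hι hq (q x) ∈ (ι ∘ (S a).sect) ⁻¹' U := by
      rw [(S a).chart_apply hι hq ha]; exact hxU
    have hat : ContMDiffAt 𝓘(ℝ, F) 𝓘(ℝ, ℝ) ∞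
        ((g ∘ (ι ∘ (S a).sect)) ∘ (S a).chart hι hq) (q x) :=
      ContMDiffAt.comp (q x) ((hgs.contDiffAt (hO.mem_nhds hcx)).contMDiffAt)
        ((contMDiffOn_chart hA a).contMDiffAt
          (((S a).isOpen_baseSet hι hq).mem_nhds ((S a).mem_baseSet.2 ha)))
    refine (hat.congr_of_eventuallyEq ?_).contMDiffWithinAt
    have hnb : (V ∩ ((S a).baseSet ∩ (S a).chart hι hq ⁻¹' ((ι ∘ (S a).sect) ⁻¹' U)))
        ∈ nhds (q x) :=
      Filter.inter_mem (hV.mem_nhds hy)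
        ((((S a).chart hι hq).isOpen_inter_preimage hO).mem_nhds ⟨(S a).mem_baseSet.2 ha, hcx⟩)
    filter_upwards [hnb] with z hz
    obtain ⟨hzV, hzS, hzU⟩ := hz
    have hz' : q ((S a).sect ((S a).chart hι hq z)) = z :=
      ((S a).chart hι hq).left_inv hzS
    have := hfg ((S a).sect ((S a).chart hι hq z)) (by rwa [Set.mem_preimage, hz']) hzU
    rw [Function.comp_apply, hz'] at this
    exact this

theorem isSmoothQuotient {n : ℕ} [ChartedSpace (EuclideanSpace ℝ (Fin n)) M]
    [T2Space M] [SecondCountableTopology X]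
    {S : A → QuotientSlice ι q (EuclideanSpace ℝ (Fin n))}
    (hA : atlas (EuclideanSpace ℝ (Fin n)) M = Set.range fun a => (S a).chart hι hq)
    (hS : ∀ x, ∃ a, ι x ∈ (S a).dom) : IsSmoothQuotient n ι q where
  isManifold := isManifold hA
  hausdorff := inferInstance
  secondCountable := secondCountableTopology (F := EuclideanSpace ℝ (Fin n)) hq
  quotient := hq
  smooth_iff _ hV f := contMDiffOn_iff_smoothOnSubset hA hS hV f

end QuotientSlice
end

noncomputable section

/-! ### Smoothness of matrix operations -/

section MatrixSmooth

variable {E : Type*} [NormedAddCommGroup E] [NormedSpace ℝ E] {s : Set E} {k l n : Type*}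
  [Fintype k] [Fintype l] [Fintype n]

theorem contDiffOn_matrix {A : E → Matrix k l ℝ} :
    ContDiffOn ℝ ∞ A s ↔ ∀ i j, ContDiffOn ℝ ∞ (fun x => A x i j) s :=
  contDiffOn_pi.trans (forall_congr' fun _ => contDiffOn_pi)

theorem ContDiffOn.matrix_mul {A : E → Matrix k l ℝ} {B : E → Matrix l n ℝ}
    (hA : ContDiffOn ℝ ∞ A s) (hB : ContDiffOn ℝ ∞ B s) :
    ContDiffOn ℝ ∞ (fun x => A x * B x) s := by
  rw [contDiffOn_matrix] at hA hB ⊢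
  intro i j
  simp only [Matrix.mul_apply]
  exact ContDiffOn.sum fun c _ => (hA i c).mul (hB c j)

theorem ContDiffOn.matrix_transpose {A : E → Matrix k l ℝ} (hA : ContDiffOn ℝ ∞ A s) :
    ContDiffOn ℝ ∞ (fun x => (A x)ᵀ) s := by
  rw [contDiffOn_matrix] at hA ⊢
  exact fun i j => hA j i

theorem ContDiffOn.matrix_det [DecidableEq k] {A : E → Matrix k k ℝ} (hA : ContDiffOn ℝ ∞ A s) :
    ContDiffOn ℝ ∞ (fun x => (A x).det) s := by
  rw [contDiffOn_matrix] at hA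
  simp only [Matrix.det_apply']
  exact ContDiffOn.sum fun σ _ => contDiffOn_const.mul (contDiffOn_prod fun i _ => hA _ _)

/-- Cramer's rule: the entries of the inverse are minors divided by the determinant. -/
theorem ContDiffOn.matrix_inv [DecidableEq k] {A : E → Matrix k k ℝ} (hA : ContDiffOn ℝ ∞ A s)
    (h : ∀ x ∈ s, (A x).det ≠ 0) : ContDiffOn ℝ ∞ (fun x => (A x)⁻¹) s := by
  rw [contDiffOn_matrix]
  intro i j
  simp only [Matrix.inv_def, Matrix.smul_apply, smul_eq_mul, Ring.inverse_eq_inv',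
    Matrix.adjugate_apply]
  refine (hA.matrix_det.inv h).mul (ContDiffOn.matrix_det ?_)
  rw [contDiffOn_matrix] at hA ⊢
  intro a b
  simp only [Matrix.updateRow_apply]
  split_ifs
  · exact contDiffOn_const
  · exact hA a b

end MatrixSmooth

/-! ### Block elimination -/

section BlockElimination

variable {ι : Type*} [DecidableEq ι] (lab : ι → ℕ)

/-- The matrix that agrees with `Y` in the rows and columns with label at least `k` and with the
identity elsewhere. -/
def blockCore (k : ℕ) (Y : Matrix ι ι ℝ) : Matrix ι ι ℝ := fun x y =>
  if k ≤ lab x ∧ k ≤ lab y then Y x y else (1 : Matrix ι ι ℝ) x y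

variable {lab}

theorem blockCore_of_le {k : ℕ} {Y : Matrix ι ι ℝ} {x y : ι} (hx : k ≤ lab x) (hy : k ≤ lab y) :
    blockCore lab k Y x y = Y x y := if_pos ⟨hx, hy⟩

theorem blockCore_of_lt_left {k : ℕ} {Y : Matrix ι ι ℝ} {x y : ι} (hx : lab x < k) :
    blockCore lab k Y x y = (1 : Matrix ι ι ℝ) x y := if_neg fun h => hx.not_ge h.1

theorem blockCore_of_lt_right {k : ℕ} {Y : Matrix ι ι ℝ} {x y : ι} (hy : lab y < k) :
    blockCore lab k Y x y = (1 : Matrix ι ι ℝ) x y := if_neg fun h => hy.not_ge h.2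

theorem blockCore_one (k : ℕ) : blockCore lab k (1 : Matrix ι ι ℝ) = 1 := by
  ext x y
  exact ite_self _

theorem blockCore_zero (Y : Matrix ι ι ℝ) : blockCore lab 0 Y = Y := by
  ext x y
  exact blockCore_of_le (Nat.zero_le _) (Nat.zero_le _)

/-- The rows with label `0` do not enter the proper leading blocks. This matters because a
configuration determines only the rows with positive label. -/
theorem blockCore_congr {Y Y' : Matrix ι ι ℝ} (h : ∀ x, 1 ≤ lab x → Y x = Y' x) {k : ℕ}
    (hk : 1 ≤ k) : blockCore lab k Y = blockCore lab k Y' := by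
  ext x y
  unfold blockCore
  split_ifs with hxy
  · rw [h x (hk.trans hxy.1)]
  · rfl

variable [Fintype ι]

/-- Rows of `L` with label at least `k` vanish in the columns of smaller label, so the leading block
of the product is the product of the leading blocks. `Y` need not be triangular. -/
theorem blockCore_mul {L : Matrix ι ι ℝ} (hL : L.BlockTriangular lab) (k : ℕ)
    (Y : Matrix ι ι ℝ) : blockCore lab k (L * Y) = blockCore lab k L * blockCore lab k Y := by
  ext x y
  rw [Matrix.mul_apply]
  rcases lt_or_ge (lab x) k with hx | hx
  · rw [blockCore_of_lt_left hx, Finset.sum_eq_single x]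
    · rw [blockCore_of_lt_left hx, blockCore_of_lt_left hx, Matrix.one_apply_eq, one_mul]
    · intro w _ hw
      rw [blockCore_of_lt_left hx, Matrix.one_apply_ne hw.symm, zero_mul]
    · simp
  rcases lt_or_ge (lab y) k with hy | hy
  · rw [blockCore_of_lt_right hy, Finset.sum_eq_single y]
    · rw [blockCore_of_lt_right hy, blockCore_of_lt_right hy, Matrix.one_apply_eq, mul_one]
    · intro w _ hw
      rw [blockCore_of_lt_right (x := w) hy, Matrix.one_apply_ne hw, mul_zero]
    · simp
  rw [blockCore_of_le hx hy, Matrix.mul_apply]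
  refine Finset.sum_congr rfl fun w _ => ?_
  rcases lt_or_ge (lab w) k with hw | hw
  · rw [hL (hw.trans_le hx), blockCore_of_lt_right hw, Matrix.one_apply_ne, zero_mul, zero_mul]
    rintro rfl
    exact hw.not_ge hx
  · rw [blockCore_of_le hx hw, blockCore_of_le hw hy]

/-- The core of `L⁻¹` is a right inverse of the core of `L`. -/
theorem det_blockCore_ne_zero {L : Matrix ι ι ℝ} (hL : L.BlockTriangular lab) (h : L.det ≠ 0)
    (k : ℕ) : (blockCore lab k L).det ≠ 0 := by
  have h1 := blockCore_mul hL k L⁻¹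
  rw [Matrix.mul_nonsing_inv _ (isUnit_iff_ne_zero.2 h), blockCore_one] at h1
  intro h0
  have := congrArg Matrix.det h1
  rw [Matrix.det_mul, h0, zero_mul, Matrix.det_one] at this
  exact one_ne_zero this

variable (lab)

/-- The coefficients of the block row operations that bring `Y` to block unipotent form. -/
def blockElim (Y : Matrix ι ι ℝ) : Matrix ι ι ℝ := fun x y => (blockCore lab (lab x) Y)⁻¹ x y

/-- The matrices whose leading block minors, apart from the determinant, do not vanish. -/
def bigCell : Set (Matrix ι ι ℝ) := {Y | ∀ x, 1 ≤ lab x → (blockCore lab (lab x) Y).det ≠ 0}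

/-- The positions in the strictly upper block triangular part. -/
abbrev UpperIdx : Type _ := {z : ι × ι // lab z.2 < lab z.1}

/-- The strictly upper block triangular part of the block unipotent form of a matrix. -/
def flagCoord (Y : Matrix ι ι ℝ) : UpperIdx lab → ℝ := fun z => (blockElim lab Y * Y) z.1.1 z.1.2

/-- The block unipotent matrix with a given strictly upper block triangular part. -/
def unip (t : UpperIdx lab → ℝ) : Matrix ι ι ℝ := fun x z =>
  if h : lab z < lab x then t ⟨(x, z), h⟩ else (1 : Matrix ι ι ℝ) x z

variable {lab}

/-- In the columns of label below `lab x` the core is the identity, hence so is its inverse. -/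
theorem blockElim_of_lt {Y : Matrix ι ι ℝ} {x y : ι} (h : (blockCore lab (lab x) Y).det ≠ 0)
    (hy : lab y < lab x) : blockElim lab Y x y = 0 := by
  have h1 := congrFun (congrFun (Matrix.nonsing_inv_mul _ (isUnit_iff_ne_zero.2 h)) x) y
  rw [Matrix.mul_apply, Finset.sum_eq_single y, blockCore_of_lt_left hy, Matrix.one_apply_eq,
    mul_one, Matrix.one_apply_ne] at h1
  · exact h1
  · rintro rfl
    exact lt_irrefl _ hy
  · intro w _ hw
    rw [blockCore_of_lt_right hy, Matrix.one_apply_ne hw, mul_zero]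
  · simp

theorem blockElim_mul_self_of_le {Y : Matrix ι ι ℝ} {x z : ι}
    (h : (blockCore lab (lab x) Y).det ≠ 0) (hz : lab x ≤ lab z) :
    (blockElim lab Y * Y) x z = (1 : Matrix ι ι ℝ) x z := by
  rw [← Matrix.nonsing_inv_mul _ (isUnit_iff_ne_zero.2 h), Matrix.mul_apply, Matrix.mul_apply]
  refine Finset.sum_congr rfl fun w _ => ?_
  rcases lt_or_ge (lab w) (lab x) with hw | hw
  · have := blockElim_of_lt h hw
    rw [this, zero_mul]
    rw [blockElim] at this
    rw [this, zero_mul]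
  · rw [blockCore_of_le hw hz, blockElim]

theorem blockElim_mul_self {Y : Matrix ι ι ℝ} {x : ι} (h : (blockCore lab (lab x) Y).det ≠ 0)
    (z : ι) : (blockElim lab Y * Y) x z = unip lab (flagCoord lab Y) x z := by
  unfold unip
  split_ifs with hz
  · rfl
  · exact blockElim_mul_self_of_le h (not_lt.1 hz)

/-- The leading blocks of `L * Y` factor by `blockCore_mul`, and their inverses absorb `L`. This is
the uniqueness of the block LU factorization. -/
theorem blockElim_mul {L Y : Matrix ι ι ℝ} (hL : L.BlockTriangular lab) (hdet : L.det ≠ 0) {x : ι}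
    (h : (blockCore lab (lab x) Y).det ≠ 0) (v : ι) :
    (blockElim lab (L * Y) * L) x v = blockElim lab Y x v := by
  have hLk := det_blockCore_ne_zero hL hdet (lab x)
  have hLY : (blockCore lab (lab x) (L * Y)).det ≠ 0 := by
    rw [blockCore_mul hL, Matrix.det_mul]
    exact mul_ne_zero hLk h
  rw [Matrix.mul_apply]
  rcases lt_or_ge (lab v) (lab x) with hv | hv
  · rw [blockElim_of_lt h hv]
    refine Finset.sum_eq_zero fun w _ => ?_
    rcases lt_or_ge (lab w) (lab x) with hw | hw
    · rw [blockElim_of_lt hLY hw, zero_mul]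
    · rw [hL (hv.trans_le hw), mul_zero]
  · have h1 : (blockCore lab (lab x) (L * Y))⁻¹ * blockCore lab (lab x) L
        = (blockCore lab (lab x) Y)⁻¹ := by
      rw [blockCore_mul hL, Matrix.mul_inv_rev, Matrix.mul_assoc,
        Matrix.nonsing_inv_mul _ (isUnit_iff_ne_zero.2 hLk), Matrix.mul_one]
    rw [blockElim, ← h1, Matrix.mul_apply]
    refine Finset.sum_congr rfl fun w _ => ?_
    rcases lt_or_ge (lab w) (lab x) with hw | hw
    · have := blockElim_of_lt hLY hw
      rw [this, zero_mul]
      rw [blockElim] at this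
      rw [this, zero_mul]
    · rw [blockCore_of_le hw hv, blockElim]

theorem mul_mem_bigCell {L Y : Matrix ι ι ℝ} (hL : L.BlockTriangular lab) (hdet : L.det ≠ 0) :
    L * Y ∈ bigCell lab ↔ Y ∈ bigCell lab := by
  refine forall₂_congr fun x _ => ?_
  rw [blockCore_mul hL, Matrix.det_mul, mul_ne_zero_iff,
    and_iff_right (det_blockCore_ne_zero hL hdet _)]

/-- Regroup `blockElim lab (L * Y) * L * Y`. The coordinates thus do not distinguish matrices that
differ by an invertible block triangular left factor, in particular representatives of one flag. -/
theorem flagCoord_mul {L Y : Matrix ι ι ℝ} (hL : L.BlockTriangular lab) (hdet : L.det ≠ 0)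
    (hY : Y ∈ bigCell lab) : flagCoord lab (L * Y) = flagCoord lab Y := by
  funext z
  have h := hY z.1.1 (Nat.one_le_of_lt z.2)
  rw [flagCoord, flagCoord, ← Matrix.mul_assoc, Matrix.mul_apply, Matrix.mul_apply]
  exact Finset.sum_congr rfl fun w _ => by rw [blockElim_mul hL hdet h]

theorem mem_bigCell_congr {Y Y' : Matrix ι ι ℝ} (h : ∀ x, 1 ≤ lab x → Y x = Y' x) :
    Y ∈ bigCell lab ↔ Y' ∈ bigCell lab :=
  forall₂_congr fun x hx => by rw [blockCore_congr h hx]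

/-- This allows the flag coordinates to be computed from the top rows of a configuration completed
by zero rows, with no choice of an orthogonal completion. -/
theorem flagCoord_congr {Y Y' : Matrix ι ι ℝ} (h : ∀ x, 1 ≤ lab x → Y x = Y' x)
    (hY : Y ∈ bigCell lab) : flagCoord lab Y = flagCoord lab Y' := by
  funext ⟨⟨x, z⟩, hz⟩
  have hx : 1 ≤ lab x := Nat.one_le_of_lt hz
  rw [flagCoord, flagCoord, Matrix.mul_apply, Matrix.mul_apply]
  refine Finset.sum_congr rfl fun w _ => ?_
  have he : blockElim lab Y x w = blockElim lab Y' x w := by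
    rw [blockElim, blockElim, blockCore_congr h hx]
  change blockElim lab Y x w * Y w z = blockElim lab Y' x w * Y' w z
  rw [← he]
  -- The possibly different rows of label `0` are multiplied by coefficients that vanish.
  rcases Nat.eq_zero_or_pos (lab w) with hw | hw
  · rw [blockElim_of_lt (hY x hx) (by omega), zero_mul, zero_mul]
  · rw [h w hw]

theorem isOpen_bigCell : IsOpen (bigCell lab) := by
  have : bigCell lab = ⋂ x, {Y : Matrix ι ι ℝ | 1 ≤ lab x → (blockCore lab (lab x) Y).det ≠ 0} := by
    ext Y; simp [bigCell]
  rw [this]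
  refine isOpen_iInter_of_finite fun x => ?_
  by_cases hx : 1 ≤ lab x
  · simp only [hx, true_imp_iff]
    refine isOpen_ne_fun (Continuous.matrix_det ?_) continuous_const
    refine continuous_pi fun a => continuous_pi fun b => ?_
    simp only [blockCore]
    split_ifs
    · exact continuous_apply_apply a b
    · exact continuous_const
  · simp [hx]

theorem contDiffOn_blockCore {k : ℕ} {s : Set (Matrix ι ι ℝ)} :
    ContDiffOn ℝ ∞ (blockCore lab k) s := by
  rw [contDiffOn_matrix]
  intro a b
  simp only [blockCore]
  split_ifs
  · exact contDiffOn_matrix.1 contDiffOn_id a b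
  · exact contDiffOn_const

theorem contDiffOn_flagCoord : ContDiffOn ℝ ∞ (flagCoord lab) (bigCell lab) := by
  rw [contDiffOn_pi]
  rintro ⟨⟨x, z⟩, hz⟩
  have hx : 1 ≤ lab x := Nat.one_le_of_lt hz
  simp only [flagCoord, Matrix.mul_apply]
  refine ContDiffOn.sum fun w _ => ContDiffOn.mul ?_ (contDiffOn_matrix.1 contDiffOn_id w z)
  exact contDiffOn_matrix.1 (ContDiffOn.matrix_inv (s := bigCell lab) contDiffOn_blockCore
    fun Y hY => hY x hx) x w

theorem contDiff_unip : ContDiff ℝ ∞ (unip lab) := by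
  rw [← contDiffOn_univ, contDiffOn_matrix]
  intro a b
  simp only [unip]
  split_ifs with h
  · exact (contDiff_apply ℝ ℝ (⟨(a, b), h⟩ : UpperIdx lab)).contDiffOn
  · exact contDiffOn_const

theorem one_mem_bigCell : (1 : Matrix ι ι ℝ) ∈ bigCell lab := fun x _ => by
  simp [blockCore_one]

/-- An orthogonal block triangular matrix is block diagonal. -/
theorem Matrix.BlockTriangular.apply_eq_zero_of_orthogonal {D : Matrix ι ι ℝ}
    (hD : D.BlockTriangular lab) (h : D * Dᵀ = 1) {x y : ι} (hxy : lab x ≠ lab y) : D x y = 0 := by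
  rcases lt_or_gt_of_ne hxy with hlt | hgt
  · have : Invertible D := invertibleOfRightInverse D Dᵀ h
    have h1 := Matrix.blockTriangular_inv_of_blockTriangular hD
    rw [Matrix.inv_eq_right_inv h] at h1
    exact h1 hlt
  · exact hD hgt

end BlockElimination

end

noncomputable section

/-! ### Orthonormalization of the rows of a matrix -/

section GramSchmidt

variable {m : ℕ}

/-- The rows of a matrix as Euclidean vectors. -/
def euclideanRow (A : Matrix (Fin m) (Fin m) ℝ) (x : Fin m) : EuclideanSpace ℝ (Fin m) :=
  WithLp.toLp 2 (A x)

theorem inner_euclideanRow (A B : Matrix (Fin m) (Fin m) ℝ) (x y : Fin m) :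
    inner ℝ (euclideanRow A x) (euclideanRow B y) = (A * Bᵀ) x y := by
  simp [euclideanRow, PiLp.inner_apply, Matrix.mul_apply, mul_comm]

theorem linearIndependent_euclideanRow {A : Matrix (Fin m) (Fin m) ℝ} (h : A.det ≠ 0) :
    LinearIndependent ℝ (euclideanRow A) := by
  have h1 : LinearIndependent ℝ A.row :=
    Matrix.linearIndependent_rows_iff_isUnit.2 ((Matrix.isUnit_iff_isUnit_det _).2
      (isUnit_iff_ne_zero.2 h))
  exact h1.map' (WithLp.linearEquiv 2 ℝ (Fin m → ℝ)).symm.toLinearMap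
    (LinearEquiv.ker _)

/-- The matrix whose rows are obtained from those of `A` by orthonormalization. -/
def gramSchmidtRows (A : Matrix (Fin m) (Fin m) ℝ) : Matrix (Fin m) (Fin m) ℝ := fun x y =>
  InnerProductSpace.gramSchmidtNormed ℝ (euclideanRow A) x y

theorem euclideanRow_gramSchmidtRows (A : Matrix (Fin m) (Fin m) ℝ) (x : Fin m) :
    euclideanRow (gramSchmidtRows A) x
      = InnerProductSpace.gramSchmidtNormed ℝ (euclideanRow A) x := rfl

theorem gramSchmidtRows_mul_transpose {A : Matrix (Fin m) (Fin m) ℝ} (h : A.det ≠ 0) :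
    gramSchmidtRows A * (gramSchmidtRows A)ᵀ = 1 := by
  have ho := InnerProductSpace.gramSchmidtNormed_orthonormal (linearIndependent_euclideanRow h)
  ext x y
  rw [← inner_euclideanRow, euclideanRow_gramSchmidtRows, euclideanRow_gramSchmidtRows,
    orthonormal_iff_ite.1 ho, Matrix.one_apply]

/-- Row `x` of `A` lies in the span of the orthonormalized rows up to `x`, so `A` is a lower
triangular matrix times `gramSchmidtRows A` when `A` is invertible. -/
theorem mul_gramSchmidtRows_transpose_of_lt (A : Matrix (Fin m) (Fin m) ℝ) {x y : Fin m}
    (h : x < y) : (A * (gramSchmidtRows A)ᵀ) x y = 0 := by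
  rw [← inner_euclideanRow, euclideanRow_gramSchmidtRows, InnerProductSpace.gramSchmidtNormed,
    inner_smul_right, real_inner_comm, InnerProductSpace.gramSchmidt_inv_triangular ℝ _ h, mul_zero]

/-- By induction on the row: each vector is a rational expression in the given row and the earlier
vectors, with squared norms as denominators, which are nonzero by linear independence. -/
theorem contDiff_gramSchmidtRows {E : Type*} [NormedAddCommGroup E] [NormedSpace ℝ E]
    {A : E → Matrix (Fin m) (Fin m) ℝ} (hA : ContDiff ℝ ∞ A) (h : ∀ t, (A t).det ≠ 0) :
    ContDiff ℝ ∞ fun t => gramSchmidtRows (A t) := by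
  have hli t := linearIndependent_euclideanRow (h t)
  have hrow : ∀ x, ContDiff ℝ ∞ fun t => euclideanRow (A t) x := by
    intro x
    rw [contDiff_euclidean]
    intro i
    exact contDiffOn_univ.1 (contDiffOn_matrix.1 hA.contDiffOn x i)
  have key : ∀ x, ContDiff ℝ ∞
      fun t => InnerProductSpace.gramSchmidt ℝ (euclideanRow (A t)) x := by
    intro x
    induction x using WellFoundedLT.induction with
    | ind x ih =>
      simp only [InnerProductSpace.gramSchmidt_def ℝ _ x, Submodule.starProjection_singleton]
      refine (hrow x).sub (ContDiff.sum fun i hi => ?_)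
      have hi' := ih i (Finset.mem_Iio.1 hi)
      refine ContDiff.fun_smul (𝕜 := ℝ) (𝕜' := ℝ) ?_ hi'
      refine (hi'.inner ℝ (hrow x)).div ?_ fun t => ?_
      · simpa using hi'.norm_sq ℝ
      · have := InnerProductSpace.gramSchmidt_ne_zero i (hli t)
        simpa using this
  rw [← contDiffOn_univ, contDiffOn_matrix]
  intro x i
  rw [contDiffOn_univ]
  have hx : ContDiff ℝ ∞
      fun t => InnerProductSpace.gramSchmidtNormed ℝ (euclideanRow (A t)) x := by
    simp only [InnerProductSpace.gramSchmidtNormed]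
    refine ContDiff.fun_smul (𝕜 := ℝ) (𝕜' := ℝ) ?_ (key x)
    exact ((key x).norm ℝ fun t => InnerProductSpace.gramSchmidt_ne_zero x (hli t)).inv fun t => by
      simpa using InnerProductSpace.gramSchmidt_ne_zero x (hli t)
  exact contDiff_euclidean.1 hx i

end GramSchmidt

/-! ### The orthogonal section over the big cell -/

section FlagSection

variable {m : ℕ} {lab : Fin m → ℕ}

theorem det_unip (hlab : Antitone lab) (t : UpperIdx lab → ℝ) : (unip lab t).det = 1 := by
  rw [Matrix.det_of_isUpperTriangular]
  · exact Finset.prod_eq_one fun x _ => by simp [unip]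
  · intro x z (hxz : z < x)
    rw [unip, dif_neg (hlab hxz.le).not_gt, Matrix.one_apply_ne hxz.ne']

theorem blockCore_unip_row (t : UpperIdx lab → ℝ) (x z : Fin m) :
    blockCore lab (lab x) (unip lab t) x z = (1 : Matrix (Fin m) (Fin m) ℝ) x z := by
  unfold blockCore
  split_ifs with h
  · rw [unip, dif_neg h.2.not_gt]
  · rfl

theorem unip_mem_bigCell (hlab : Antitone lab) (t : UpperIdx lab → ℝ) :
    unip lab t ∈ bigCell lab := by
  intro x _
  rw [Matrix.det_of_isUpperTriangular, Finset.prod_eq_one]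
  · exact one_ne_zero
  · intro z _
    simp [blockCore, unip]
  · intro y z (hyz : z < y)
    unfold blockCore
    rw [unip, dif_neg (hlab hyz.le).not_gt, ite_self, Matrix.one_apply_ne hyz.ne']

/-- Row `x` of the core at level `lab x` is already a row of the identity, so the elimination does
nothing. -/
theorem flagCoord_unip (hlab : Antitone lab) (t : UpperIdx lab → ℝ) :
    flagCoord lab (unip lab t) = t := by
  funext ⟨⟨x, z⟩, hz⟩
  have hdet := unip_mem_bigCell hlab t x (Nat.one_le_of_lt hz)
  have hrow : ∀ w, blockElim lab (unip lab t) x w = (1 : Matrix (Fin m) (Fin m) ℝ) x w := by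
    intro w
    rw [← Matrix.mul_nonsing_inv _ (isUnit_iff_ne_zero.2 hdet), Matrix.mul_apply,
      Finset.sum_eq_single x]
    · rw [blockCore_unip_row, Matrix.one_apply_eq, one_mul, blockElim]
    · intro v _ hv
      rw [blockCore_unip_row, Matrix.one_apply_ne hv.symm, zero_mul]
    · simp
  change (blockElim lab (unip lab t) * unip lab t) x z = _
  rw [Matrix.mul_apply, Finset.sum_eq_single x]
  · rw [hrow, Matrix.one_apply_eq, one_mul, unip, dif_pos hz]
  · intro v _ hv
    rw [hrow, Matrix.one_apply_ne hv.symm, zero_mul]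
  · simp

/-- The orthogonal matrix whose flag has given coordinates. -/
def flagSect (hlab : Antitone lab) (t : UpperIdx lab → ℝ) : Matrix.orthogonalGroup (Fin m) ℝ :=
  ⟨gramSchmidtRows (unip lab t), (Matrix.mem_orthogonalGroup_iff _ _).2 (by
    exact gramSchmidtRows_mul_transpose (by rw [det_unip hlab]; exact one_ne_zero))⟩

theorem Matrix.orthogonalGroup.mul_transpose (O : Matrix.orthogonalGroup (Fin m) ℝ) :
    O.1 * O.1ᵀ = 1 := (Matrix.mem_orthogonalGroup_iff _ _).1 O.2

theorem Matrix.orthogonalGroup.transpose_mul (O : Matrix.orthogonalGroup (Fin m) ℝ) :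
    O.1ᵀ * O.1 = 1 := (Matrix.mem_orthogonalGroup_iff' _ _).1 O.2

theorem Matrix.orthogonalGroup.det_ne_zero (O : Matrix.orthogonalGroup (Fin m) ℝ) :
    O.1.det ≠ 0 := fun h => by
  have := congrArg Matrix.det (Matrix.orthogonalGroup.mul_transpose O)
  rw [Matrix.det_mul, h, zero_mul, Matrix.det_one] at this
  exact zero_ne_one this

theorem contDiff_flagSect (hlab : Antitone lab) :
    ContDiff ℝ ∞ fun t => ((flagSect hlab t).1 : Matrix (Fin m) (Fin m) ℝ) :=
  contDiff_gramSchmidtRows contDiff_unip fun t => by rw [det_unip hlab]; exact one_ne_zero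

/-- The block triangular factor of a block unipotent matrix. -/
theorem exists_unip_eq_mul_flagSect (hlab : Antitone lab) (t : UpperIdx lab → ℝ) :
    ∃ L : Matrix (Fin m) (Fin m) ℝ, L.BlockTriangular lab ∧ L.det ≠ 0 ∧
      unip lab t = L * (flagSect hlab t).1 := by
  have h : unip lab t = unip lab t * (flagSect hlab t).1ᵀ * (flagSect hlab t).1 := by
    rw [Matrix.mul_assoc, Matrix.orthogonalGroup.transpose_mul, Matrix.mul_one]
  refine ⟨unip lab t * (flagSect hlab t).1ᵀ, ?_, ?_, h⟩
  · intro x y hxy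
    refine mul_gramSchmidtRows_transpose_of_lt _ (lt_of_not_ge fun hyx => ?_)
    exact hxy.not_ge (hlab hyx)
  · intro h0
    have := congrArg Matrix.det h
    rw [Matrix.det_mul, h0, zero_mul, det_unip hlab] at this
    exact one_ne_zero this

theorem flagSect_mem_bigCell (hlab : Antitone lab) (t : UpperIdx lab → ℝ) :
    (flagSect hlab t).1 ∈ bigCell lab := by
  obtain ⟨L, hL, hdet, h⟩ := exists_unip_eq_mul_flagSect hlab t
  rw [← mul_mem_bigCell hL hdet, ← h]
  exact unip_mem_bigCell hlab t

/-- `unip lab t` and its orthonormalization differ by a block triangular factor, which the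
coordinates ignore. -/
theorem flagCoord_flagSect (hlab : Antitone lab) (t : UpperIdx lab → ℝ) :
    flagCoord lab (flagSect hlab t).1 = t := by
  obtain ⟨L, hL, hdet, h⟩ := exists_unip_eq_mul_flagSect hlab t
  rw [← flagCoord_mul hL hdet (flagSect_mem_bigCell hlab t), ← h, flagCoord_unip hlab]

/-- `O` and `S` have the same block unipotent form up to block triangular left factors, so `S * O⁻¹`
is block triangular. Being orthogonal, it is block diagonal, which means that both represent the
same flag. -/
theorem flagSect_flagCoord (hlab : Antitone lab) {O : Matrix.orthogonalGroup (Fin m) ℝ}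
    (hO : O.1 ∈ bigCell lab) {x y : Fin m} (hxy : lab x ≠ lab y) :
    (flagSect hlab (flagCoord lab O.1) * O⁻¹).1 x y = 0 := by
  set S := flagSect hlab (flagCoord lab O.1) with hS
  obtain ⟨L, hL, hdet, h⟩ := exists_unip_eq_mul_flagSect hlab (flagCoord lab O.1)
  have hne : ∀ x, (blockCore lab (lab x) O.1).det ≠ 0 := by
    intro x
    -- At label `0` the core is all of `O`; the big cell says nothing about its determinant, but
    -- orthogonality does.
    rcases Nat.eq_zero_or_pos (lab x) with hx | hx
    · rw [hx, blockCore_zero]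
      exact Matrix.orthogonalGroup.det_ne_zero O
    · exact hO x hx
  have hU : blockElim lab O.1 * O.1 = L * S.1 := by
    rw [hS, ← h]
    ext x z
    exact blockElim_mul_self (hne x) z
  have hM : (blockElim lab O.1).BlockTriangular lab := fun x y hxy => blockElim_of_lt (hne x) hxy
  have : Invertible L := L.invertibleOfIsUnitDet (isUnit_iff_ne_zero.2 hdet)
  have hD : (S * O⁻¹).1 = L⁻¹ * blockElim lab O.1 := by
    change S.1 * O.1ᵀ = _
    have : S.1 = L⁻¹ * (blockElim lab O.1 * O.1) := by
      rw [hU, ← Matrix.mul_assoc, Matrix.nonsing_inv_mul _ (isUnit_iff_ne_zero.2 hdet),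
        Matrix.one_mul]
    rw [this, Matrix.mul_assoc, Matrix.mul_assoc, Matrix.orthogonalGroup.mul_transpose,
      Matrix.mul_one]
  have hT : (S * O⁻¹).1.BlockTriangular lab := by
    rw [hD]
    exact (Matrix.blockTriangular_inv_of_blockTriangular hL).mul hM
  exact hT.apply_eq_zero_of_orthogonal (Matrix.orthogonalGroup.mul_transpose (S * O⁻¹)) hxy

end FlagSection

end

noncomputable section

namespace StructParam

variable {p m : ℕ} (P : StructParam p m)

/-! ### The flag manifold -/

/-- The label of the row block that contains a row. -/
def lab (x : Fin m) : ℕ := (P.row.symm x).1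

@[simp]
theorem lab_row (x : P.Row) : P.lab (P.row x) = x.1 := by simp [lab]

theorem row_val (z : Σ i : Fin (p + 1), Fin (P.d (Fin.revPerm i))) :
    (P.row ⟨Fin.revPerm z.1, z.2⟩ : ℕ) = ∑ i ∈ Finset.range z.1, P.d (p - i) + z.2 := by
  have h : (Equiv.sigmaCongrLeft (β := fun j : Fin (p + 1) => Fin (P.d j)) Fin.revPerm).symm
      ⟨Fin.revPerm z.1, z.2⟩ = z := by
    rw [Equiv.symm_apply_eq]
    rfl
  simp only [row, Equiv.trans_apply, h, finCongr_apply, Fin.val_cast, finSigmaFinEquiv_apply,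
    Finset.sum_range]
  congr 1
  refine Finset.sum_congr rfl fun i _ => congrArg P.d ?_
  simp [Fin.val_rev]

/-- This turns the triangularity of Gram–Schmidt in the order of the rows into block triangularity
with respect to the labels. -/
theorem lab_antitone : Antitone P.lab := by
  intro x y hxy
  obtain ⟨⟨i, a⟩, rfl⟩ := P.row.surjective x
  obtain ⟨⟨j, b⟩, rfl⟩ := P.row.surjective y
  obtain ⟨i, rfl⟩ := Fin.revPerm.surjective i
  obtain ⟨j, rfl⟩ := Fin.revPerm.surjective j
  by_contra! hlt
  rw [lab_row, lab_row] at hlt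
  have hji : (j : ℕ) < i := by
    simp only [Fin.revPerm_apply, Fin.val_rev] at hlt
    omega
  rw [Fin.le_def, P.row_val ⟨i, a⟩, P.row_val ⟨j, b⟩] at hxy
  have hb : (b : ℕ) < P.d (p - j) := by
    have := b.2
    simpa [Fin.val_rev] using this
  have hsum : ∑ k ∈ Finset.range (j + 1), P.d (p - k) ≤ ∑ k ∈ Finset.range i, P.d (p - k) :=
    Finset.sum_le_sum_of_subset (Finset.range_subset_range.2 hji)
  rw [Finset.sum_range_succ] at hsum
  dsimp only at hxy
  omega

theorem mem_blockDiag {U : Matrix.orthogonalGroup (Fin m) ℝ} :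
    U ∈ P.blockDiag ↔ ∀ x y, P.lab x ≠ P.lab y → U.1 x y = 0 := by
  constructor
  · intro h x y hxy
    have := h (P.row.symm x) (P.row.symm y) fun e => hxy (congrArg Fin.val e)
    simpa using this
  · intro h x y hxy
    refine h _ _ ?_
    simpa [Fin.ext_iff] using hxy

variable {P} in
theorem blockTriangular_of_mem_blockDiag {U : Matrix.orthogonalGroup (Fin m) ℝ}
    (hU : U ∈ P.blockDiag) : U.1.BlockTriangular P.lab :=
  fun _ _ h => P.mem_blockDiag.1 hU _ _ h.ne'

theorem toFlag_eq_toFlag {O O' : Matrix.orthogonalGroup (Fin m) ℝ} :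
    P.toFlag O = P.toFlag O' ↔ O' * O⁻¹ ∈ P.blockDiag :=
  Quotient.eq.trans QuotientGroup.rightRel_apply

theorem toFlag_surjective : Function.Surjective P.toFlag := Quotient.exists_rep

theorem isQuotientMap_toFlag : Topology.IsQuotientMap P.toFlag := isQuotientMap_quotient_mk'

theorem isInducing_orthogonalGroup : Topology.IsInducing
    (fun O : Matrix.orthogonalGroup (Fin m) ℝ => (O : Matrix (Fin m) (Fin m) ℝ)) :=
  Topology.IsInducing.subtypeVal

/-- The symmetric matrix with eigenvalues given by the labels, whose eigenspaces are the members
of the flag. -/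
def flagMatrix (O : Matrix (Fin m) (Fin m) ℝ) : Matrix (Fin m) (Fin m) ℝ :=
  Oᵀ * Matrix.diagonal (fun x => (P.lab x : ℝ)) * O

/-- Equality of the two matrices means that `D = O' * O⁻¹` commutes with the diagonal matrix of
labels. Different blocks carry different labels, so this means that `D` is block diagonal. -/
theorem toFlag_eq_toFlag_iff_flagMatrix {O O' : Matrix.orthogonalGroup (Fin m) ℝ} :
    P.toFlag O = P.toFlag O' ↔ P.flagMatrix O.1 = P.flagMatrix O'.1 := by
  set D := O' * O⁻¹ with hD
  have hDO : O'.1 = D.1 * O.1 := by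
    have : O' = D * O := by simp [hD]
    exact congrArg Subtype.val this
  have hDD := Matrix.orthogonalGroup.mul_transpose D
  have hOO := Matrix.orthogonalGroup.mul_transpose O
  have hOO' := Matrix.orthogonalGroup.transpose_mul O
  set Λ : Matrix (Fin m) (Fin m) ℝ := Matrix.diagonal fun x => (P.lab x : ℝ) with hΛ
  have h1 : P.flagMatrix O.1 = P.flagMatrix O'.1 ↔ Λ = D.1ᵀ * Λ * D.1 := by
    have e : P.flagMatrix O'.1 = O.1ᵀ * (D.1ᵀ * Λ * D.1) * O.1 := by
      rw [flagMatrix, hDO, Matrix.transpose_mul]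
      simp only [Matrix.mul_assoc, hΛ]
    rw [e, flagMatrix]
    constructor
    · intro h
      have := congrArg (fun N => O.1 * N * O.1ᵀ) h
      simpa only [Matrix.mul_assoc, hOO, Matrix.mul_one, ← Matrix.mul_assoc O.1 O.1ᵀ,
        Matrix.one_mul] using this
    · intro h
      rw [← h]
  have h2 : Λ = D.1ᵀ * Λ * D.1 ↔ D.1 * Λ = Λ * D.1 := by
    constructor
    · intro h
      conv_lhs => rw [h]
      rw [← Matrix.mul_assoc, ← Matrix.mul_assoc, hDD, Matrix.one_mul]
    · intro h
      rw [Matrix.mul_assoc, ← h, ← Matrix.mul_assoc, Matrix.orthogonalGroup.transpose_mul,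
        Matrix.one_mul]
  rw [toFlag_eq_toFlag, mem_blockDiag, h1, h2, ← Matrix.ext_iff]
  refine forall₂_congr fun x y => ?_
  rw [hΛ, Matrix.mul_diagonal, Matrix.diagonal_mul, mul_comm, mul_eq_mul_right_iff, Nat.cast_inj,
    eq_comm (a := P.lab y), or_iff_not_imp_left]

instance : T2Space P.Flag := by
  let f : P.Flag → Matrix (Fin m) (Fin m) ℝ :=
    Quotient.lift (fun O => P.flagMatrix O.1) fun O O' h =>
      P.toFlag_eq_toFlag_iff_flagMatrix.1 (Quotient.sound h)
  refine T2Space.of_injective_continuous (f := f) ?_ ?_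
  · intro b b' h
    obtain ⟨O, rfl⟩ := P.toFlag_surjective b
    obtain ⟨O', rfl⟩ := P.toFlag_surjective b'
    exact P.toFlag_eq_toFlag_iff_flagMatrix.2 h
  · refine continuous_quot_lift _ ?_
    exact ((continuous_subtype_val.matrix_transpose).matrix_mul continuous_const).matrix_mul
      continuous_subtype_val

/-! ### Charts of the flag manifold. -/

variable (R : Matrix.orthogonalGroup (Fin m) ℝ)

/-- The slice for the flag manifold around the class of `R`. -/
def flagSlice : QuotientSlice
    (fun O : Matrix.orthogonalGroup (Fin m) ℝ => (O : Matrix (Fin m) (Fin m) ℝ)) P.toFlag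
    (UpperIdx P.lab → ℝ) where
  dom := {Y | Y * R.1ᵀ ∈ bigCell P.lab}
  coord Y := flagCoord P.lab (Y * R.1ᵀ)
  sect t := flagSect P.lab_antitone t * R
  isOpen_dom := isOpen_bigCell.preimage (continuous_id.matrix_mul continuous_const)
  contDiffOn_coord := contDiffOn_flagCoord.comp (contDiffOn_id.matrix_mul contDiffOn_const)
    fun _ h => h
  contDiff_sect := by
    rw [← contDiffOn_univ]
    exact (contDiff_flagSect P.lab_antitone).contDiffOn.matrix_mul contDiffOn_const
  sect_mem t := by
    change (flagSect P.lab_antitone t).1 * R.1 * R.1ᵀ ∈ bigCell P.lab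
    rw [Matrix.mul_assoc, Matrix.orthogonalGroup.mul_transpose, Matrix.mul_one]
    exact flagSect_mem_bigCell _ t
  coord_sect t := by
    change flagCoord P.lab ((flagSect P.lab_antitone t).1 * R.1 * R.1ᵀ) = t
    rw [Matrix.mul_assoc, Matrix.orthogonalGroup.mul_transpose, Matrix.mul_one]
    exact flagCoord_flagSect _ t
  saturated O O' h hO := by
    have hD := blockTriangular_of_mem_blockDiag (P.toFlag_eq_toFlag.1 h)
    have hdet := Matrix.orthogonalGroup.det_ne_zero (O' * O⁻¹)
    have e : O'.1 * R.1ᵀ = (O' * O⁻¹).1 * (O.1 * R.1ᵀ) := by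
      rw [← Matrix.mul_assoc]
      congr 1
      exact congrArg Subtype.val (inv_mul_cancel_right O' O).symm
    change O'.1 * R.1ᵀ ∈ bigCell P.lab ∧
      flagCoord P.lab (O.1 * R.1ᵀ) = flagCoord P.lab (O'.1 * R.1ᵀ)
    rw [e]
    exact ⟨(mul_mem_bigCell hD hdet).2 hO, (flagCoord_mul hD hdet hO).symm⟩
  q_sect_coord O hO := by
    symm
    rw [toFlag_eq_toFlag, mem_blockDiag]
    intro x y hxy
    have := flagSect_flagCoord P.lab_antitone (O := O * R⁻¹) hO hxy
    rwa [mul_inv_rev, inv_inv, ← mul_assoc] at this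

theorem mem_dom_flagSlice_self : R.1 ∈ (P.flagSlice R).dom := by
  change R.1 * R.1ᵀ ∈ bigCell P.lab
  rw [Matrix.orthogonalGroup.mul_transpose]
  exact one_mem_bigCell

theorem card_upperIdx : Fintype.card (UpperIdx P.lab) = P.flagDim := by
  rw [Fintype.card_subtype, Finset.card_filter, Fintype.sum_prod_type, ← Equiv.sum_comp P.row,
    Fintype.sum_sigma, flagDim, Finset.sum_range]
  refine Finset.sum_congr rfl fun i _ => ?_
  have h : ∀ a : Fin (P.d i), (∑ y, if P.lab y < P.lab (P.row ⟨i, a⟩) then 1 else 0)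
      = ∑ j ∈ Finset.range i, P.d j := by
    intro a
    rw [← Equiv.sum_comp P.row, Fintype.sum_sigma]
    simp only [lab_row, Finset.sum_const, Finset.card_univ, Fintype.card_fin, smul_eq_mul, mul_ite,
      mul_one, mul_zero]
    rw [← Finset.sum_range fun j => if j < (i : ℕ) then P.d j else 0, ← Finset.sum_filter]
    congr 1
    ext j
    simp only [Finset.mem_filter, Finset.mem_range]
    omega
  simp only [h, Finset.sum_const, Finset.card_univ, Fintype.card_fin, smul_eq_mul, Finset.mul_sum]

/-- Linear coordinates on the model space of the flag manifold. -/
def flagModel : (UpperIdx P.lab → ℝ) ≃L[ℝ] EuclideanSpace ℝ (Fin P.flagDim) :=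
  ContinuousLinearEquiv.ofFinrankEq (by simp [card_upperIdx])

instance : ChartedSpace (EuclideanSpace ℝ (Fin P.flagDim)) P.Flag :=
  QuotientSlice.chartedSpace (fun R => (P.flagSlice R).congr P.flagModel)
    isInducing_orthogonalGroup P.isQuotientMap_toFlag fun O => ⟨O, P.mem_dom_flagSlice_self O⟩

theorem atlas_flag : atlas (EuclideanSpace ℝ (Fin P.flagDim)) P.Flag
    = Set.range fun R => ((P.flagSlice R).congr P.flagModel).chart
      isInducing_orthogonalGroup P.isQuotientMap_toFlag := rfl

instance : SecondCountableTopology (Matrix.orthogonalGroup (Fin m) ℝ) :=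
  inferInstanceAs (SecondCountableTopology
    {A : Fin m → Fin m → ℝ // A ∈ Matrix.orthogonalGroup (Fin m) ℝ})

theorem isSmoothQuotient_flag : IsSmoothQuotient P.flagDim
    (fun O : Matrix.orthogonalGroup (Fin m) ℝ => (O : Matrix (Fin m) (Fin m) ℝ)) P.toFlag :=
  QuotientSlice.isSmoothQuotient P.atlas_flag fun O => ⟨O, P.mem_dom_flagSlice_self O⟩

end StructParam

end

noncomputable section

namespace StructParam

variable {p m : ℕ} (P : StructParam p m)

/-! ### Configurations and their representations -/

/-- The rows of the blocks `O_0, …, O_{r-l-1}` in the order of the columns of `C_{r,l}`. -/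
def colRow {r : Fin p} (l : Fin r) (c : Σ j : Fin (r - l), Fin (P.d j)) : Fin m :=
  P.row ⟨⟨c.1, by omega⟩, c.2⟩

@[simp]
theorem lab_colRow {r : Fin p} (l : Fin r) (c : Σ j : Fin (r - l), Fin (P.d j)) :
    P.lab (P.colRow l c) = c.1 := by simp [colRow]

theorem colRow_injective {r : Fin p} (l : Fin r) : Function.Injective (P.colRow l) := by
  rintro ⟨i, a⟩ ⟨j, b⟩ h
  have h1 := P.row.injective h
  obtain ⟨h2, h3⟩ := Sigma.mk.inj_iff.1 h1
  have h2' : i = j := Fin.ext (Fin.mk.inj_iff.1 h2)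
  subst h2'
  rw [show a = b from eq_of_heq h3]

theorem mem_range_colRow {r : Fin p} (l : Fin r) {y : Fin m} (hy : P.lab y < r - l) :
    y ∈ Set.range (P.colRow l) := by
  obtain ⟨⟨j, b⟩, rfl⟩ := P.row.surjective y
  rw [lab_row] at hy
  exact ⟨⟨⟨j, hy⟩, b⟩, rfl⟩

theorem sum_colRow {r : Fin p} (l : Fin r) {f : Fin m → ℝ}
    (hf : ∀ y, (r : ℕ) - l ≤ P.lab y → f y = 0) : ∑ c, f (P.colRow l c) = ∑ y, f y :=
  Fintype.sum_of_injective (P.colRow l) (P.colRow_injective l) _ _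
    (fun y hy => hf y (not_lt.1 fun h => hy (P.mem_range_colRow l h))) fun _ => rfl

theorem sum_row {j : Fin (p + 1)} {f : Fin m → ℝ} (hf : ∀ y, P.lab y ≠ j → f y = 0) :
    ∑ a, f (P.row ⟨j, a⟩) = ∑ y, f y := by
  refine Fintype.sum_of_injective (fun a => P.row ⟨j, a⟩)
    (P.row.injective.comp sigma_mk_injective) _ _ (fun y hy => hf y fun h => hy ?_) fun _ => rfl
  obtain ⟨⟨i, b⟩, rfl⟩ := P.row.surjective y
  rw [lab_row] at h
  obtain rfl := Fin.ext h
  exact ⟨b, rfl⟩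

theorem build_zero (C : P.Coef) (O : Matrix (Fin m) (Fin m) ℝ) (r : Fin p)
    (a : Fin (P.d (r + 1))) : P.build C O ⟨r, (0, a)⟩ = O (P.row ⟨r.succ, a⟩) := rfl

theorem build_succ (C : P.Coef) (O : Matrix (Fin m) (Fin m) ℝ) (r : Fin p) (l : Fin r)
    (a : Fin (P.d (r + 1))) (x : Fin m) :
    P.build C O ⟨r, (l.succ, a)⟩ x = ∑ c, C r a ⟨l, c⟩ * O (P.colRow l c) x := rfl

theorem build_mul (C : P.Coef) (O R : Matrix (Fin m) (Fin m) ℝ) :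
    P.build C (O * R) = P.build C O * R := by
  ext ⟨r, l, a⟩ x
  refine Fin.cases ?_ (fun l => ?_) l
  · rfl
  · rw [build_succ, Matrix.mul_apply]
    simp only [build_succ, Matrix.mul_apply, Finset.sum_mul, Finset.mul_sum, mul_assoc]
    exact Finset.sum_comm

/-- Membership in `𝒢𝒪` in terms of the entries of `G * Gᵀ`. -/
theorem mem_GO_iff {G : Matrix P.State (Fin m) ℝ} : G ∈ P.GO ↔
    (∀ (r s : Fin p) (a : Fin (P.d (r + 1))) (b : Fin (P.d (s + 1))),
      (G * Gᵀ) ⟨r, (0, a)⟩ ⟨s, (0, b)⟩ = (1 : Matrix P.Top P.Top ℝ) ⟨r, a⟩ ⟨s, b⟩) ∧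
    ∀ (r s : Fin p) (l : Fin r) (a : Fin (P.d (r + 1))) (b : Fin (P.d (s + 1))),
      (r : ℕ) ≤ l + s + 1 → (G * Gᵀ) ⟨r, (l.succ, a)⟩ ⟨s, (0, b)⟩ = 0 := by
  refine and_congr ⟨fun h r s a b => ?_, fun h => ?_⟩ ⟨fun h r s l a b hl => ?_,
    fun h r s l hl => ?_⟩
  · exact congrFun (congrFun h ⟨r, a⟩) ⟨s, b⟩
  · ext ⟨r, a⟩ ⟨s, b⟩
    exact h r s a b
  · refine congrFun (congrFun (h r s l.succ ?_) a) b
    rw [Fin.val_succ]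
    omega
  · ext a b
    revert hl
    refine Fin.cases (fun hl => ?_) (fun l hl => ?_) l
    · simp at hl
    · refine h r s l a b ?_
      rw [Fin.val_succ] at hl
      omega

theorem row_succ_eq_one (r s : Fin p) (a : Fin (P.d (r + 1))) (b : Fin (P.d (s + 1))) :
    (1 : Matrix (Fin m) (Fin m) ℝ) (P.row ⟨r.succ, a⟩) (P.row ⟨s.succ, b⟩)
      = (1 : Matrix P.Top P.Top ℝ) ⟨r, a⟩ ⟨s, b⟩ := by
  by_cases h : (⟨r, a⟩ : P.Top) = ⟨s, b⟩
  · obtain ⟨rfl, h⟩ := Sigma.mk.inj_iff.1 h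
    rw [eq_of_heq h, Matrix.one_apply_eq, Matrix.one_apply_eq]
  · rw [Matrix.one_apply_ne h, Matrix.one_apply_ne]
    intro h'
    obtain ⟨h1, h2⟩ := Sigma.mk.inj_iff.1 (P.row.injective h')
    obtain rfl := Fin.succ_injective _ h1
    exact h (Sigma.mk.inj_iff.2 ⟨rfl, h2⟩)

theorem build_mul_transpose_zero (C : P.Coef) (O S : Matrix (Fin m) (Fin m) ℝ) (r : Fin p)
    (a : Fin (P.d (r + 1))) (y : Fin m) :
    (P.build C O * Sᵀ) ⟨r, (0, a)⟩ y = (O * Sᵀ) (P.row ⟨r.succ, a⟩) y := rfl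

theorem build_mul_transpose_succ (C : P.Coef) (O S : Matrix (Fin m) (Fin m) ℝ) (r : Fin p)
    (l : Fin r) (a : Fin (P.d (r + 1))) (y : Fin m) :
    (P.build C O * Sᵀ) ⟨r, (l.succ, a)⟩ y = ∑ c, C r a ⟨l, c⟩ * (O * Sᵀ) (P.colRow l c) y := by
  rw [← build_mul, build_succ]

theorem build_mem_GO (C : P.Coef) (O : Matrix.orthogonalGroup (Fin m) ℝ) :
    P.build C O.1 ∈ P.GO := by
  have hO := Matrix.orthogonalGroup.mul_transpose O
  have key : ∀ (i : P.State) (s : Fin p) (b : Fin (P.d (s + 1))),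
      (P.build C O.1 * (P.build C O.1)ᵀ) i ⟨s, (0, b)⟩
        = (P.build C O.1 * O.1ᵀ) i (P.row ⟨s.succ, b⟩) := fun _ _ _ => rfl
  rw [mem_GO_iff]
  constructor
  · intro r s a b
    rw [key, build_mul_transpose_zero, hO, row_succ_eq_one]
  · intro r s l a b hl
    rw [key, build_mul_transpose_succ, hO]
    refine Finset.sum_eq_zero fun c _ => ?_
    rw [Matrix.one_apply_ne, mul_zero]
    -- The columns of `C_{r,l}` carry labels below `r - l`, while `hl` gives `s + 1 ≥ r - l`, so the
    -- two rows of `O` are distinct.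
    intro h
    have := congrArg P.lab h
    rw [lab_colRow, lab_row, Fin.val_succ] at this
    have := c.1.2
    omega

/-- A configuration is adapted to an orthogonal matrix when its blocks are combinations of the
same row blocks as in the representation by pairs. -/
structure Adapted (S : Matrix (Fin m) (Fin m) ℝ) (G : Matrix P.State (Fin m) ℝ) : Prop where
  zero : ∀ (r : Fin p) (a : Fin (P.d (r + 1))) (y : Fin m), P.lab y ≠ r + 1 →
    (G * Sᵀ) ⟨r, (0, a)⟩ y = 0
  succ : ∀ (r : Fin p) (l : Fin r) (a : Fin (P.d (r + 1))) (y : Fin m), (r : ℕ) - l ≤ P.lab y →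
    (G * Sᵀ) ⟨r, (l.succ, a)⟩ y = 0

/-- The invariant `G_{r,0}ᵀ G_{r,l}`. -/
def invt (G : Matrix P.State (Fin m) ℝ) (r : Fin p) (l : Fin (r + 1)) :
    Matrix (Fin m) (Fin m) ℝ := (P.blk G r 0)ᵀ * P.blk G r l

/-- The coefficients `C_{r,l,j} = S_r G_{r,0}ᵀ G_{r,l} S_jᵀ`. -/
def coef (S : Matrix (Fin m) (Fin m) ℝ) (G : Matrix P.State (Fin m) ℝ) : P.Coef :=
  fun r a z => (S * P.invt G r z.1.succ * Sᵀ) (P.row ⟨r.succ, a⟩) (P.colRow z.1 z.2)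

/-- The block `S_r G_{r,0}ᵀ`. -/
def transBlk (S : Matrix (Fin m) (Fin m) ℝ) (G : Matrix P.State (Fin m) ℝ) (r : Fin p) :
    Matrix (Fin (P.d (r + 1))) (Fin (P.d (r + 1))) ℝ :=
  fun a b => (S * Gᵀ) (P.row ⟨r.succ, a⟩) ⟨r, (0, b)⟩

theorem coef_apply (S : Matrix (Fin m) (Fin m) ℝ) (G : Matrix P.State (Fin m) ℝ) (r : Fin p)
    (a : Fin (P.d (r + 1))) (l : Fin r) (c : Σ j : Fin (r - l), Fin (P.d j)) :
    P.coef S G r a ⟨l, c⟩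
      = ∑ b, P.transBlk S G r a b * (G * Sᵀ) ⟨r, (l.succ, b)⟩ (P.colRow l c) := by
  have : S * P.invt G r l.succ * Sᵀ = S * (P.blk G r 0)ᵀ * (P.blk G r l.succ * Sᵀ) := by
    simp only [invt, Matrix.mul_assoc]
  rw [coef, this, Matrix.mul_apply]
  rfl

/-! ### Recovering the coefficients of an adapted configuration. -/

variable {P}

theorem GO.blk_mul_transpose {G : Matrix P.State (Fin m) ℝ} (hG : G ∈ P.GO) (r : Fin p) :
    P.blk G r 0 * (P.blk G r 0)ᵀ = 1 := by
  ext a b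
  have := (P.mem_GO_iff.1 hG).1 r r a b
  simp only [Matrix.one_apply, Sigma.mk.inj_iff, heq_eq_eq, true_and] at this ⊢
  exact this

/-- Adaptedness leaves only the block `S_r` in the expansion of `G_{r,0}` along the orthonormal rows
of `S`. -/
theorem Adapted.sum_transBlk {S : Matrix.orthogonalGroup (Fin m) ℝ}
    {G : Matrix P.State (Fin m) ℝ} (h : P.Adapted S.1 G) (r : Fin p) (b : Fin (P.d (r + 1)))
    (x : Fin m) : ∑ a, P.transBlk S.1 G r a b * S.1 (P.row ⟨r.succ, a⟩) x = G ⟨r, (0, b)⟩ x := by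
  have h1 : G = G * S.1ᵀ * S.1 := by
    rw [Matrix.mul_assoc, Matrix.orthogonalGroup.transpose_mul, Matrix.mul_one]
  conv_rhs => rw [h1, Matrix.mul_apply, ← P.sum_row (j := r.succ) (fun y hy => by
    rw [h.zero r b y (by simpa using hy), zero_mul])]
  refine Finset.sum_congr rfl fun a _ => ?_
  congr 1
  simp only [transBlk, Matrix.mul_apply, Matrix.transpose_apply, mul_comm]

/-- The rows of `G_{r,0}` and of `S_r` are orthonormal bases of the same space, and `transBlk` is
the change of basis. -/
theorem Adapted.transBlk_transpose_mul {S : Matrix.orthogonalGroup (Fin m) ℝ}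
    {G : Matrix P.State (Fin m) ℝ} (h : P.Adapted S.1 G) (hG : G ∈ P.GO) (r : Fin p) :
    (P.transBlk S.1 G r)ᵀ * P.transBlk S.1 G r = 1 := by
  rw [← GO.blk_mul_transpose hG r]
  ext b b'
  simp only [Matrix.mul_apply, Matrix.transpose_apply]
  have h1 : ∀ x, P.blk G r 0 b x = ∑ a, P.transBlk S.1 G r a b * S.1 (P.row ⟨r.succ, a⟩) x :=
    fun x => (h.sum_transBlk r b x).symm
  simp only [h1, Finset.sum_mul]
  rw [Finset.sum_comm]
  refine Finset.sum_congr rfl fun a _ => ?_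
  simp only [mul_assoc, ← Finset.mul_sum]
  congr 1

/-- A configuration adapted to `S` is carried by a block orthogonal matrix to one that is
represented by a pair with second entry `S`. -/
theorem Adapted.build_coef {S : Matrix.orthogonalGroup (Fin m) ℝ}
    {G : Matrix P.State (Fin m) ℝ} (h : P.Adapted S.1 G) (hG : G ∈ P.GO) (r : Fin p)
    (l : Fin (r + 1)) (a : Fin (P.d (r + 1))) (x : Fin m) :
    P.build (P.coef S.1 G) S.1 ⟨r, (l, a)⟩ x
      = ∑ b, P.transBlk S.1 G r a b * G ⟨r, (l, b)⟩ x := by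
  refine Fin.cases ?_ (fun l => ?_) l
  · rw [build_zero]
    simp only [← h.sum_transBlk, Finset.mul_sum]
    rw [Finset.sum_comm]
    have h1 : P.transBlk S.1 G r * (P.transBlk S.1 G r)ᵀ = 1 :=
      mul_eq_one_comm.1 (h.transBlk_transpose_mul hG r)
    have h2 : ∀ c, ∑ b, P.transBlk S.1 G r a b *
        (P.transBlk S.1 G r c b * S.1 (P.row ⟨r.succ, c⟩) x)
          = (1 : Matrix _ _ ℝ) a c * S.1 (P.row ⟨r.succ, c⟩) x := by
      intro c
      rw [← h1, Matrix.mul_apply, Finset.sum_mul]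
      simp only [Matrix.transpose_apply, mul_assoc]
    simp only [h2, Matrix.one_apply, ite_mul, one_mul, zero_mul, Finset.sum_ite_eq,
      Finset.mem_univ, if_true]
  · rw [build_succ]
    have h1 : G = G * S.1ᵀ * S.1 := by
      rw [Matrix.mul_assoc, Matrix.orthogonalGroup.transpose_mul, Matrix.mul_one]
    have h2 : ∀ b, ∑ c, (G * S.1ᵀ) ⟨r, (l.succ, b)⟩ (P.colRow l c) * S.1 (P.colRow l c) x
        = G ⟨r, (l.succ, b)⟩ x := by
      intro b
      conv_rhs => rw [h1, Matrix.mul_apply]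
      exact P.sum_colRow l (f := fun y => (G * S.1ᵀ) ⟨r, (l.succ, b)⟩ y * S.1 y x)
        fun y hy => by rw [h.succ r l b y hy, zero_mul]
    simp only [coef_apply, Finset.sum_mul, ← h2, Finset.mul_sum, mul_assoc]
    exact Finset.sum_comm

/-- Here the change of basis `transBlk` is the identity, and orthonormality of the rows of `S` reads
off `C`. Hence different `C` give different orbits for fixed `S`. -/
theorem coef_build (C : P.Coef) (S : Matrix.orthogonalGroup (Fin m) ℝ) :
    P.coef S.1 (P.build C S.1) = C := by
  have hS := Matrix.orthogonalGroup.mul_transpose S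
  funext r a ⟨l, c⟩
  have h1 : ∀ b, P.transBlk S.1 (P.build C S.1) r a b = (1 : Matrix _ _ ℝ) a b := by
    intro b
    have : P.transBlk S.1 (P.build C S.1) r a b
      = (S.1 * S.1ᵀ) (P.row ⟨r.succ, a⟩) (P.row ⟨r.succ, b⟩) := rfl
    rw [this, hS, row_succ_eq_one]
    simp [Matrix.one_apply]
  rw [coef_apply]
  simp only [h1, build_mul_transpose_succ, hS, Matrix.one_apply, ite_mul, one_mul, zero_mul,
    Finset.sum_ite_eq, Finset.mem_univ, if_true, mul_ite, mul_one, mul_zero,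
    (P.colRow_injective l).eq_iff, Finset.sum_ite_eq']

/-- `O Sᵀ` is block diagonal, so `O_j` and `S_j` have the same row space for each `j`. -/
theorem Adapted.build {O S : Matrix.orthogonalGroup (Fin m) ℝ} (h : P.toFlag S = P.toFlag O)
    (C : P.Coef) : P.Adapted S.1 (P.build C O.1) := by
  have hD := P.mem_blockDiag.1 (P.toFlag_eq_toFlag.1 h)
  have hD' : ∀ x y, P.lab x ≠ P.lab y → (O.1 * S.1ᵀ) x y = 0 := hD
  constructor
  · intro r a y hy
    rw [build_mul_transpose_zero]
    exact hD' _ _ (by rw [lab_row]; exact hy.symm)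
  · intro r l a y hy
    rw [build_mul_transpose_succ]
    refine Finset.sum_eq_zero fun c _ => ?_
    have := c.1.2
    rw [hD' _ _ (by rw [lab_colRow]; omega), mul_zero]

end StructParam

end

noncomputable section

namespace StructParam

variable {p m : ℕ} (P : StructParam p m)

/-! ### The group and its orbits -/

/-- The block diagonal matrix with given diagonal blocks, equal for equal exponents. -/
def ofBlocks (V : ∀ r : Fin p, Matrix (Fin (P.d (r + 1))) (Fin (P.d (r + 1))) ℝ) :
    Matrix P.State P.State ℝ := fun x y =>
  if (x.2.1 : ℕ) = y.2.1 then Matrix.blockDiagonal' V ⟨x.1, x.2.2⟩ ⟨y.1, y.2.2⟩ else 0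

variable {P}
variable {V : ∀ r : Fin p, Matrix (Fin (P.d (r + 1))) (Fin (P.d (r + 1))) ℝ}

theorem ofBlocks_same (r : Fin p) (j : Fin (r + 1)) (a b : Fin (P.d (r + 1))) :
    P.ofBlocks V ⟨r, (j, a)⟩ ⟨r, (j, b)⟩ = V r a b := by
  simp [ofBlocks]

theorem ofBlocks_off (r s : Fin p) (j : Fin (r + 1)) (k : Fin (s + 1)) (a : Fin (P.d (r + 1)))
    (b : Fin (P.d (s + 1))) (h : ¬ (r = s ∧ (j : ℕ) = k)) :
    P.ofBlocks V ⟨r, (j, a)⟩ ⟨s, (k, b)⟩ = 0 := by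
  unfold ofBlocks
  split_ifs with hjk
  · exact Matrix.blockDiagonal'_apply_ne _ _ _ fun h' => h ⟨h', hjk⟩
  · rfl

theorem ofBlocks_mul_apply {ι : Type*} (N : Matrix P.State ι ℝ) (r : Fin p) (j : Fin (r + 1))
    (a : Fin (P.d (r + 1))) (y : ι) :
    (P.ofBlocks V * N) ⟨r, (j, a)⟩ y = ∑ c, V r a c * N ⟨r, (j, c)⟩ y := by
  rw [Matrix.mul_apply]
  refine (Fintype.sum_of_injective (fun c => (⟨r, (j, c)⟩ : P.State)) ?_ _ _ ?_ ?_).symm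
  · intro c c' h
    simpa using h
  · rintro ⟨s, k, c⟩ h
    rw [ofBlocks_off, zero_mul]
    rintro ⟨rfl, hjk⟩
    obtain rfl := Fin.ext hjk
    exact h ⟨c, rfl⟩
  · intro c
    rw [ofBlocks_same]

theorem mul_ofBlocks_apply {ι : Type*} (N : Matrix ι P.State ℝ) (r : Fin p) (j : Fin (r + 1))
    (a : Fin (P.d (r + 1))) (x : ι) :
    (N * P.ofBlocks V) x ⟨r, (j, a)⟩ = ∑ c, N x ⟨r, (j, c)⟩ * V r c a := by
  rw [Matrix.mul_apply]
  refine (Fintype.sum_of_injective (fun c => (⟨r, (j, c)⟩ : P.State)) ?_ _ _ ?_ ?_).symm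
  · intro c c' h
    simpa using h
  · rintro ⟨s, k, c⟩ h
    rw [ofBlocks_off, mul_zero]
    rintro ⟨rfl, hjk⟩
    obtain rfl := Fin.ext hjk
    exact h ⟨c, rfl⟩
  · intro c
    rw [ofBlocks_same]

theorem diagBlk_ofBlocks (r : Fin p) : P.diagBlk (P.ofBlocks V) r = V r := by
  ext a b
  exact ofBlocks_same r 0 a b

theorem isOrthBlockDiag_ofBlocks (hV : ∀ r, V r * (V r)ᵀ = 1) :
    P.IsOrthBlockDiag (P.ofBlocks V) where
  comm := by
    ext ⟨r, j, a⟩ ⟨s, k, b⟩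
    rw [ofBlocks_mul_apply, mul_ofBlocks_apply]
    by_cases h : r = s ∧ (j : ℕ) = k + 1
    · obtain ⟨rfl, h⟩ := h
      simp [jordan, h, ← Fin.ext_iff]
    · have h1 : ∀ c c', P.jordan ⟨r, (j, c)⟩ ⟨s, (k, c')⟩ = 0 := fun c c' =>
        if_neg fun h' => h ⟨h'.1, h'.2.1⟩
      simp [h1]
  off := ofBlocks_off
  same r j a b := by rw [ofBlocks_same, diagBlk_ofBlocks]
  orth r := by rw [diagBlk_ofBlocks, hV]

theorem IsOrthBlockDiag.eq_ofBlocks {Q : Matrix P.State P.State ℝ} (hQ : P.IsOrthBlockDiag Q) :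
    Q = P.ofBlocks (P.diagBlk Q) := by
  ext ⟨r, j, a⟩ ⟨s, k, b⟩
  by_cases h : r = s ∧ (j : ℕ) = k
  · obtain ⟨rfl, h⟩ := h
    obtain rfl := Fin.ext h
    rw [ofBlocks_same, hQ.same]
  · rw [ofBlocks_off _ _ _ _ _ _ h, hQ.off _ _ _ _ _ _ h]

/-- The invertible matrix given by a block orthogonal matrix. -/
def IsOrthBlockDiag.unit {Q : Matrix P.State P.State ℝ} (hQ : P.IsOrthBlockDiag Q) :
    (Matrix P.State P.State ℝ)ˣ :=
  ⟨Q, Qᵀ, hQ.mul_transpose, mul_eq_one_comm.1 hQ.mul_transpose⟩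

theorem IsOrthBlockDiag.unit_mem {Q : Matrix P.State P.State ℝ} (hQ : P.IsOrthBlockDiag Q) :
    hQ.unit ∈ P.Q := hQ

theorem blk_mul {Q : Matrix P.State P.State ℝ} (hQ : P.IsOrthBlockDiag Q)
    (G : Matrix P.State (Fin m) ℝ) (r : Fin p) (l : Fin (r + 1)) :
    P.blk (Q * G) r l = P.diagBlk Q r * P.blk G r l := by
  ext a x
  exact hQ.mul_apply G r l a x

theorem invt_mul {Q : Matrix P.State P.State ℝ} (hQ : P.IsOrthBlockDiag Q)
    (G : Matrix P.State (Fin m) ℝ) (r : Fin p) (l : Fin (r + 1)) :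
    P.invt (Q * G) r l = P.invt G r l := by
  rw [invt, invt, blk_mul hQ, blk_mul hQ, Matrix.transpose_mul, Matrix.mul_assoc,
    ← Matrix.mul_assoc _ (P.diagBlk Q r), mul_eq_one_comm.1 (hQ.orth r), Matrix.one_mul]

variable (P) in
theorem toK_surjective : Function.Surjective P.toK := Quotient.exists_rep

theorem toK_eq_of_blocks {G G' : P.GO} (hV : ∀ r, V r * (V r)ᵀ = 1)
    (h : ∀ (r : Fin p) (l : Fin (r + 1)) a x,
      G'.1 ⟨r, (l, a)⟩ x = ∑ b, V r a b * G.1 ⟨r, (l, b)⟩ x) : P.toK G = P.toK G' := by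
  refine Quotient.sound ⟨_, (isOrthBlockDiag_ofBlocks hV).unit_mem, ?_⟩
  ext ⟨r, l, a⟩ x
  exact (ofBlocks_mul_apply _ _ _ _ _).trans (h r l a x).symm

/-- The connecting element of `𝒬` has the blocks `G'_{r,0} G_{r,0}ᵀ`. The case `l = 0` says that
`G_{r,0}` and `G'_{r,0}` have the same row space, which makes these blocks orthogonal; the cases `l
> 0` say that they carry `G_{r,l}` to `G'_{r,l}`. -/
theorem toK_eq_toK_iff {G G' : P.GO} :
    P.toK G = P.toK G' ↔ ∀ r l, P.invt G.1 r l = P.invt G'.1 r l := by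
  constructor
  · intro h r l
    obtain ⟨U, hU, e⟩ := Quotient.exact h
    rw [← e, invt_mul hU]
  · intro h
    have hG := GO.blk_mul_transpose G.2
    have hG' := GO.blk_mul_transpose G'.2
    refine toK_eq_of_blocks (V := fun r => P.blk G'.1 r 0 * (P.blk G.1 r 0)ᵀ) ?_ ?_
    · intro r
      rw [Matrix.transpose_mul, Matrix.transpose_transpose, Matrix.mul_assoc,
        ← Matrix.mul_assoc _ (P.blk G.1 r 0)]
      have e : (P.blk G.1 r 0)ᵀ * P.blk G.1 r 0 = (P.blk G'.1 r 0)ᵀ * P.blk G'.1 r 0 := h r 0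
      rw [e, Matrix.mul_assoc, hG', Matrix.mul_one, hG']
    · intro r l a x
      have : P.blk G'.1 r l = P.blk G'.1 r 0 * (P.blk G.1 r 0)ᵀ * P.blk G.1 r l := by
        have e : (P.blk G.1 r 0)ᵀ * P.blk G.1 r l = (P.blk G'.1 r 0)ᵀ * P.blk G'.1 r l := h r l
        rw [Matrix.mul_assoc, e, ← Matrix.mul_assoc, hG', Matrix.one_mul]
      exact congrFun (congrFun this a) x

theorem mul_mem_GO {Q : Matrix P.State P.State ℝ} (hQ : P.IsOrthBlockDiag Q)
    {G : Matrix P.State (Fin m) ℝ} (hG : G ∈ P.GO) : Q * G ∈ P.GO := by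
  have h1 : ∀ (r s : Fin p) (l : Fin (r + 1)) (a : Fin (P.d (r + 1))) (b : Fin (P.d (s + 1))),
      (Q * G * (Q * G)ᵀ) ⟨r, (l, a)⟩ ⟨s, (0, b)⟩ = ∑ c, ∑ c', P.diagBlk Q r a c *
        (P.diagBlk Q s b c' * (G * Gᵀ) ⟨r, (l, c)⟩ ⟨s, (0, c')⟩) := by
    intro r s l a b
    rw [Matrix.mul_assoc, hQ.mul_apply, Matrix.transpose_mul, ← Matrix.mul_assoc]
    refine Finset.sum_congr rfl fun c _ => ?_
    have : (G * Gᵀ * Qᵀ) ⟨r, (l, c)⟩ ⟨s, (0, b)⟩ = (Q * (G * Gᵀ)ᵀ) ⟨s, (0, b)⟩ ⟨r, (l, c)⟩ := by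
      rw [← Matrix.transpose_apply (Q * _), Matrix.transpose_mul, Matrix.transpose_transpose]
    rw [this, hQ.mul_apply, Finset.mul_sum]
    rfl
  obtain ⟨hz, hs⟩ := P.mem_GO_iff.1 hG
  rw [mem_GO_iff]
  constructor
  · intro r s a b
    simp only [h1, hz]
    by_cases hrs : r = s
    · subst hrs
      have := congrFun (congrFun (hQ.orth r) a) b
      rw [Matrix.mul_apply] at this
      simpa [Matrix.one_apply] using this
    · have hne : ∀ c c', (1 : Matrix P.Top P.Top ℝ) ⟨r, c⟩ ⟨s, c'⟩ = 0 := fun c c' =>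
        Matrix.one_apply_ne fun h => hrs (Sigma.mk.inj_iff.1 h).1
      simp [hne]
  · intro r s l a b hl
    rw [h1]
    exact Finset.sum_eq_zero fun c _ => Finset.sum_eq_zero fun c' _ => by
      rw [hs r s l c c' hl, mul_zero, mul_zero]

/-! ### Every configuration is represented by a pair -/

/-- The top row of a configuration with a given label; zero for the label zero. -/
def topRow (G : Matrix P.State (Fin m) ℝ) (z : P.Row) : Fin m → ℝ :=
  Fin.cases (motive := fun j => Fin (P.d j) → Fin m → ℝ) (fun _ => 0)
    (fun r a => G ⟨r, (0, a)⟩) z.1 z.2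

/-- The square matrix with rows taken from the blocks `G_{r,0}`, completed by zero rows. -/
def topRows (G : Matrix P.State (Fin m) ℝ) : Matrix (Fin m) (Fin m) ℝ :=
  fun y => topRow G (P.row.symm y)

theorem topRows_row (G : Matrix P.State (Fin m) ℝ) (r : Fin p) (a : Fin (P.d (r + 1))) :
    topRows G (P.row ⟨r.succ, a⟩) = G ⟨r, (0, a)⟩ := by
  rw [topRows, Equiv.symm_apply_apply]
  rfl

theorem eq_of_row_succ {β : Type*} {f g : Fin m → β}
    (h : ∀ (r : Fin p) (a : Fin (P.d (r + 1))), f (P.row ⟨r.succ, a⟩) = g (P.row ⟨r.succ, a⟩))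
    (x : Fin m) (hx : 1 ≤ P.lab x) : f x = g x := by
  obtain ⟨⟨j, a⟩, rfl⟩ := P.row.surjective x
  rw [lab_row] at hx
  obtain ⟨r, rfl⟩ := Fin.exists_succ_eq.2 (Fin.pos_iff_ne_zero.1 hx)
  exact h r a

/-- An orthonormal family indexed by part of `Fin m` extends to an orthonormal basis indexed by all
of it, the given vectors keeping their positions. -/
theorem exists_extension {G : Matrix P.State (Fin m) ℝ} (hG : G ∈ P.GO) :
    ∃ O : Matrix.orthogonalGroup (Fin m) ℝ, ∀ (r : Fin p) (a : Fin (P.d (r + 1))),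
      O.1 (P.row ⟨r.succ, a⟩) = G ⟨r, (0, a)⟩ := by
  have hv : Orthonormal ℝ ({x | 1 ≤ P.lab x}.domRestrict (euclideanRow (topRows G))) := by
    rw [orthonormal_iff_ite]
    rintro ⟨x, hx⟩ ⟨y, hy⟩
    obtain ⟨⟨i, a⟩, rfl⟩ := P.row.surjective x
    obtain ⟨⟨j, b⟩, rfl⟩ := P.row.surjective y
    change 1 ≤ P.lab _ at hx
    change 1 ≤ P.lab _ at hy
    rw [lab_row] at hx hy
    obtain ⟨r, rfl⟩ := Fin.exists_succ_eq.2 (Fin.pos_iff_ne_zero.1 hx)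
    obtain ⟨s, rfl⟩ := Fin.exists_succ_eq.2 (Fin.pos_iff_ne_zero.1 hy)
    have h1 : inner ℝ (euclideanRow (topRows G) (P.row ⟨r.succ, a⟩))
        (euclideanRow (topRows G) (P.row ⟨s.succ, b⟩)) = (G * Gᵀ) ⟨r, (0, a)⟩ ⟨s, (0, b)⟩ := by
      rw [inner_euclideanRow]
      simp only [Matrix.mul_apply, Matrix.transpose_apply, topRows_row]
    change inner ℝ (euclideanRow (topRows G) (P.row ⟨r.succ, a⟩))
        (euclideanRow (topRows G) (P.row ⟨s.succ, b⟩)) = _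
    rw [h1, (P.mem_GO_iff.1 hG).1, ← row_succ_eq_one, Matrix.one_apply]
    simp only [Subtype.mk.injEq]
  obtain ⟨b, hb⟩ := hv.exists_orthonormalBasis_extension_of_card_eq (by simp)
  refine ⟨⟨fun x y => b x y, (Matrix.mem_orthogonalGroup_iff _ _).2 ?_⟩, fun r a => ?_⟩
  · ext x y
    have := orthonormal_iff_ite.1 b.orthonormal x y
    have h2 := inner_euclideanRow (fun x y => b x y) (fun x y => b x y) x y
    rw [Matrix.one_apply, ← this]
    exact h2.symm
  · have := hb (P.row ⟨r.succ, a⟩) (by change 1 ≤ P.lab _; simp)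
    funext y
    change b (P.row ⟨r.succ, a⟩) y = _
    rw [this]
    exact congrFun (topRows_row G r a) y

/-- The relations of `𝒢𝒪` make `G_{r,l}` orthogonal to every row of `O` whose label is too large to
occur in the representation. -/
theorem Adapted.of_extension {G : Matrix P.State (Fin m) ℝ} (hG : G ∈ P.GO)
    {O : Matrix.orthogonalGroup (Fin m) ℝ} (hO : ∀ (r : Fin p) (a : Fin (P.d (r + 1))),
      O.1 (P.row ⟨r.succ, a⟩) = G ⟨r, (0, a)⟩) : P.Adapted O.1 G := by
  constructor
  · intro r a y hy
    have : (G * O.1ᵀ) ⟨r, (0, a)⟩ y = (O.1 * O.1ᵀ) (P.row ⟨r.succ, a⟩) y := by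
      simp only [Matrix.mul_apply, hO]
    rw [this, Matrix.orthogonalGroup.mul_transpose, Matrix.one_apply_ne]
    rintro rfl
    simp at hy
  · intro r l a y hy
    have := l.2
    obtain ⟨⟨j, b⟩, rfl⟩ := P.row.surjective y
    rw [lab_row] at hy
    dsimp only at hy
    -- Since `l < r`, the label is positive, so this row of `O` is a row of `G_{:,0}` and the
    -- relations of `𝒢𝒪` apply to it.
    obtain ⟨s, rfl⟩ := Fin.exists_succ_eq.2 (Fin.pos_iff_ne_zero.1 (show 0 < j by
      rw [Fin.lt_def, Fin.val_zero]; omega))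
    rw [← (P.mem_GO_iff.1 hG).2 r s l a b (by rw [Fin.val_succ] at hy; omega)]
    simp only [Matrix.mul_apply, Matrix.transpose_apply, hO]

theorem build_coef_of_extension {G : Matrix P.State (Fin m) ℝ} (hG : G ∈ P.GO)
    {O : Matrix.orthogonalGroup (Fin m) ℝ} (hO : ∀ (r : Fin p) (a : Fin (P.d (r + 1))),
      O.1 (P.row ⟨r.succ, a⟩) = G ⟨r, (0, a)⟩) : P.build (P.coef O.1 G) O.1 = G := by
  have h := Adapted.of_extension hG hO
  ext ⟨r, l, a⟩ x
  have h1 : ∀ b, P.transBlk O.1 G r a b = (1 : Matrix _ _ ℝ) a b := by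
    intro b
    rw [← GO.blk_mul_transpose hG]
    simp only [transBlk, Matrix.mul_apply, hO]
    rfl
  rw [h.build_coef hG]
  simp [h1, Matrix.one_apply]

variable (P) in
theorem mem_GO_iff_exists_build (G : Matrix P.State (Fin m) ℝ) : G ∈ P.GO ↔
    ∃ (C : P.Coef) (O : Matrix.orthogonalGroup (Fin m) ℝ), P.build C O.1 = G := by
  constructor
  · intro hG
    obtain ⟨O, hO⟩ := exists_extension hG
    exact ⟨_, O, build_coef_of_extension hG hO⟩
  · rintro ⟨C, O, rfl⟩
    exact P.build_mem_GO C O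

/-- A configuration adapted to `S` is equivalent to one represented by a pair with second
entry `S`. -/
theorem Adapted.toK_build_coef {S : Matrix.orthogonalGroup (Fin m) ℝ} {G : P.GO}
    (h : P.Adapted S.1 G.1) :
    P.toK ⟨P.build (P.coef S.1 G.1) S.1, P.build_mem_GO _ S⟩ = P.toK G :=
  (toK_eq_of_blocks (V := P.transBlk S.1 G.1)
    (fun r => mul_eq_one_comm.1 (h.transBlk_transpose_mul G.2 r))
    (h.build_coef G.2)).symm

theorem coef_congr {G G' : P.GO} (h : P.toK G = P.toK G') (S : Matrix (Fin m) (Fin m) ℝ) :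
    P.coef S G.1 = P.coef S G'.1 := by
  funext r a z
  unfold coef
  rw [toK_eq_toK_iff.1 h]

end StructParam

end

noncomputable section

namespace StructParam

variable {p m : ℕ} (P : StructParam p m)

/-! ### The projection to the flag manifold -/

variable {P}

/-- An orthogonal matrix that extends the orthonormal rows of a configuration. -/
def frame (G : P.GO) : Matrix.orthogonalGroup (Fin m) ℝ := (exists_extension G.2).choose

theorem frame_row (G : P.GO) (r : Fin p) (a : Fin (P.d (r + 1))) :
    (frame G).1 (P.row ⟨r.succ, a⟩) = G.1 ⟨r, (0, a)⟩ := (exists_extension G.2).choose_spec r a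

theorem frame_row_of_build {G : P.GO} {C : P.Coef} {O : Matrix.orthogonalGroup (Fin m) ℝ}
    (h : P.build C O.1 = G.1) (x : Fin m) (hx : 1 ≤ P.lab x) : (frame G).1 x = O.1 x := by
  refine P.eq_of_row_succ (f := (frame G).1) (g := O.1) (fun r a => ?_) x hx
  rw [frame_row, ← h, build_zero]

/-- In a row or column of positive label, `O` and `O'` are interchangeable in `O' Oᵀ`, which
therefore has the entries of the identity there. -/
theorem toStiefel_eq_of_rows {O O' : Matrix.orthogonalGroup (Fin m) ℝ}
    (h : ∀ x, 1 ≤ P.lab x → O.1 x = O'.1 x) : P.toStiefel O = P.toStiefel O' := by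
  refine Quotient.sound (QuotientGroup.rightRel_apply.2 fun x y hxy => ?_)
  change (O'.1 * O.1ᵀ) (P.row x) (P.row y) = _
  have hlab : ∀ z : P.Row, z.1 ≠ 0 → 1 ≤ P.lab (P.row z) := fun z hz => by
    rw [lab_row]
    exact Fin.pos_iff_ne_zero.2 hz
  have hone : (1 : Matrix (Fin m) (Fin m) ℝ) (P.row x) (P.row y)
      = (1 : Matrix P.Row P.Row ℝ) x y := by
    simp [Matrix.one_apply]
  rw [← hone]
  rcases hxy with hx | hy
  · rw [← Matrix.orthogonalGroup.mul_transpose O, Matrix.mul_apply, Matrix.mul_apply,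
      h _ (hlab x hx)]
  · rw [← Matrix.orthogonalGroup.mul_transpose O', Matrix.mul_apply, Matrix.mul_apply]
    simp only [Matrix.transpose_apply, h _ (hlab y hy)]

/-- The class in `O(m) / O(m - 𝔩)` of a configuration. -/
def toStiefelOfGO (G : P.GO) : P.Stiefel := P.toStiefel (frame G)

theorem toStiefelOfGO_eq {G : P.GO} {C : P.Coef} {O : Matrix.orthogonalGroup (Fin m) ℝ}
    (h : P.build C O.1 = G.1) : toStiefelOfGO G = P.toStiefel O :=
  toStiefel_eq_of_rows (frame_row_of_build h)

theorem toFlag_eq_of_rows {O O' : Matrix.orthogonalGroup (Fin m) ℝ}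
    (h : ∀ x, 1 ≤ P.lab x → O.1 x = O'.1 x) : P.toFlag O = P.toFlag O' :=
  congrArg P.stiefelToFlag (toStiefel_eq_of_rows h)

/-- The rows of label `0`, the only ones that `frame` chooses, enter with coefficient zero. So the
flag depends only on the invariants, hence only on the orbit. -/
theorem flagMatrix_frame (G : P.GO) :
    P.flagMatrix (frame G).1 = ∑ r : Fin p, (r + 1 : ℝ) • P.invt G.1 r 0 := by
  ext x y
  have h1 : P.flagMatrix (frame G).1 x y
      = ∑ z, (P.lab z : ℝ) * ((frame G).1 z x * (frame G).1 z y) := by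
    rw [flagMatrix, Matrix.mul_apply]
    refine Finset.sum_congr rfl fun z _ => ?_
    rw [Matrix.mul_diagonal, Matrix.transpose_apply]
    ring
  rw [h1, ← Equiv.sum_comp P.row, Fintype.sum_sigma, Fin.sum_univ_succ]
  simp only [lab_row, Fin.val_zero, Nat.cast_zero, zero_mul, Finset.sum_const_zero, zero_add,
    frame_row, Fin.val_succ, Nat.cast_add, Nat.cast_one, Matrix.sum_apply, Matrix.smul_apply,
    smul_eq_mul]
  refine Finset.sum_congr rfl fun r _ => ?_
  rw [← Finset.mul_sum]
  rfl

variable (P) in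
/-- The projection `𝒦 → ℱ`. -/
def proj : P.K → P.Flag :=
  Quotient.lift (fun G => P.toFlag (frame G)) fun G G' h => by
    rw [toFlag_eq_toFlag_iff_flagMatrix, flagMatrix_frame, flagMatrix_frame]
    have := toK_eq_toK_iff.1 (Quotient.sound h : P.toK G = P.toK G')
    simp only [this]

theorem proj_toK (G : P.GO) : P.proj (P.toK G) = P.toFlag (frame G) := rfl

theorem proj_toK_of_build {G : P.GO} {C : P.Coef} {O : Matrix.orthogonalGroup (Fin m) ℝ}
    (h : P.build C O.1 = G.1) : P.proj (P.toK G) = P.toFlag O :=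
  toFlag_eq_of_rows (frame_row_of_build h)

variable (P) in
/-- The class of the configuration represented by `(C, O)`. -/
def buildK (C : P.Coef) (O : Matrix.orthogonalGroup (Fin m) ℝ) : P.K :=
  P.toK ⟨P.build C O.1, P.build_mem_GO C O⟩

@[simp]
theorem proj_buildK (C : P.Coef) (O : Matrix.orthogonalGroup (Fin m) ℝ) :
    P.proj (P.buildK C O) = P.toFlag O := proj_toK_of_build rfl

theorem adapted_of_toFlag_eq {G : P.GO} {S : Matrix.orthogonalGroup (Fin m) ℝ}
    (h : P.toFlag S = P.proj (P.toK G)) : P.Adapted S.1 G.1 := by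
  obtain ⟨C, O, e⟩ := (P.mem_GO_iff_exists_build G.1).1 G.2
  rw [← e]
  exact Adapted.build (h.trans (proj_toK_of_build e)) C

/-- The coefficients of a class with respect to an orthogonal matrix. -/
def coefK (S : Matrix (Fin m) (Fin m) ℝ) : P.K → P.Coef :=
  Quotient.lift (fun G => P.coef S G.1) fun _ _ h => coef_congr (Quotient.sound h) S

@[simp]
theorem coefK_buildK (C : P.Coef) (S : Matrix.orthogonalGroup (Fin m) ℝ) :
    coefK S.1 (P.buildK C S) = C := coef_build C S

/-- Together with `coefK_buildK` this makes `C ↦ P.buildK C S` a bijection of `V` onto the fibre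
over the class of `S`. -/
theorem buildK_coefK {S : Matrix.orthogonalGroup (Fin m) ℝ} {x : P.K}
    (h : P.toFlag S = P.proj x) : P.buildK (coefK S.1 x) S = x := by
  obtain ⟨G, rfl⟩ := P.toK_surjective x
  exact (adapted_of_toFlag_eq h).toK_build_coef

/-! ### The manifold structure of the orbit space -/

section Smooth

variable {E : Type*} [NormedAddCommGroup E] [NormedSpace ℝ E] {s : Set E}

theorem contDiffOn_coefSpace {f : E → P.Coef} :
    ContDiffOn ℝ ∞ f s ↔ ∀ r a z, ContDiffOn ℝ ∞ (fun x => f x r a z) s :=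
  (contDiffOn_pi (F' := fun r : Fin p => Matrix (Fin (P.d (r + 1)))
    (Σ l : Fin r, Σ j : Fin (r - l), Fin (P.d j)) ℝ)).trans
    (forall_congr' fun _ => contDiffOn_matrix)

theorem contDiffOn_build {f : E → P.Coef} {g : E → Matrix (Fin m) (Fin m) ℝ}
    (hf : ContDiffOn ℝ ∞ f s) (hg : ContDiffOn ℝ ∞ g s) :
    ContDiffOn ℝ ∞ (fun x => P.build (f x) (g x)) s := by
  rw [contDiffOn_coefSpace] at hf
  rw [contDiffOn_matrix] at hg ⊢
  rintro ⟨r, l, a⟩ x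
  refine Fin.cases ?_ (fun l => ?_) l
  · exact hg _ _
  · simp only [build_succ]
    exact ContDiffOn.sum fun c _ => (hf _ _ _).mul (hg _ _)

theorem contDiffOn_coef {f : E → Matrix P.State (Fin m) ℝ} {g : E → Matrix (Fin m) (Fin m) ℝ}
    (hf : ContDiffOn ℝ ∞ f s) (hg : ContDiffOn ℝ ∞ g s) :
    ContDiffOn ℝ ∞ (fun x => P.coef (g x) (f x)) s := by
  have hblk : ∀ r l, ContDiffOn ℝ ∞ (fun x => P.blk (f x) r l) s := fun r l =>
    contDiffOn_matrix.2 fun _ _ => contDiffOn_matrix.1 hf _ _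
  rw [contDiffOn_coefSpace]
  intro r a z
  exact contDiffOn_matrix.1 ((hg.matrix_mul
    ((hblk r 0).matrix_transpose.matrix_mul (hblk r _))).matrix_mul hg.matrix_transpose) _ _

theorem contDiffOn_topRows {f : E → Matrix P.State (Fin m) ℝ} (hf : ContDiffOn ℝ ∞ f s) :
    ContDiffOn ℝ ∞ (fun x => topRows (f x)) s := by
  rw [contDiffOn_matrix]
  intro y z
  obtain ⟨⟨j, a⟩, rfl⟩ := P.row.surjective y
  have h : ∀ G : Matrix P.State (Fin m) ℝ,
      topRows G (P.row ⟨j, a⟩) = topRow G ⟨j, a⟩ := fun G => by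
    rw [topRows, Equiv.symm_apply_apply]
  simp only [h]
  clear h
  revert a
  refine Fin.cases ?_ (fun r => ?_) j
  · exact fun _ => contDiffOn_const
  · exact fun a => contDiffOn_matrix.1 hf _ _

end Smooth

/-- `frame` is a choice and need not be continuous, whereas `topRows` is linear on the whole matrix
space. They agree in the rows of positive label, the only ones that the flag coordinates see. -/
theorem topRows_mul_eq (G : P.GO) (N : Matrix (Fin m) (Fin m) ℝ) (x : Fin m)
    (hx : 1 ≤ P.lab x) : (topRows G.1 * N) x = ((frame G).1 * N) x := by
  have : topRows G.1 x = (frame G).1 x :=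
    P.eq_of_row_succ (f := topRows G.1) (g := (frame G).1)
      (fun r a => by rw [topRows_row, frame_row]) x hx
  funext y
  simp only [Matrix.mul_apply, this]

variable (P) in
/-- The orthogonal matrix with given flag coordinates around the class of `R`. -/
def localSect (R : Matrix.orthogonalGroup (Fin m) ℝ) (t : UpperIdx P.lab → ℝ) :
    Matrix.orthogonalGroup (Fin m) ℝ := (P.flagSlice R).sect t

theorem contDiff_localSect (R : Matrix.orthogonalGroup (Fin m) ℝ) :
    ContDiff ℝ ∞ fun t => ((P.localSect R t).1 : Matrix (Fin m) (Fin m) ℝ) :=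
  (P.flagSlice R).contDiff_sect

theorem isQuotientMap_toK : Topology.IsQuotientMap P.toK := isQuotientMap_quotient_mk'

theorem isInducing_GO :
    Topology.IsInducing (fun G : P.GO => (G : Matrix P.State (Fin m) ℝ)) :=
  Topology.IsInducing.subtypeVal

instance : T2Space P.K := by
  let f : P.K → (r : Fin p) → Fin (r + 1) → Matrix (Fin m) (Fin m) ℝ :=
    Quotient.lift (fun G r l => P.invt G.1 r l) fun G G' h => by
      have := toK_eq_toK_iff.1 (Quotient.sound h : P.toK G = P.toK G')
      simp only [this]
  refine T2Space.of_injective_continuous (f := f) ?_ ?_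
  · intro b b' h
    obtain ⟨G, rfl⟩ := P.toK_surjective b
    obtain ⟨G', rfl⟩ := P.toK_surjective b'
    exact toK_eq_toK_iff.2 fun r l => congrFun (congrFun h r) l
  · refine continuous_quot_lift _ (continuous_pi fun r => continuous_pi fun l => ?_)
    have hblk : ∀ l, Continuous fun G : P.GO => P.blk G.1 r l := fun l =>
      continuous_matrix fun a x => continuous_subtype_val.matrix_elem _ _
    exact (hblk 0).matrix_transpose.matrix_mul (hblk l)

/-! ### Slices for the orbit space, made of flag coordinates and coefficients. -/

theorem mem_bigCell_iff_frame {R : Matrix.orthogonalGroup (Fin m) ℝ} {G : P.GO} :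
    topRows G.1 * R.1ᵀ ∈ bigCell P.lab ↔ (frame G).1 ∈ (P.flagSlice R).dom :=
  mem_bigCell_congr (topRows_mul_eq G R.1ᵀ)

theorem flagCoord_topRows {R : Matrix.orthogonalGroup (Fin m) ℝ} {G : P.GO}
    (h : topRows G.1 * R.1ᵀ ∈ bigCell P.lab) :
    flagCoord P.lab (topRows G.1 * R.1ᵀ) = (P.flagSlice R).coord (frame G).1 :=
  flagCoord_congr (topRows_mul_eq G R.1ᵀ) h

theorem frame_build_coord (R : Matrix.orthogonalGroup (Fin m) ℝ) (C : P.Coef)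
    (t : UpperIdx P.lab → ℝ) :
    (frame ⟨P.build C (P.localSect R t).1, P.build_mem_GO _ _⟩).1 ∈ (P.flagSlice R).dom ∧
    (P.flagSlice R).coord (frame ⟨P.build C (P.localSect R t).1, P.build_mem_GO _ _⟩).1 = t := by
  have h := (P.flagSlice R).saturated (P.localSect R t)
    (frame ⟨P.build C (P.localSect R t).1, P.build_mem_GO _ _⟩) (proj_buildK C _).symm
    ((P.flagSlice R).sect_mem t)
  exact ⟨h.1, h.2.symm.trans ((P.flagSlice R).coord_sect t)⟩

variable (P) in
/-- The slice for the orbit space around the classes in the fibre over the class of `R`. -/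
def orbitSlice (R : Matrix.orthogonalGroup (Fin m) ℝ) : QuotientSlice
    (fun G : P.GO => (G : Matrix P.State (Fin m) ℝ)) P.toK
    ((UpperIdx P.lab → ℝ) × P.Coef) where
  dom := {G | topRows G * R.1ᵀ ∈ bigCell P.lab}
  coord G := (flagCoord P.lab (topRows G * R.1ᵀ),
    P.coef (P.localSect R (flagCoord P.lab (topRows G * R.1ᵀ))).1 G)
  sect z := ⟨P.build z.2 (P.localSect R z.1).1, P.build_mem_GO _ _⟩
  isOpen_dom := isOpen_bigCell.preimage
    ((contDiffOn_univ.1 (contDiffOn_topRows contDiffOn_id)).continuous.matrix_mul continuous_const)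
  contDiffOn_coord := by
    have h : ContDiffOn ℝ ∞ (fun G : Matrix P.State (Fin m) ℝ =>
        flagCoord P.lab (topRows G * R.1ᵀ)) {G | topRows G * R.1ᵀ ∈ bigCell P.lab} :=
      contDiffOn_flagCoord.comp ((contDiffOn_topRows contDiffOn_id).matrix_mul contDiffOn_const)
        fun _ h => h
    exact h.prodMk (contDiffOn_coef contDiffOn_id ((contDiff_localSect R).comp_contDiffOn h))
  contDiff_sect := by
    rw [← contDiffOn_univ]
    exact contDiffOn_build contDiff_snd.contDiffOn
      ((contDiff_localSect R).comp contDiff_fst).contDiffOn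
  sect_mem z := mem_bigCell_iff_frame.2 (frame_build_coord R z.2 z.1).1
  coord_sect z := by
    have h := frame_build_coord R z.2 z.1
    have e := (flagCoord_topRows (mem_bigCell_iff_frame.2 h.1)).trans h.2
    exact Prod.ext e (by rw [e, coef_build])
  saturated G G' h hG := by
    have hS := (P.flagSlice R).saturated (frame G) (frame G') (congrArg P.proj h)
      (mem_bigCell_iff_frame.1 hG)
    have hG' := mem_bigCell_iff_frame.2 hS.1
    have e : flagCoord P.lab (topRows G.1 * R.1ᵀ) = flagCoord P.lab (topRows G'.1 * R.1ᵀ) :=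
      ((flagCoord_topRows hG).trans hS.2).trans (flagCoord_topRows hG').symm
    exact ⟨hG', Prod.ext e (by rw [e, coef_congr h])⟩
  q_sect_coord G hG := by
    refine buildK_coefK (x := P.toK G) ?_
    rw [proj_toK, ← (P.flagSlice R).q_sect_coord (frame G) (mem_bigCell_iff_frame.1 hG),
      flagCoord_topRows hG]
    rfl

theorem mem_dom_orbitSlice_frame (G : P.GO) : G.1 ∈ (P.orbitSlice (frame G)).dom :=
  mem_bigCell_iff_frame.2 (P.mem_dom_flagSlice_self (frame G))

variable (P)

theorem finrank_coef : Module.finrank ℝ P.Coef = P.fibreDim := by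
  have h : Module.finrank ℝ P.Coef = Module.finrank ℝ ((r : Fin p) →
    Matrix (Fin (P.d (r + 1))) (Σ l : Fin r, Σ j : Fin (r - l), Fin (P.d j)) ℝ) := rfl
  rw [h, Module.finrank_pi_fintype, fibreDim, ← Finset.Ico_add_one_right_eq_Icc,
    Finset.sum_Ico_eq_sum_range, Nat.add_sub_cancel, Finset.sum_range]
  refine Finset.sum_congr rfl fun r _ => ?_
  rw [Module.finrank_matrix, Module.finrank_self, mul_one, Fintype.card_fin, Fintype.card_sigma,
    ← Finset.Ico_add_one_right_eq_Icc, Finset.sum_Ico_eq_sum_range, add_comm 1 (r : ℕ),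
    Nat.add_sub_cancel, Nat.add_sub_cancel, Finset.sum_range]
  congr 1
  refine Finset.sum_congr rfl fun l _ => ?_
  rw [Fintype.card_sigma, add_comm 1 (l : ℕ), Nat.add_sub_add_right, Finset.sum_range]
  simp only [Fintype.card_fin]

instance : FiniteDimensional ℝ P.Coef :=
  inferInstanceAs (FiniteDimensional ℝ ((r : Fin p) →
    Matrix (Fin (P.d (r + 1))) (Σ l : Fin r, Σ j : Fin (r - l), Fin (P.d j)) ℝ))

/-- Linear coordinates on the model space of the orbit space. -/
def orbitModel : ((UpperIdx P.lab → ℝ) × P.Coef) ≃L[ℝ]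
    EuclideanSpace ℝ (Fin (P.flagDim + P.fibreDim)) :=
  ContinuousLinearEquiv.ofFinrankEq (by simp [card_upperIdx, finrank_coef])

instance : ChartedSpace (EuclideanSpace ℝ (Fin (P.flagDim + P.fibreDim))) P.K :=
  QuotientSlice.chartedSpace (fun R => (P.orbitSlice R).congr P.orbitModel)
    isInducing_GO isQuotientMap_toK fun G => ⟨frame G, mem_dom_orbitSlice_frame G⟩

theorem atlas_K : atlas (EuclideanSpace ℝ (Fin (P.flagDim + P.fibreDim))) P.K
    = Set.range fun R => ((P.orbitSlice R).congr P.orbitModel).chart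
      isInducing_GO isQuotientMap_toK := rfl

instance : SecondCountableTopology P.GO :=
  inferInstanceAs (SecondCountableTopology {A : P.State → Fin m → ℝ // A ∈ P.GO})

theorem isSmoothQuotient_K : IsSmoothQuotient (P.flagDim + P.fibreDim)
    (fun G : P.GO => (G : Matrix P.State (Fin m) ℝ)) P.toK :=
  QuotientSlice.isSmoothQuotient P.atlas_K fun G => ⟨frame G, mem_dom_orbitSlice_frame G⟩

end StructParam

end

noncomputable section

namespace StructParam

variable {p m : ℕ} {P : StructParam p m}

/-! ### The vector bundle structure -/

/-- The dependence of the coefficients of a fixed configuration on the orthogonal matrix. -/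
def coefChange (S O : Matrix (Fin m) (Fin m) ℝ) : P.Coef →ₗ[ℝ] P.Coef where
  toFun C := P.coef S (P.build C O)
  map_add' C C' := by
    funext r a ⟨l, c⟩
    -- `build` is only affine in `C`, but its blocks with sub-index `0` do not involve `C`. So
    -- `transBlk` is constant and the coefficients are linear in `C`.
    have e : ∀ C, P.transBlk S (P.build C O) r a
      = fun b => (S * Oᵀ) (P.row ⟨r.succ, a⟩) (P.row ⟨r.succ, b⟩) := fun _ => rfl
    change P.coef S _ r a ⟨l, c⟩ = P.coef S _ r a ⟨l, c⟩ + P.coef S _ r a ⟨l, c⟩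
    simp only [coef_apply, e, build_mul_transpose_succ, ← Finset.sum_add_distrib, ← mul_add]
    refine Finset.sum_congr rfl fun b _ => ?_
    congr 1
    exact Finset.sum_congr rfl fun c' _ => add_mul _ _ _
  map_smul' k C := by
    funext r a ⟨l, c⟩
    have e : ∀ C, P.transBlk S (P.build C O) r a
      = fun b => (S * Oᵀ) (P.row ⟨r.succ, a⟩) (P.row ⟨r.succ, b⟩) := fun _ => rfl
    change P.coef S _ r a ⟨l, c⟩ = k * P.coef S _ r a ⟨l, c⟩
    simp only [coef_apply, e, build_mul_transpose_succ, Finset.mul_sum]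
    refine Finset.sum_congr rfl fun b _ => Finset.sum_congr rfl fun c' _ => ?_
    change _ * (k * C r b ⟨l, c'⟩ * _) = _
    ring

/-- The fibre over the class of `S` is parametrized by the coefficients with respect to `S`. -/
def fibreEquiv {b : P.Flag} (S : Matrix.orthogonalGroup (Fin m) ℝ) (hS : P.toFlag S = b) :
    P.Coef ≃ Fibre P.proj b where
  toFun C := ⟨P.buildK C S, (proj_buildK C S).trans hS⟩
  invFun x := coefK S.1 x.1
  left_inv C := coefK_buildK C S
  right_inv x := Subtype.ext (buildK_coefK (hS.trans x.2.symm))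

/-- A representative of a point of the flag manifold. -/
def flagRep (b : P.Flag) : Matrix.orthogonalGroup (Fin m) ℝ := (P.toFlag_surjective b).choose

theorem toFlag_flagRep (b : P.Flag) : P.toFlag (flagRep b) = b :=
  (P.toFlag_surjective b).choose_spec

/-- The structure is transported from a chosen representative; `fibreLinearEquiv` shows that every
representative gives the same one. -/
instance (b : P.Flag) : AddCommGroup (Fibre P.proj b) :=
  (fibreEquiv (flagRep b) (toFlag_flagRep b)).symm.addCommGroup

instance (b : P.Flag) : Module ℝ (Fibre P.proj b) :=
  (fibreEquiv (flagRep b) (toFlag_flagRep b)).symm.module ℝ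

/-- The linear isomorphism given by a representative of the base point. -/
def fibreLinearEquiv {b : P.Flag} (S : Matrix.orthogonalGroup (Fin m) ℝ) (hS : P.toFlag S = b) :
    P.Coef ≃ₗ[ℝ] Fibre P.proj b where
  __ := fibreEquiv S hS
  map_add' C C' := by
    refine (fibreEquiv (flagRep b) (toFlag_flagRep b)).symm.injective ?_
    have h := ((fibreEquiv (flagRep b) (toFlag_flagRep b)).symm.addEquiv).map_add
      (fibreEquiv S hS C) (fibreEquiv S hS C')
    exact ((coefChange (flagRep b).1 S.1).map_add C C').trans h.symm
  map_smul' k C := by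
    refine (fibreEquiv (flagRep b) (toFlag_flagRep b)).symm.injective ?_
    have h := ((fibreEquiv (flagRep b) (toFlag_flagRep b)).symm.linearEquiv ℝ).map_smul k
      (fibreEquiv S hS C)
    exact ((coefChange (flagRep b).1 S.1).map_smul k C).trans h.symm

variable (P) in
/-- The union of the fibres is the orbit space. -/
def totalHomeo : Bundle.TotalSpace P.Coef (Fibre P.proj) ≃ₜ P.K where
  toFun z := z.2.1
  invFun x := ⟨P.proj x, ⟨x, rfl⟩⟩
  left_inv := by
    rintro ⟨b, x, rfl⟩
    rfl
  right_inv _ := rfl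
  continuous_toFun := continuous_induced_dom
  continuous_invFun := continuous_induced_rng.2 continuous_id

/-! ### Local trivializations and their coordinate changes. -/

variable (R : Matrix.orthogonalGroup (Fin m) ℝ)

theorem mem_baseSet_orbitSlice {x : P.K} :
    x ∈ (P.orbitSlice R).baseSet ↔ P.proj x ∈ (P.flagSlice R).baseSet := by
  obtain ⟨G, rfl⟩ := P.toK_surjective x
  rw [QuotientSlice.mem_baseSet, proj_toK, QuotientSlice.mem_baseSet]
  exact mem_bigCell_iff_frame

variable (P) in
/-- The local section of `O(m) → ℱ` over the domain of a chart. -/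
def flagSection (b : P.Flag) : Matrix.orthogonalGroup (Fin m) ℝ :=
  P.localSect R ((P.flagSlice R).toFun b)

theorem toFlag_flagSection {b : P.Flag} (hb : b ∈ (P.flagSlice R).baseSet) :
    P.toFlag (P.flagSection R b) = b := by
  obtain ⟨O, hO, rfl⟩ := hb
  rw [flagSection, QuotientSlice.toFun_apply _ hO]
  exact (P.flagSlice R).q_sect_coord O hO

/-- In the coordinates of the slices, `π` is the projection to the first factor; the second factor
becomes the fibre coordinate. -/
theorem orbitSlice_toFun {x : P.K} (hx : x ∈ (P.orbitSlice R).baseSet) :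
    (P.orbitSlice R).toFun x
      = ((P.flagSlice R).toFun (P.proj x), coefK (P.flagSection R (P.proj x)).1 x) := by
  obtain ⟨G, hG, rfl⟩ := hx
  rw [QuotientSlice.toFun_apply _ hG, flagSection, proj_toK,
    QuotientSlice.toFun_apply _ (mem_bigCell_iff_frame.1 hG), ← flagCoord_topRows hG]
  rfl

theorem contMDiffOn_flagSlice_toFun :
    ContMDiffOn (𝓡 P.flagDim) 𝓘(ℝ, UpperIdx P.lab → ℝ) ∞ (P.flagSlice R).toFun
      (P.flagSlice R).baseSet := by
  have h := P.flagModel.symm.contDiff.contMDiff.comp_contMDiffOn (n := ∞)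
    (QuotientSlice.contMDiffOn_chart P.atlas_flag R)
  refine h.congr fun b hb => ?_
  obtain ⟨O, hO, rfl⟩ := hb
  rw [QuotientSlice.toFun_apply _ hO]
  change _ = P.flagModel.symm (((P.flagSlice R).congr P.flagModel).toFun (P.toFlag O))
  rw [QuotientSlice.toFun_apply _ hO]
  exact (P.flagModel.symm_apply_apply _).symm

theorem contMDiffOn_orbitSlice_toFun :
    ContMDiffOn (𝓡 (P.flagDim + P.fibreDim)) 𝓘(ℝ, (UpperIdx P.lab → ℝ) × P.Coef) ∞
      (P.orbitSlice R).toFun (P.orbitSlice R).baseSet := by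
  have h := P.orbitModel.symm.contDiff.contMDiff.comp_contMDiffOn (n := ∞)
    (QuotientSlice.contMDiffOn_chart P.atlas_K R)
  refine h.congr fun b hb => ?_
  obtain ⟨G, hG, rfl⟩ := hb
  rw [QuotientSlice.toFun_apply _ hG]
  change _ = P.orbitModel.symm (((P.orbitSlice R).congr P.orbitModel).toFun (P.toK G))
  rw [QuotientSlice.toFun_apply _ hG]
  exact (P.orbitModel.symm_apply_apply _).symm

theorem contMDiff_toFlag_localSect :
    ContMDiff 𝓘(ℝ, UpperIdx P.lab → ℝ) (𝓡 P.flagDim) ∞ fun t => P.toFlag (P.localSect R t) := by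
  have h := (QuotientSlice.contMDiff_chart_symm P.atlas_flag R).comp
    (P.flagModel.contDiff.contMDiff (n := ∞))
  refine h.congr fun t => ?_
  change _ = P.toFlag ((P.flagSlice R).sect (P.flagModel.symm (P.flagModel t)))
  rw [P.flagModel.symm_apply_apply]
  rfl

theorem contMDiff_buildK_localSect :
    ContMDiff 𝓘(ℝ, (UpperIdx P.lab → ℝ) × P.Coef) (𝓡 (P.flagDim + P.fibreDim)) ∞
      fun z : (UpperIdx P.lab → ℝ) × P.Coef => P.buildK z.2 (P.localSect R z.1) := by
  have h := (QuotientSlice.contMDiff_chart_symm P.atlas_K R).comp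
    (P.orbitModel.contDiff.contMDiff (n := ∞))
  refine h.congr fun t => ?_
  change _ = P.toK ((P.orbitSlice R).sect (P.orbitModel.symm (P.orbitModel t)))
  rw [P.orbitModel.symm_apply_apply]
  rfl

theorem contMDiffOn_buildK_flagSection :
    ContMDiffOn ((𝓡 P.flagDim).prod 𝓘(ℝ, P.Coef)) (𝓡 (P.flagDim + P.fibreDim)) ∞
      (fun z : P.Flag × P.Coef => P.buildK z.2 (P.flagSection R z.1))
      ((P.flagSlice R).baseSet ×ˢ Set.univ) := by
  have h1 : ContMDiffOn ((𝓡 P.flagDim).prod 𝓘(ℝ, P.Coef)) 𝓘(ℝ, UpperIdx P.lab → ℝ) ∞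
      (fun z : P.Flag × P.Coef => (P.flagSlice R).toFun z.1)
      ((P.flagSlice R).baseSet ×ˢ Set.univ) :=
    (contMDiffOn_flagSlice_toFun (P := P) R).comp contMDiffOn_fst fun _ h => h.1
  have h2 : ContMDiffOn ((𝓡 P.flagDim).prod 𝓘(ℝ, P.Coef)) 𝓘(ℝ, P.Coef) ∞
      (fun z : P.Flag × P.Coef => z.2) ((P.flagSlice R).baseSet ×ˢ Set.univ) := contMDiffOn_snd
  have h3 := h1.prodMk_space h2
  have h4 := (contMDiff_buildK_localSect (P := P) R).comp_contMDiffOn h3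
  exact h4

theorem contMDiffOn_proj_coefK :
    ContMDiffOn (𝓡 (P.flagDim + P.fibreDim)) ((𝓡 P.flagDim).prod 𝓘(ℝ, P.Coef)) ∞
      (fun x : P.K => (P.proj x, coefK (P.flagSection R (P.proj x)).1 x))
      (P.orbitSlice R).baseSet := by
  have h := contMDiffOn_orbitSlice_toFun (P := P) R
  refine (((contMDiff_toFlag_localSect R).comp_contMDiffOn
    (contDiff_fst.contMDiff.comp_contMDiffOn h)).prodMk
      (contDiff_snd.contMDiff.comp_contMDiffOn h)).congr fun x hx => ?_
  have hb := toFlag_flagSection R ((mem_baseSet_orbitSlice R).1 hx)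
  simp only [Function.comp_apply, orbitSlice_toFun R hx]
  exact Prod.ext hb.symm rfl

variable (P) in
/-- The local trivialization over the domain of a chart of the flag manifold. -/
def triv : Bundle.Trivialization P.Coef
    (Bundle.TotalSpace.proj : Bundle.TotalSpace P.Coef (Fibre P.proj) → P.Flag) where
  toFun z := (z.1, coefK (P.flagSection R z.1).1 z.2.1)
  invFun z := P.totalHomeo.symm (P.buildK z.2 (P.flagSection R z.1))
  source := Bundle.TotalSpace.proj ⁻¹' (P.flagSlice R).baseSet
  target := (P.flagSlice R).baseSet ×ˢ Set.univ
  map_source' _ hz := ⟨hz, Set.mem_univ _⟩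
  map_target' z hz := by
    change P.proj (P.buildK z.2 (P.flagSection R z.1)) ∈ (P.flagSlice R).baseSet
    rw [proj_buildK, toFlag_flagSection R hz.1]
    exact hz.1
  left_inv' := by
    rintro ⟨b, x, rfl⟩ hz
    exact congrArg P.totalHomeo.symm (buildK_coefK (toFlag_flagSection R hz))
  right_inv' := by
    rintro ⟨b, C⟩ hz
    have hb := toFlag_flagSection R hz.1
    have h : P.proj (P.buildK C (P.flagSection R b)) = b := by rw [proj_buildK, hb]
    change (P.proj (P.buildK C (P.flagSection R b)),
      coefK (P.flagSection R (P.proj (P.buildK C (P.flagSection R b)))).1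
        (P.buildK C (P.flagSection R b))) = (b, C)
    rw [h, coefK_buildK]
  open_source := by
    have h : (Bundle.TotalSpace.proj ⁻¹' (P.flagSlice R).baseSet :
        Set (Bundle.TotalSpace P.Coef (Fibre P.proj)))
          = P.totalHomeo ⁻¹' (P.orbitSlice R).baseSet := by
      ext ⟨b, x, rfl⟩
      exact (mem_baseSet_orbitSlice R).symm
    rw [h]
    exact ((P.orbitSlice R).isOpen_baseSet isInducing_GO isQuotientMap_toK).preimage
      P.totalHomeo.continuous
  open_target := ((P.flagSlice R).isOpen_baseSet isInducing_orthogonalGroup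
    P.isQuotientMap_toFlag).prod isOpen_univ
  continuousOn_toFun := by
    refine ((contMDiffOn_proj_coefK R).continuousOn.comp P.totalHomeo.continuous.continuousOn
      ?_).congr ?_
    · rintro ⟨b, x, rfl⟩ hz
      exact (mem_baseSet_orbitSlice R).2 hz
    · rintro ⟨b, x, rfl⟩ hz
      rfl
  continuousOn_invFun :=
    P.totalHomeo.symm.continuous.comp_continuousOn (contMDiffOn_buildK_flagSection R).continuousOn
  baseSet := (P.flagSlice R).baseSet
  open_baseSet := (P.flagSlice R).isOpen_baseSet isInducing_orthogonalGroup P.isQuotientMap_toFlag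
  source_eq := rfl
  target_eq := rfl
  proj_toFun _ _ := rfl

instance : (P.triv R).IsLinear ℝ where
  linear b hb := by
    have h : (fun x : Fibre P.proj b => (P.triv R ⟨b, x⟩).2)
        = (fibreLinearEquiv (P.flagSection R b) (toFlag_flagSection R hb)).symm := by
      rfl
    rw [h]
    exact LinearMap.isLinear (fibreLinearEquiv (P.flagSection R b)
      (toFlag_flagSection R hb)).symm.toLinearMap

theorem mem_baseSet_flagRep (b : P.Flag) : b ∈ (P.flagSlice (flagRep b)).baseSet := by
  have := (P.flagSlice (flagRep b)).mem_baseSet.2 (P.mem_dom_flagSlice_self (flagRep b))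
  rwa [toFlag_flagRep] at this

instance : FiberBundle P.Coef (Fibre P.proj) where
  totalSpaceMk_isInducing' b := by
    rw [← P.totalHomeo.isInducing.of_comp_iff]
    exact Topology.IsInducing.subtypeVal
  trivializationAtlas' := Set.range P.triv
  trivializationAt' b := P.triv (flagRep b)
  mem_baseSet_trivializationAt' := mem_baseSet_flagRep
  trivialization_mem_atlas' b := ⟨_, rfl⟩

/-- As `V` has finite dimension, smoothness of a family of operators can be tested on each vector,
where the expression is polynomial in the entries of the two sections. -/
theorem contDiff_coefChange_localSect (R' : Matrix.orthogonalGroup (Fin m) ℝ) : ContDiff ℝ ∞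
    fun z : (UpperIdx P.lab → ℝ) × (UpperIdx P.lab → ℝ) => LinearMap.toContinuousLinearMap
      (coefChange (P := P) (P.localSect R' z.1).1 (P.localSect R z.2).1) := by
  rw [contDiff_clm_apply_iff]
  intro C
  exact contDiffOn_univ.1 (contDiffOn_coef (contDiffOn_build contDiffOn_const
    ((contDiff_localSect R).comp contDiff_snd).contDiffOn)
    ((contDiff_localSect R').comp contDiff_fst).contDiffOn)

theorem coordChangeL_triv (R' : Matrix.orthogonalGroup (Fin m) ℝ) {b : P.Flag}
    (hb : b ∈ (P.triv R).baseSet ∩ (P.triv R').baseSet) :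
    ((P.triv R).coordChangeL ℝ (P.triv R') b : P.Coef →L[ℝ] P.Coef)
      = LinearMap.toContinuousLinearMap
        (coefChange (P.flagSection R' b).1 (P.flagSection R b).1) := by
  ext1 C
  have h1 := Bundle.Trivialization.coordChangeL_apply' (R := ℝ) (P.triv R) (P.triv R') hb C
  refine h1.trans ?_
  change coefK (P.flagSection R' (P.proj (P.buildK C (P.flagSection R b)))).1
    (P.buildK C (P.flagSection R b)) = _
  rw [proj_buildK, toFlag_flagSection R hb.1]
  rfl

theorem contMDiffOn_coordChangeL_triv (R' : Matrix.orthogonalGroup (Fin m) ℝ) :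
    ContMDiffOn (𝓡 P.flagDim) 𝓘(ℝ, P.Coef →L[ℝ] P.Coef) ∞
      (fun b => ((P.triv R).coordChangeL ℝ (P.triv R') b : P.Coef →L[ℝ] P.Coef))
      ((P.triv R).baseSet ∩ (P.triv R').baseSet) := by
  have h := (contDiff_coefChange_localSect R R').contMDiff.comp_contMDiffOn
    (((contMDiffOn_flagSlice_toFun R').mono Set.inter_subset_right).prodMk_space
      ((contMDiffOn_flagSlice_toFun R).mono
        (Set.inter_subset_left (s := (P.flagSlice R).baseSet))))
  exact h.congr fun b hb => coordChangeL_triv R R' hb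

instance : VectorBundle ℝ P.Coef (Fibre P.proj) where
  trivialization_linear' := by
    rintro e ⟨R, rfl⟩
    infer_instance
  continuousOn_coordChange' := by
    rintro e e' ⟨R, rfl⟩ ⟨R', rfl⟩
    exact (contMDiffOn_coordChangeL_triv R R').continuousOn

instance : ContMDiffVectorBundle ∞ P.Coef (Fibre P.proj) (𝓡 P.flagDim) where
  contMDiffOn_coordChangeL := by
    rintro e e' ⟨R, rfl⟩ ⟨R', rfl⟩
    exact contMDiffOn_coordChangeL_triv R R'

instance : MemTrivializationAtlas (P.triv R) := ⟨⟨R, rfl⟩⟩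

variable (P) in
/-- The union of the fibres is diffeomorphic to the orbit space. -/
def totalDiffeo : Bundle.TotalSpace P.Coef (Fibre P.proj)
    ≃ₘ^∞⟮(𝓡 P.flagDim).prod 𝓘(ℝ, P.Coef), 𝓡 (P.flagDim + P.fibreDim)⟯ P.K where
  toEquiv := P.totalHomeo.toEquiv
  contMDiff_toFun := by
    intro z
    obtain ⟨R, hR⟩ : ∃ R, z.1 ∈ (P.flagSlice R).baseSet := ⟨_, mem_baseSet_flagRep z.1⟩
    have he := Bundle.Trivialization.contMDiffOn (IB := 𝓡 P.flagDim) (n := ∞) (P.triv R)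
    have h := (contMDiffOn_buildK_flagSection R).comp he (P.triv R).mapsTo
    refine ((h.congr fun z' hz' => ?_).contMDiffAt ((P.triv R).open_source.mem_nhds hR))
    exact congrArg P.totalHomeo ((P.triv R).left_inv hz').symm
  contMDiff_invFun := by
    intro x
    obtain ⟨R, hR⟩ : ∃ R, P.proj x ∈ (P.flagSlice R).baseSet := ⟨_, mem_baseSet_flagRep _⟩
    have he := Bundle.Trivialization.contMDiffOn_symm (IB := 𝓡 P.flagDim) (n := ∞) (P.triv R)
    have h := he.comp (contMDiffOn_proj_coefK R) fun y hy =>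
      ⟨(mem_baseSet_orbitSlice R).1 hy, Set.mem_univ _⟩
    refine ((h.congr fun y hy => ?_).contMDiffAt
      (((P.orbitSlice R).isOpen_baseSet isInducing_GO isQuotientMap_toK).mem_nhds
        ((mem_baseSet_orbitSlice R).2 hR)))
    exact ((P.triv R).left_inv (x := P.totalHomeo.symm y) ((mem_baseSet_orbitSlice R).1 hy)).symm

theorem contMDiff_proj : ContMDiff (𝓡 (P.flagDim + P.fibreDim)) (𝓡 P.flagDim) ∞ P.proj := by
  intro x
  have hR := mem_baseSet_flagRep (P.proj x)
  exact (contMDiff_fst.comp_contMDiffOn (contMDiffOn_proj_coefK (flagRep (P.proj x)))).contMDiffAt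
    (((P.orbitSlice _).isOpen_baseSet isInducing_GO isQuotientMap_toK).mem_nhds
      ((mem_baseSet_orbitSlice _).2 hR))

variable (P) in
/-- If the fibre is zero, then the orbit space is diffeomorphic to the flag manifold. -/
def projDiffeo [Subsingleton P.Coef] :
    P.K ≃ₘ^∞⟮𝓡 (P.flagDim + P.fibreDim), 𝓡 P.flagDim⟯ P.Flag where
  toFun := P.proj
  invFun b := P.buildK 0 (flagRep b)
  left_inv x := by
    conv_rhs => rw [← buildK_coefK (toFlag_flagRep (P.proj x))]
    rw [Subsingleton.elim (0 : P.Coef)]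
  right_inv b := by
    rw [proj_buildK, toFlag_flagRep]
  contMDiff_toFun := contMDiff_proj
  contMDiff_invFun := by
    intro b
    have h := (contMDiffOn_buildK_flagSection (flagRep b)).comp
      (contMDiff_id.prodMk (contMDiff_const (c := (0 : P.Coef)))).contMDiffOn
      (s := (P.flagSlice (flagRep b)).baseSet) fun y hy => ⟨hy, Set.mem_univ _⟩
    refine ((h.congr fun y hy => ?_).contMDiffAt (((P.flagSlice _).isOpen_baseSet
      isInducing_orthogonalGroup P.isQuotientMap_toFlag).mem_nhds (mem_baseSet_flagRep b)))
    -- `flagRep` is a bare choice. As the fibre is a point, it can be replaced by the smooth local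
    -- section without changing the class.
    change P.buildK 0 (flagRep y) = P.buildK 0 (P.flagSection (flagRep b) y)
    have hy' : P.proj (P.buildK 0 (flagRep y)) = y := by rw [proj_buildK, toFlag_flagRep]
    rw [← buildK_coefK ((toFlag_flagSection _ hy).trans hy'.symm), Subsingleton.elim (coefK _ _) 0]

end StructParam

end

noncomputable section

namespace StructParam

variable {p m : ℕ} {P : StructParam p m}

/-! ### The group as a product of orthogonal groups -/

theorem diagBlk_mul {Q R : Matrix P.State P.State ℝ} (hQ : P.IsOrthBlockDiag Q) (r : Fin p) :
    P.diagBlk (Q * R) r = P.diagBlk Q r * P.diagBlk R r := by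
  ext a b
  exact hQ.mul_apply R r 0 a _

/-- Extension of a family of orthogonal matrices by the trivial blocks of size zero. -/
def extendBlocks (V : (r : {r : Fin p // 0 < P.d (r + 1)}) →
    Matrix.orthogonalGroup (Fin (P.d (r.1 + 1))) ℝ) (r : Fin p) :
    Matrix (Fin (P.d (r + 1))) (Fin (P.d (r + 1))) ℝ :=
  if h : 0 < P.d (r + 1) then (V ⟨r, h⟩).1 else 1

theorem extendBlocks_mul_transpose (V : (r : {r : Fin p // 0 < P.d (r + 1)}) →
    Matrix.orthogonalGroup (Fin (P.d (r.1 + 1))) ℝ) (r : Fin p) :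
    extendBlocks V r * (extendBlocks V r)ᵀ = 1 := by
  unfold extendBlocks
  split_ifs with h
  · exact Matrix.orthogonalGroup.mul_transpose (V ⟨r, h⟩)
  · simp

variable (P) in
/-- The group `𝒬` is a product of orthogonal groups. -/
def groupEquiv : P.Q ≃ₜ* ((r : {r : Fin p // 0 < P.d (r + 1)}) →
    Matrix.orthogonalGroup (Fin (P.d (r.1 + 1))) ℝ) where
  toFun U r := ⟨P.diagBlk U.1.1 r.1, (Matrix.mem_orthogonalGroup_iff _ _).2 (U.2.orth r.1)⟩
  invFun V := ⟨(isOrthBlockDiag_ofBlocks (extendBlocks_mul_transpose V)).unit,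
    IsOrthBlockDiag.unit_mem _⟩
  left_inv U := by
    refine Subtype.ext (Units.ext ?_)
    refine Eq.trans ?_ (IsOrthBlockDiag.eq_ofBlocks U.2).symm
    refine congrArg P.ofBlocks (funext fun r => ?_)
    unfold extendBlocks
    split_ifs with h
    · rfl
    · ext a
      exact absurd a.2 (by omega)
  right_inv V := by
    funext r
    refine Subtype.ext ((diagBlk_ofBlocks r.1).trans ?_)
    exact dif_pos r.2
  map_mul' U U' := funext fun r => Subtype.ext (diagBlk_mul U.2 r.1)
  continuous_toFun := by
    refine continuous_pi fun r => Continuous.subtype_mk (continuous_matrix fun a b => ?_) _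
    exact (Units.continuous_val.comp continuous_subtype_val).matrix_elem _ _
  continuous_invFun := by
    have h : Continuous fun V : (r : {r : Fin p // 0 < P.d (r + 1)}) →
        Matrix.orthogonalGroup (Fin (P.d (r.1 + 1))) ℝ => P.ofBlocks (extendBlocks V) := by
      have h1 : Continuous fun V : (r : {r : Fin p // 0 < P.d (r + 1)}) →
          Matrix.orthogonalGroup (Fin (P.d (r.1 + 1))) ℝ => extendBlocks (P := P) V := by
        refine continuous_pi fun r => ?_
        unfold extendBlocks
        split_ifs with h
        · exact continuous_subtype_val.comp (continuous_apply _)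
        · exact continuous_const
      refine continuous_matrix fun x y => ?_
      unfold ofBlocks
      split_ifs
      · exact h1.matrix_blockDiagonal'.matrix_elem _ _
      · exact continuous_const
    exact Continuous.subtype_mk (Units.continuous_iff.2 ⟨h, h.matrix_transpose⟩) _

/-! ### The generalized Rayleigh quotient -/

theorem kappa_mul {Q : Matrix P.State P.State ℝ} (hQ : P.IsOrthBlockDiag Q)
    (G : Matrix P.State (Fin m) ℝ) : P.kappa (Q * G) = Q * P.kappa G := by
  ext ⟨r, l, a⟩ ⟨i, y⟩
  rw [hQ.mul_apply]
  unfold kappa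
  dsimp only
  split_ifs
  · exact hQ.mul_apply G r _ a y
  · simp

/-- Since `κ(Q G) = Q κ(G)`, both determinants are multiplied by `det Q * det Qᵀ = 1`. -/
theorem rayleigh_mul {Q : Matrix P.State P.State ℝ} (hQ : P.IsOrthBlockDiag Q)
    (A B : Matrix (Fin p × Fin m) (Fin p × Fin m) ℝ) (G : Matrix P.State (Fin m) ℝ) :
    P.rayleigh A B (Q * G) = P.rayleigh A B G := by
  have h : ∀ N : Matrix (Fin p × Fin m) (Fin p × Fin m) ℝ,
      (P.kappa (Q * G) * N * (P.kappa (Q * G))ᵀ).det = (P.kappa G * N * (P.kappa G)ᵀ).det := by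
    intro N
    have h1 := congrArg Matrix.det hQ.mul_transpose
    rw [Matrix.det_mul, Matrix.det_one] at h1
    have h2 : P.kappa (Q * G) * N * (P.kappa (Q * G))ᵀ
        = Q * (P.kappa G * N * (P.kappa G)ᵀ) * Qᵀ := by
      rw [kappa_mul hQ, Matrix.transpose_mul]
      simp only [Matrix.mul_assoc]
    rw [h2, Matrix.det_mul, Matrix.det_mul, mul_right_comm, h1, one_mul]
  rw [rayleigh, rayleigh, h, h]

/-- `κ(G)` is in block echelon form: the last nonzero block in the row `(r, l)` stands in column `r
- l` (counted from `0`) and is `G_{r,0}`. Rows with the same `r - l` have different `r` or the same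
`(r, l)`, so these last blocks have orthonormal rows. Pairing column `r - l` of `v κ(G) = 0` with a
row of `G_{r,0}` isolates one entry of `v`, once the entries with larger `r - l` are known to
vanish. -/
theorem vecMul_kappa_injective {G : Matrix P.State (Fin m) ℝ} (hG : G ∈ P.GO) :
    Function.Injective (P.kappa G).vecMul := by
  have hker : ∀ v, v ᵥ* P.kappa G = 0 → v = 0 := by
    intro v hv
    -- Induction on `p - (r - l)` treats the rows in the order of decreasing `r - l`.
    have key : ∀ n, ∀ x : P.State, p - ((x.1 : ℕ) - x.2.1) = n → v x = 0 := by
      intro n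
      induction n using Nat.strong_induction_on with
      | _ n ih =>
        rintro ⟨r, l, a⟩ hn
        dsimp only at hn
        have hl := l.2
        have hr := r.2
        set s : Fin p := ⟨r - l, by omega⟩ with hs
        have h0 : ∑ y, (v ᵥ* P.kappa G) (s, y) * G ⟨r, (0, a)⟩ y = 0 := by simp [hv]
        have h1 : ∑ y, (v ᵥ* P.kappa G) (s, y) * G ⟨r, (0, a)⟩ y
            = ∑ x, v x * ∑ y, P.kappa G x (s, y) * G ⟨r, (0, a)⟩ y := by
          simp only [Matrix.vecMul, dotProduct, Finset.sum_mul, Finset.mul_sum, mul_assoc]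
          exact Finset.sum_comm
        rw [h1, Finset.sum_eq_single ⟨r, (l, a)⟩] at h0
        · have h2 : ∑ y, P.kappa G ⟨r, (l, a)⟩ (s, y) * G ⟨r, (0, a)⟩ y
              = (G * Gᵀ) ⟨r, (0, a)⟩ ⟨r, (0, a)⟩ := by
            rw [Matrix.mul_apply]
            refine Finset.sum_congr rfl fun y _ => ?_
            have h3 : (⟨r - l - (r - l), by omega⟩ : Fin (r + 1)) = 0 := by
              ext; simp
            simp only [kappa, hs]
            rw [if_pos (by omega), h3, Matrix.transpose_apply]
          rwa [h2, (P.mem_GO_iff.1 hG).1, Matrix.one_apply_eq, mul_one] at h0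
        · rintro ⟨r', l', a'⟩ - hne
          have hl' := l'.2
          rcases lt_trichotomy ((r' : ℕ) - l') s with hlt | heq | hgt
          · have h3 : ∀ y, P.kappa G ⟨r', (l', a')⟩ (s, y) = 0 := fun y =>
              if_neg (by dsimp only; omega)
            simp [h3]
          · have h2 : ∑ y, P.kappa G ⟨r', (l', a')⟩ (s, y) * G ⟨r, (0, a)⟩ y
                = (G * Gᵀ) ⟨r', (0, a')⟩ ⟨r, (0, a)⟩ := by
              rw [Matrix.mul_apply]
              refine Finset.sum_congr rfl fun y _ => ?_
              have h3 : (⟨r' - l' - s, by omega⟩ : Fin (r' + 1)) = 0 := by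
                ext; simp [heq]
              simp only [kappa]
              rw [if_pos (by omega), h3, Matrix.transpose_apply]
            rw [h2, (P.mem_GO_iff.1 hG).1, Matrix.one_apply_ne, mul_zero]
            intro h3
            obtain ⟨rfl, h4⟩ := Sigma.mk.inj_iff.1 h3
            obtain rfl := eq_of_heq h4
            refine hne ?_
            have : l' = l := Fin.ext (by simp only [hs] at heq; omega)
            rw [this]
          · rw [ih (p - (r' - l')) (by simp only [hs] at hgt; omega) ⟨r', (l', a')⟩ rfl, zero_mul]
        · simp
    exact funext fun x => key _ x rfl
  intro v w h
  refine sub_eq_zero.1 (hker (v - w) ?_)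
  rw [Matrix.sub_vecMul]
  exact sub_eq_zero.2 h

theorem posDef_kappa {G : Matrix P.State (Fin m) ℝ} (hG : G ∈ P.GO)
    {B : Matrix (Fin p × Fin m) (Fin p × Fin m) ℝ} (hB : B.PosDef) :
    (P.kappa G * B * (P.kappa G)ᵀ).PosDef := by
  have := hB.mul_mul_conjTranspose_same (vecMul_kappa_injective hG)
  rwa [Matrix.conjTranspose_eq_transpose_of_trivial] at this

theorem contDiffOn_kappa {E : Type*} [NormedAddCommGroup E] [NormedSpace ℝ E] {s : Set E}
    {f : E → Matrix P.State (Fin m) ℝ} (hf : ContDiffOn ℝ ∞ f s) :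
    ContDiffOn ℝ ∞ (fun x => P.kappa (f x)) s := by
  rw [contDiffOn_matrix]
  intro x c
  unfold kappa
  split_ifs
  · exact contDiffOn_matrix.1 hf _ _
  · exact contDiffOn_const

theorem contDiffOn_det_kappa (N : Matrix (Fin p × Fin m) (Fin p × Fin m) ℝ)
    {s : Set (Matrix P.State (Fin m) ℝ)} :
    ContDiffOn ℝ ∞ (fun G => (P.kappa G * N * (P.kappa G)ᵀ).det) s :=
  (((contDiffOn_kappa contDiffOn_id).matrix_mul contDiffOn_const).matrix_mul
    (contDiffOn_kappa contDiffOn_id).matrix_transpose).matrix_det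

/-- The Rayleigh quotient as a function on the orbit space. -/
def rayleighK (A B : Matrix (Fin p × Fin m) (Fin p × Fin m) ℝ) : P.K → ℝ :=
  Quotient.lift (fun G => P.rayleigh A B G.1) fun G G' h => by
    obtain ⟨U, hU, e⟩ := h
    rw [← e, rayleigh_mul hU]

/-- Both determinants are polynomials in the entries of the ambient matrix, so the quotient formula
is itself the smooth extension where the denominator does not vanish. -/
theorem contMDiff_rayleighK (A : Matrix (Fin p × Fin m) (Fin p × Fin m) ℝ)
    {B : Matrix (Fin p × Fin m) (Fin p × Fin m) ℝ} (hB : B.PosDef) :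
    ContMDiff (𝓡 (P.flagDim + P.fibreDim)) 𝓘(ℝ, ℝ) ∞ (rayleighK (P := P) A B) := by
  rw [← contMDiffOn_univ, P.isSmoothQuotient_K.smooth_iff _ isOpen_univ]
  intro G _
  refine ⟨{N | (P.kappa N * B * (P.kappa N)ᵀ).det ≠ 0}, ?_, (posDef_kappa G.2 hB).det_pos.ne',
    P.rayleigh A B, ?_, fun _ _ _ => rfl⟩
  · exact isOpen_ne_fun (contDiffOn_univ.1 (contDiffOn_det_kappa B)).continuous continuous_const
  · exact (contDiffOn_det_kappa A).div (contDiffOn_det_kappa B) fun _ h => h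

end StructParam

/-! ### Boundedness of quotients of determinants -/

section DetQuotient

variable {σ ι : Type*} [Fintype ι] [DecidableEq σ]

theorem abs_le_one_of_mul_transpose_eq_one {W : Matrix σ ι ℝ} (h : W * Wᵀ = 1) (a : σ) (i : ι) :
    |W a i| ≤ 1 := by
  have h1 := congrFun (congrFun h a) a
  rw [Matrix.mul_apply, Matrix.one_apply_eq] at h1
  rw [← sq_le_one_iff_abs_le_one, ← h1]
  refine le_trans (le_of_eq ?_) (Finset.single_le_sum (f := fun j => W a j * Wᵀ j a)
    (fun j _ => mul_self_nonneg _) (Finset.mem_univ i))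
  exact sq _

theorem abs_mul_mul_transpose_le {W : Matrix σ ι ℝ} (h : W * Wᵀ = 1) (A : Matrix ι ι ℝ)
    (a b : σ) : |(W * A * Wᵀ) a b| ≤ ∑ j, ∑ i, |A i j| := by
  rw [Matrix.mul_apply]
  refine (Finset.abs_sum_le_sum_abs _ _).trans (Finset.sum_le_sum fun j _ => ?_)
  rw [abs_mul, Matrix.mul_apply]
  refine (mul_le_of_le_one_right (abs_nonneg _)
    (abs_le_one_of_mul_transpose_eq_one h b j)).trans ?_
  refine (Finset.abs_sum_le_sum_abs _ _).trans (Finset.sum_le_sum fun i _ => ?_)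
  rw [abs_mul]
  exact mul_le_of_le_one_left (abs_nonneg _) (abs_le_one_of_mul_transpose_eq_one h a i)

variable [Fintype σ]

open scoped MatrixOrder in
theorem Matrix.PosDef.exists_eq_transpose_mul_self {M : Matrix σ σ ℝ} (hM : M.PosDef) :
    ∃ S : Matrix σ σ ℝ, M = Sᵀ * S ∧ IsUnit S.det := by
  obtain ⟨S, hS⟩ := CStarAlgebra.nonneg_iff_eq_star_mul_self.mp hM.posSemidef.nonneg
  rw [Matrix.star_eq_conjTranspose, Matrix.conjTranspose_eq_transpose_of_trivial] at hS
  refine ⟨S, hS, isUnit_iff_ne_zero.2 fun h => ?_⟩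
  have := hM.det_pos
  rw [hS, Matrix.det_mul, h, mul_zero] at this
  exact this.false

/-- Write `B = Tᵀ T` and `κ B κᵀ = Sᵀ S`. Then `W = (S⁻¹)ᵀ κ Tᵀ` has orthonormal rows and the
quotient equals `det (W A' Wᵀ)`, where `A'` does not depend on `κ`. -/
theorem exists_abs_det_div_det_le [DecidableEq ι] (A : Matrix ι ι ℝ) {B : Matrix ι ι ℝ}
    (hB : B.PosDef) :
    ∃ c : ℝ, ∀ κ : Matrix σ ι ℝ, (κ * B * κᵀ).PosDef →
      |(κ * A * κᵀ).det / (κ * B * κᵀ).det| ≤ c := by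
  obtain ⟨T, hT, hTu⟩ := hB.exists_eq_transpose_mul_self
  set A' := (T⁻¹)ᵀ * A * T⁻¹ with hA'
  have hTT : T⁻¹ * T = 1 := Matrix.nonsing_inv_mul _ hTu
  have hTT' : Tᵀ * (T⁻¹)ᵀ = 1 := by rw [← Matrix.transpose_mul, hTT, Matrix.transpose_one]
  -- The entries of `W A' Wᵀ` are at most the sum of the `|A' i j|`, and a determinant of size `n`
  -- with entries at most `x` is at most `n! xⁿ`.
  refine ⟨(Fintype.card σ).factorial • (∑ j, ∑ i, |A' i j|) ^ Fintype.card σ, fun κ hκ => ?_⟩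
  obtain ⟨S, hS, hSu⟩ := hκ.exists_eq_transpose_mul_self
  have hSS : S * S⁻¹ = 1 := Matrix.mul_nonsing_inv _ hSu
  have hSS' : (S⁻¹)ᵀ * Sᵀ = 1 := by rw [← Matrix.transpose_mul, hSS, Matrix.transpose_one]
  set W := (S⁻¹)ᵀ * κ * Tᵀ with hW
  have hWt : Wᵀ = T * κᵀ * S⁻¹ := by
    simp only [hW, Matrix.transpose_mul, Matrix.transpose_transpose, Matrix.mul_assoc]
  have hWW : W * Wᵀ = 1 := by
    calc W * Wᵀ = (S⁻¹)ᵀ * (κ * (Tᵀ * T) * κᵀ) * S⁻¹ := by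
          rw [hWt, hW]; simp only [Matrix.mul_assoc]
      _ = (S⁻¹)ᵀ * Sᵀ * (S * S⁻¹) := by rw [← hT, hS]; simp only [Matrix.mul_assoc]
      _ = 1 := by rw [hSS', hSS, Matrix.one_mul]
  have hWA : W * A' * Wᵀ = (S⁻¹)ᵀ * (κ * A * κᵀ) * S⁻¹ := by
    calc W * A' * Wᵀ = (S⁻¹)ᵀ * (κ * ((Tᵀ * (T⁻¹)ᵀ) * A * (T⁻¹ * T)) * κᵀ) * S⁻¹ := by
          rw [hWt, hW, hA']; simp only [Matrix.mul_assoc]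
      _ = _ := by rw [hTT', hTT, Matrix.one_mul, Matrix.mul_one]
  have hdet : (κ * A * κᵀ).det / (κ * B * κᵀ).det = (W * A' * Wᵀ).det := by
    have h1 := congrArg Matrix.det hSS
    rw [Matrix.det_mul, Matrix.det_one] at h1
    rw [div_eq_iff hκ.det_pos.ne', hWA, hS]
    simp only [Matrix.det_mul, Matrix.det_transpose]
    -- With `u = det S * det S⁻¹`, the claim is `u ^ 2 = 1` times a determinant, and `u ^ 2 - 1 = (u
    -- + 1) * (u - 1)`.
    linear_combination (-((κ * A * κᵀ).det) * (S.det * S⁻¹.det + 1)) * h1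
  rw [hdet]
  exact Matrix.det_le (abv := AbsoluteValue.abs) fun a b => abs_mul_mul_transpose_le hWW A' a b

end DetQuotient

/-! ### The dimension formula -/

section Dimension

variable (d : ℕ → ℤ)

/-- `d j` lies in the tails starting at `1, …, j`, so it is counted `j` times. -/
theorem sum_sum_Icc_tail (p : ℕ) :
    ∑ i ∈ Finset.Icc 1 p, ∑ j ∈ Finset.Icc i p, d j = ∑ j ∈ Finset.Icc 1 p, (j : ℤ) * d j := by
  induction p with
  | zero => simp
  | succ p ih =>
    have : ∀ i ∈ Finset.Icc 1 p, ∑ j ∈ Finset.Icc i (p + 1), d j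
        = ∑ j ∈ Finset.Icc i p, d j + d (p + 1) := fun i hi => by
      rw [Finset.mem_Icc] at hi
      exact Finset.sum_Icc_succ_top (by omega) _
    rw [Finset.sum_Icc_succ_top (by omega) fun i => ∑ j ∈ Finset.Icc i (p + 1), d j,
      Finset.sum_Icc_succ_top (by omega) fun j => (j : ℤ) * d j, ← ih,
      Finset.Icc_self, Finset.sum_singleton, Finset.sum_congr rfl this, Finset.sum_add_distrib,
      Finset.sum_const, Nat.card_Icc, nsmul_eq_mul]
    push_cast
    ring

/-- `d j` is counted `p - j` times. -/
theorem sum_partial_sums (p : ℕ) :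
    ∑ l ∈ Finset.Icc 1 p, ∑ j ∈ Finset.range (p + 1 - l), d j
      = p * ∑ j ∈ Finset.range (p + 1), d j - ∑ j ∈ Finset.Icc 1 p, (j : ℤ) * d j := by
  have h : ∑ l ∈ Finset.Icc 1 p, ∑ j ∈ Finset.range (p + 1 - l), d j
      = ∑ k ∈ Finset.range p, ∑ j ∈ Finset.range (k + 1), d j := by
    rw [← Finset.sum_range_reflect, ← Finset.Ico_add_one_right_eq_Icc,
      Finset.sum_Ico_eq_sum_range, Nat.add_sub_cancel]
    refine Finset.sum_congr rfl fun l hl => ?_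
    rw [Finset.mem_range] at hl
    congr 2
    omega
  rw [h]
  clear h
  induction p with
  | zero => simp
  | succ p ih =>
    rw [Finset.sum_range_succ, ih, Finset.sum_Icc_succ_top (by omega),
      Finset.sum_range_succ _ (p + 1)]
    push_cast
    ring

/-- Put `D = ∑_{j ≤ p} d j`, `N = ∑_{j ≤ p} j * d j` and `e = d (p + 1)`. In passing from `p` to `p
+ 1` both sides grow by `e * ((p + 1) * D - N)`: on the right `e * D` comes from the flags and `e *
(p * D - N)` from the fibre. -/
theorem dimension_formula (p : ℕ) :
    (∑ j ∈ Finset.range (p + 1), d j) * ∑ j ∈ Finset.Icc 1 p, (j : ℤ) * d j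
        - ∑ i ∈ Finset.Icc 1 p, (∑ j ∈ Finset.Icc i p, d j) ^ 2
      = ∑ i ∈ Finset.range (p + 1), ∑ j ∈ Finset.range i, d i * d j
        + ∑ r ∈ Finset.Icc 1 p, d r * ∑ l ∈ Finset.Icc 1 (r - 1),
          ∑ j ∈ Finset.range (r - l), d j := by
  induction p with
  | zero => simp
  | succ p ih =>
    have h1 : ∀ i ∈ Finset.Icc 1 p, (∑ j ∈ Finset.Icc i (p + 1), d j) ^ 2
        = (∑ j ∈ Finset.Icc i p, d j) ^ 2 + 2 * d (p + 1) * ∑ j ∈ Finset.Icc i p, d j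
          + d (p + 1) ^ 2 := fun i hi => by
      rw [Finset.mem_Icc] at hi
      rw [Finset.sum_Icc_succ_top (by omega)]
      ring
    rw [Finset.sum_range_succ _ (p + 1), Finset.sum_Icc_succ_top (by omega),
      Finset.sum_Icc_succ_top (by omega), Finset.sum_congr rfl h1, Finset.sum_add_distrib,
      Finset.sum_add_distrib, ← Finset.mul_sum, sum_sum_Icc_tail, Finset.Icc_self,
      Finset.sum_singleton, Finset.sum_const, Nat.card_Icc, nsmul_eq_mul,
      Finset.sum_range_succ _ (p + 1), Finset.sum_Icc_succ_top (by omega), Nat.add_sub_cancel,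
      sum_partial_sums, ← Finset.mul_sum]
    push_cast
    linear_combination ih

end Dimension

/-! ### Dimension of the orbit space, vanishing of the fibre, boundedness. -/

namespace StructParam

variable {p m : ℕ} (P : StructParam p m)

theorem dim_eq : ((P.flagDim + P.fibreDim : ℕ) : ℤ)
    = m * ∑ j ∈ Finset.Icc 1 p, (j : ℤ) * P.d j
      - ∑ i ∈ Finset.Icc 1 p, (∑ j ∈ Finset.Icc i p, (P.d j : ℤ)) ^ 2 := by
  have h := dimension_formula (fun j => (P.d j : ℤ)) p
  rw [← Nat.cast_sum, P.sum_eq] at h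
  rw [h, flagDim, fibreDim]
  push_cast
  rfl

variable {P}

/-- An entry of `C_{r,l,j}` exists only if `d_r` and `d_j` are positive with `0 < l` and `j ≤ r - l
- 1`, hence `r ≥ j + 2`. Each of the two cases excludes this. -/
theorem subsingleton_coef (h : p = 1 ∨ (P.d 0 = 0 ∧
    ∀ i j, 1 ≤ j → j + 2 ≤ i → i ≤ p → P.d i = 0 ∨ P.d j = 0)) : Subsingleton P.Coef := by
  refine ⟨fun C C' => ?_⟩
  funext r a ⟨l, j, b⟩
  exfalso
  have hr := r.2
  have hl := l.2
  have hj := j.2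
  have ha := a.2
  have hb : 0 < P.d j := lt_of_le_of_lt (Nat.zero_le _) b.2
  rcases h with h | ⟨h0, h⟩
  · omega
  · rcases Nat.eq_zero_or_pos (j : ℕ) with hj0 | hj0
    · rw [hj0] at hb
      omega
    · rcases h (r + 1) j hj0 (by omega) (by omega) with h | h <;> omega

theorem exists_abs_rayleighK_le (A : Matrix (Fin p × Fin m) (Fin p × Fin m) ℝ)
    {B : Matrix (Fin p × Fin m) (Fin p × Fin m) ℝ} (hB : B.PosDef) :
    ∃ c : ℝ, ∀ x, |rayleighK (P := P) A B x| ≤ c := by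
  obtain ⟨c, hc⟩ := exists_abs_det_div_det_le (σ := P.State) A hB
  refine ⟨c, fun x => ?_⟩
  obtain ⟨G, rfl⟩ := P.toK_surjective x
  exact hc _ (posDef_kappa G.2 hB)

end StructParam

end

/-! ### Assembly of the theorem. -/

theorem mainTheorem6 (p m : ℕ) (P : StructParam p m) :
    -- `𝒬` is isomorphic to `O(l_1) × ⋯ × O(l_g)`, and it acts on `𝒢𝒪`
    (∃ e : P.Q ≃ₜ* ((r : {r : Fin p // 0 < P.d (r + 1)}) →
        Matrix.orthogonalGroup (Fin (P.d (r.1 + 1))) ℝ),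
      ∀ U r, ((e U r : Matrix.orthogonalGroup (Fin (P.d (r.1 + 1))) ℝ) : Matrix _ _ ℝ)
        = P.diagBlk ((U : (Matrix P.State P.State ℝ)ˣ) : Matrix P.State P.State ℝ) r.1) ∧
    (∀ U ∈ P.Q, ∀ G ∈ P.GO, (U : Matrix P.State P.State ℝ) * G ∈ P.GO) ∧
    -- the configurations are the matrices represented by pairs `(C, O)`
    (∀ G : Matrix P.State (Fin m) ℝ, G ∈ P.GO ↔
      ∃ (C : P.Coef) (O : Matrix.orthogonalGroup (Fin m) ℝ), P.build C O.1 = G) ∧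
    -- the map to `O(m) / O(m - 𝔩)` is well defined
    ∃ τ : P.GO → P.Stiefel,
      (∀ (G : P.GO) (C : P.Coef) (O : Matrix.orthogonalGroup (Fin m) ℝ),
        P.build C O.1 = G.1 → τ G = P.toStiefel O) ∧
    -- it induces a map `π : 𝒢𝒪 / 𝒬 → ℱ`
    ∃ π : P.K → P.Flag, (∀ G : P.GO, π (P.toK G) = P.stiefelToFlag (τ G)) ∧
    -- the two expressions for the dimension of `𝒦`
    ∃ n : ℕ,
      (n : ℤ) = m * ∑ j ∈ Finset.Icc 1 p, (j : ℤ) * P.d j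
        - ∑ i ∈ Finset.Icc 1 p, (∑ j ∈ Finset.Icc i p, (P.d j : ℤ)) ^ 2 ∧
      n = P.flagDim + P.fibreDim ∧
    -- `ℱ` and `𝒦` are smooth manifolds, with the quotient structures
    ∃ (_ : ChartedSpace (EuclideanSpace ℝ (Fin P.flagDim)) P.Flag)
      (_ : ChartedSpace (EuclideanSpace ℝ (Fin n)) P.K),
      IsSmoothQuotient P.flagDim
        (fun O : Matrix.orthogonalGroup (Fin m) ℝ => (O : Matrix (Fin m) (Fin m) ℝ)) P.toFlag ∧
      IsSmoothQuotient n (fun G : P.GO => (G : Matrix P.State (Fin m) ℝ)) P.toK ∧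
    -- `π : 𝒦 → ℱ` is a smooth vector bundle with fibre `P.Coef`
      (∃ (_ : ∀ b, AddCommGroup (StructParam.Fibre π b))
        (_ : ∀ b, Module ℝ (StructParam.Fibre π b))
        (_ : FiberBundle P.Coef (StructParam.Fibre π))
        (_ : VectorBundle ℝ P.Coef (StructParam.Fibre π)),
        ContMDiffVectorBundle ∞ P.Coef (StructParam.Fibre π) (𝓡 P.flagDim) ∧
        (∃ Φ : Bundle.TotalSpace P.Coef (StructParam.Fibre π)
            ≃ₘ^∞⟮(𝓡 P.flagDim).prod 𝓘(ℝ, P.Coef), 𝓡 n⟯ P.K,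
          ∀ z, Φ z = z.2.1) ∧
        (∀ O : Matrix.orthogonalGroup (Fin m) ℝ,
          ∃ L : P.Coef ≃ₗ[ℝ] StructParam.Fibre π (P.toFlag O),
            ∀ (C : P.Coef) (G : P.GO), P.build C O.1 = G.1 → (L C).1 = P.toK G) ∧
        Module.finrank ℝ P.Coef = P.fibreDim) ∧
    -- cases in which the fibre is zero and `𝒦` is identified with `ℱ`
      ((p = 1 ∨ (P.d 0 = 0 ∧
          ∀ i j, 1 ≤ j → j + 2 ≤ i → i ≤ p → P.d i = 0 ∨ P.d j = 0)) →
        ∃ Φ : P.K ≃ₘ^∞⟮𝓡 n, 𝓡 P.flagDim⟯ P.Flag, ∀ x, Φ x = π x) ∧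
    -- the generalized Rayleigh quotient is a bounded smooth function on `𝒦`
      (∀ A B : Matrix (Fin p × Fin m) (Fin p × Fin m) ℝ, A.IsSymm → B.PosDef →
        (∀ G ∈ P.GO, (P.kappa G * B * (P.kappa G)ᵀ).det ≠ 0) ∧
        ∃ R : P.K → ℝ, (∀ G : P.GO, R (P.toK G) = P.rayleigh A B G.1) ∧
          ContMDiff (𝓡 n) 𝓘(ℝ, ℝ) ∞ R ∧ ∃ c : ℝ, ∀ x, |R x| ≤ c) := by
  refine ⟨⟨P.groupEquiv, fun U r => rfl⟩, fun U hU G hG => StructParam.mul_mem_GO hU hG,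
    P.mem_GO_iff_exists_build, StructParam.toStiefelOfGO,
    fun G C O h => StructParam.toStiefelOfGO_eq h, P.proj, fun G => rfl,
    P.flagDim + P.fibreDim, P.dim_eq, rfl, inferInstance, inferInstance,
    P.isSmoothQuotient_flag, P.isSmoothQuotient_K,
    ⟨fun _ => inferInstance, fun _ => inferInstance, inferInstance, inferInstance, inferInstance,
      ⟨P.totalDiffeo, fun z => rfl⟩,
      fun O => ⟨StructParam.fibreLinearEquiv O rfl, fun C G h => congrArg P.toK (Subtype.ext h)⟩,
      P.finrank_coef⟩,
    fun h => ?_, fun A B _ hB => ⟨fun G hG => (StructParam.posDef_kappa hG hB).det_pos.ne',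
      StructParam.rayleighK A B, fun G => rfl, StructParam.contMDiff_rayleighK A hB,
      StructParam.exists_abs_rayleighK_le A hB⟩⟩
  have := StructParam.subsingleton_coef h
  exact ⟨P.projDiffeo, fun x => rfl⟩
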